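/- Fix $\alpha\ge 0$ and a probability measure $\mu$ on $[0,1]$, and let $f(k)=k+\alpha$ for $k\ge 1$. **Model.** The random trees $\mathcal T(n)$, $n\ge 1$, on the vertices $v_1,\dots,v_n$, rooted at $v_1$, grow as follows. $\mathcal T(1)$ is the single vertex $v_1$, $\mathcal T(2)$ consists of $v_1,v_2$ joined by an edge, and $\mathcal T(0):=\mathcal T(1)$. Given $\mathcal T(1),\dots,\mathcal T(n)$, $n\ge 2$, a delay $\xi_{n+1}\sim\mu$ independent of them is drawn; put $m=\lfloor n-n\xi_{n+1}\rfloor$. The new vertex $v_{n+1}$ is attached to a vertex $v$ of $\mathcal T(m)$ chosen with probability proportional to $f(\deg(v,m))$, where $\deg(v,m)$ is the degree of $v$ in $\mathcal T(m)$ (and $\deg(v_1,1):=1$). Let $N_k(n)$ be the number of vertices of degree $k$ in $\mathcal T(n)$. **Fringe convergence.** Let $\mathbb T$ be the set of finite rooted trees up to root-preserving isomorphism, with the metric $d(\mathbf t,\mathbf s)=1/(1+R^*)$, $R^*=\sup\{r: B(\mathbf t,r)\simeq B(\mathbf s,r)\}$, where $B(\mathbf t,r)$ is the subtree of vertices within distance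 $r$ of the root. The fringe of $\mathbf t$ at $v$ is the subtree, rooted at $v$, of all vertices whose path to the root passes through $v$. The empirical fringe distribution $\mathfrak P_n$ is the law on $\mathbb T$ of the fringe of $\mathcal T(n)$ at a uniformly chosen vertex, given $\mathcal T(n)$. The trees $\mathcal T(n)$ converge in the expected fringe sense to a probability measure $\varpi$ on $\mathbb T$ if $\mathbb E(\mathfrak P_n)\to\varpi$ weakly. **Limit.** Let $\eta=-\log(1-\xi)\in[0,\infty]$ with $\xi\sim\mu$, and let $F_\eta$ be its law. Random variables $\mathscr E_{0\leadsto 1},\mathscr E_{1\leadsto 2},\dots\in[0,\infty]$, with $\sigma_i=\sum_{j=1}^i\mathscr E_{j-1\leadsto j}$ and $\sigma_0=0$, are defined recursively: given $\sigma_1,\dots,\sigma_i$ (all finite), $$\mathbb P(\mathscr E_{i\leadsto i+1}>s\mid \sigma_1,\dots,\sigma_i)=\exp\Big(-\int_0^s h_{i\leadsto i+1}(x)\,dx\Big),\qquad s\ge 0,$$ $$h_{i\leadsto i+1}(x)=\frac1{2+\alpha}\Big[\sum_{j=1}^{i}\int_{(x+\sigma_i-\sigma_j,\;x+\sigma_i-\sigma_{j-1}]}(j+\alpha)e^u\,dF_\eta(u)+\int_{[0,x]}(i+1+\alpha)e^u\,dF_\eta(u)\Big],$$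 while $\sigma_{i+1}=\infty$ if $\sigma_i=\infty$. Let $\mathrm{BP}_{\mathsf{Mac},\alpha}$ be the continuous-time branching process started from one individual at time $0$ in which the individuals have children at ages given by independent copies of $(\sigma_1,\sigma_2,\dots)$ (an infinite $\sigma_i$ means no $i$-th child). Let $T_1$ be a rate one exponential variable independent of it, and let $\varpi_{\mathsf{Mac},\alpha}$ be the law on $\mathbb T$ of the genealogical tree of the individuals born by time $T_1$. **Theorem.** The population of $\mathrm{BP}_{\mathsf{Mac},\alpha}$ at time $T_1$ is almost surely finite, so that $\varpi_{\mathsf{Mac},\alpha}$ is a probability measure on $\mathbb T$, and the trees $\mathcal T(n)$ converge in the expected fringe sense to $\varpi_{\mathsf{Mac},\alpha}$ as $n\to\infty$. In particular, for every $k\ge 1$, $$\mathbb E\Big(\frac{N_k(n)}n\Big)\longrightarrow p_{\mathsf{Mac},\alpha}(k):=\mathbb P\big(\sigma_{k-1}\le T_1<\sigma_k\big),$$ where $T_1$ is a rate one exponential variable independent of $(\mathscr E_{j-1\leadsto j})_{j\ge 1}$. -/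

import Mathlib

open MeasureTheory ProbabilityTheory Filter Topology
open scoped ENNReal NNReal unitInterval

/-! ## Finite rooted trees, their fringes, and the space of unlabelled finite rooted trees -/

/-- A finite rooted tree: a finite vertex set with a root and a parent map along which every vertex
reaches the root (the edges are `{v, parent v}`, `v ≠ root`; by convention the root is its own
parent). -/
structure FinRootedTree where
  V : Type
  finite_V : Finite V
  root : V
  parent : V → V
  parent_root : parent root = root
  reaches_root : ∀ v, ∃ k, parent^[k] v = root

namespace FinRootedTree

/-- Root preserving isomorphism: a bijection of the vertex sets that matches roots and parents. -/
def Iso (t s : FinRootedTree) : Prop :=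
  ∃ e : t.V ≃ s.V, e t.root = s.root ∧ ∀ v, e (t.parent v) = s.parent (e v)

instance isoSetoid : Setoid FinRootedTree where
  r := Iso
  iseqv :=
    { refl := fun t => ⟨Equiv.refl _, rfl, fun _ => rfl⟩
      symm := by
        rintro t s ⟨e, h0, h⟩
        refine ⟨e.symm, ?_, fun v => ?_⟩
        · rw [← h0, Equiv.symm_apply_apply]
        · rw [Equiv.symm_apply_eq, h, Equiv.apply_symm_apply]
      trans := by
        rintro t s u ⟨e, h0, h⟩ ⟨e', h0', h'⟩
        exact ⟨e.trans e', by simp [h0, h0'], fun v => by simp [h, h']⟩ }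

lemma iterate_parent_root (t : FinRootedTree) (k : ℕ) : t.parent^[k] t.root = t.root :=
  Function.iterate_fixed t.parent_root k

/-- The subtree `B(t, r)` of the vertices within graph distance `r` of the root. -/
def ball (t : FinRootedTree) (r : ℕ) : FinRootedTree where
  V := {v : t.V // ∃ k ≤ r, t.parent^[k] v = t.root}
  finite_V := by
    have := t.finite_V
    infer_instance
  root := ⟨t.root, 0, Nat.zero_le r, rfl⟩
  parent v := ⟨t.parent v.1, by
    obtain ⟨v, k, hk, hv⟩ := v
    refine ⟨k, hk, ?_⟩
    rw [← Function.iterate_succ_apply, Function.iterate_succ_apply', hv, t.parent_root]⟩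
  parent_root := Subtype.ext t.parent_root
  reaches_root := by
    rintro ⟨v, k, hk, hv⟩
    exact ⟨k, Subtype.ext ((Function.Semiconj.iterate_right (f := Subtype.val) (gb := t.parent)
      (fun _ => rfl) k _).trans hv)⟩

/-- The fringe `f₀(v, t)` of `t` at `v`: the subtree, rooted at `v`, of all vertices whose path to
the root of `t` passes through `v`. -/
noncomputable def fringe (t : FinRootedTree) (v : t.V) : FinRootedTree where
  V := {w : t.V // ∃ k, t.parent^[k] w = v}
  finite_V := by
    have := t.finite_V
    infer_instance
  root := ⟨v, 0, rfl⟩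
  parent w := by
    classical
    exact if h : w.1 = v then w else ⟨t.parent w.1, by
      obtain ⟨w, k, hk⟩ := w
      cases k with
      | zero => exact absurd hk h
      | succ k => exact ⟨k, hk⟩⟩
  parent_root := by simp
  reaches_root := by
    rintro ⟨w, k, hk⟩
    induction k generalizing w with
    | zero => exact ⟨0, Subtype.ext hk⟩
    | succ k ih =>
      by_cases h : w = v
      · exact ⟨0, Subtype.ext h⟩
      · obtain ⟨m, hm⟩ := ih (t.parent w) hk
        refine ⟨m + 1, ?_⟩
        rw [Function.iterate_succ_apply, dif_neg h]
        exact hm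

/-- The tree with a single vertex. -/
def single : FinRootedTree where
  V := Unit
  finite_V := inferInstance
  root := ()
  parent := id
  parent_root := rfl
  reaches_root := fun _ => ⟨0, rfl⟩

end FinRootedTree

/-- The space `𝕋` of finite rooted trees, up to root preserving isomorphism. -/
def TreeSpace : Type 1 := Quotient FinRootedTree.isoSetoid

namespace TreeSpace

/-- The class of a finite rooted tree. -/
def mk (t : FinRootedTree) : TreeSpace := Quotient.mk _ t

/-- `B(·, r)` on isomorphism classes. -/
def ball (r : ℕ) : TreeSpace → TreeSpace :=
  Quotient.map (fun t => t.ball r) (by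
    rintro t s ⟨e, h0, h⟩
    have hit : ∀ k v, e (t.parent^[k] v) = s.parent^[k] (e v) := fun k v =>
      Function.Semiconj.iterate_right (f := e) h k v
    refine ⟨e.subtypeEquiv fun v => ?_, Subtype.ext h0, fun v => Subtype.ext (h v.1)⟩
    simp only [← hit, ← h0, e.injective.eq_iff])

/-- `R*(t, s) = sup {r : B(t, r) ≃ B(s, r)} ∈ [0, ∞]`. -/
noncomputable def agreementRadius (t s : TreeSpace) : ℝ≥0∞ :=
  ⨆ r ∈ {r : ℕ | ball r t = ball r s}, (r : ℝ≥0∞)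

lemma ball_ball {r r' : ℕ} (h : r' ≤ r) (t : TreeSpace) : ball r' (ball r t) = ball r' t := by
  induction t using Quotient.inductionOn with | _ t =>
  refine Quotient.sound ⟨⟨fun v => ⟨v.1.1, ?_⟩, fun v => ⟨⟨v.1, ?_⟩, ?_⟩, fun _ => rfl,
    fun _ => rfl⟩, rfl, fun _ => rfl⟩
  · obtain ⟨v, k, hk, hv⟩ := v
    refine ⟨k, hk, ?_⟩
    have := congrArg Subtype.val hv
    rw [← Function.Semiconj.iterate_right (f := Subtype.val) (ga := (t.ball r).parent)
      (gb := t.parent) (fun _ => rfl) k v]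
    exact this
  · obtain ⟨v, k, hk, hv⟩ := v
    exact ⟨k, hk.trans h, hv⟩
  · obtain ⟨v, k, hk, hv⟩ := v
    refine ⟨k, hk, Subtype.ext ?_⟩
    exact (Function.Semiconj.iterate_right (f := Subtype.val) (ga := (t.ball r).parent)
      (gb := t.parent) (fun _ => rfl) k _).trans hv

lemma ball_eq_mono {r r' : ℕ} (h : r' ≤ r) {t s : TreeSpace} (hr : ball r t = ball r s) :
    ball r' t = ball r' s := by
  rw [← ball_ball h t, hr, ball_ball h s]

lemma exists_ball_eq_self (t : TreeSpace) : ∃ N, ∀ r ≥ N, ball r t = t := by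
  induction t using Quotient.inductionOn with | _ t =>
  have := t.finite_V
  choose k hk using t.reaches_root
  obtain ⟨N, hN⟩ := (Set.finite_range k).bddAbove
  refine ⟨N, fun r hr => Quotient.sound ⟨Equiv.subtypeUnivEquiv fun v =>
    ⟨k v, (hN ⟨v, rfl⟩).trans hr, hk v⟩, rfl, fun _ => rfl⟩⟩

lemma min_agreementRadius_le (t s u : TreeSpace) :
    min (agreementRadius t s) (agreementRadius s u) ≤ agreementRadius t u := by
  refine le_of_forall_lt fun c hc => ?_
  obtain ⟨h1, h2⟩ := lt_min_iff.1 hc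
  simp only [agreementRadius, lt_iSup_iff] at h1 h2 ⊢
  obtain ⟨r, hr, hcr⟩ := h1
  obtain ⟨r', hr', hcr'⟩ := h2
  refine ⟨min r r', ?_, ?_⟩
  · exact (ball_eq_mono (min_le_left _ _) hr).trans (ball_eq_mono (min_le_right _ _) hr')
  · rcases min_choice r r' with h | h <;> rw [h] <;> assumption

/-- The metric `d(t, s) = 1 / (1 + R*(t, s))` on `𝕋`. -/
noncomputable instance : EMetricSpace TreeSpace where
  edist t s := (1 + agreementRadius t s)⁻¹
  edist_self t := by
    have : agreementRadius t t = ⊤ := by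
      refine ENNReal.eq_top_of_forall_nnreal_le fun x => ?_
      obtain ⟨n, hn⟩ := exists_nat_ge x
      refine le_trans ?_ (le_iSup₂_of_le n rfl le_rfl)
      exact_mod_cast hn
    simp [this]
  edist_comm t s := by
    simp only [agreementRadius, eq_comm]
  edist_triangle t s u := by
    refine le_trans ?_ (max_le_add_of_nonneg (zero_le) (zero_le))
    have h := min_agreementRadius_le t s u
    rcases min_choice (agreementRadius t s) (agreementRadius s u) with h' | h' <;> rw [h'] at h
    · exact le_max_of_le_left (ENNReal.inv_le_inv.2 (by gcongr))
    · exact le_max_of_le_right (ENNReal.inv_le_inv.2 (by gcongr))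
  eq_of_edist_eq_zero := by
    intro t s h
    have h' : agreementRadius t s = ⊤ := by simpa using h
    obtain ⟨N, hN⟩ := exists_ball_eq_self t
    obtain ⟨M, hM⟩ := exists_ball_eq_self s
    have h2 : ((max N M : ℕ) : ℝ≥0∞) < agreementRadius t s := by
      rw [h']
      exact ENNReal.natCast_lt_top _
    simp only [agreementRadius, lt_iSup_iff] at h2
    obtain ⟨r, hr, hlt⟩ := h2
    have hlt' : max N M < r := by exact_mod_cast hlt
    have : ball r t = ball r s := hr
    rwa [hN r ((le_max_left _ _).trans hlt'.le), hM r ((le_max_right _ _).trans hlt'.le)] at this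

noncomputable instance : MeasurableSpace TreeSpace := borel TreeSpace

instance : BorelSpace TreeSpace := ⟨rfl⟩

end TreeSpace

/-- The empirical fringe distribution `|t|⁻¹ ∑_{v ∈ t} δ_{f₀(v, t)}` of a finite rooted tree. -/
noncomputable def FinRootedTree.empiricalFringe (t : FinRootedTree) : Measure TreeSpace :=
  (Nat.card t.V : ℝ≥0∞)⁻¹ • Measure.sum fun v : t.V => Measure.dirac (TreeSpace.mk (t.fringe v))

/-- The expected empirical fringe distribution of a random finite rooted tree. -/
noncomputable def expectedFringe {Ω : Type*} [MeasurableSpace Ω] (P : Measure Ω)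
    (T : Ω → FinRootedTree) : Measure TreeSpace :=
  P.bind fun ω => (T ω).empiricalFringe

/-- Convergence of random finite rooted trees in expectation, in the fringe sense, to `ϖ`: the
expected empirical fringe distributions and `ϖ` are probability measures on `𝕋`, and the former
converge weakly to the latter. -/
def TendstoExpectedFringe {Ω : Type*} [MeasurableSpace Ω] (P : Measure Ω)
    (T : ℕ → Ω → FinRootedTree) (ϖ : Measure TreeSpace) : Prop :=
  ∃ (hT : ∀ n, IsProbabilityMeasure (expectedFringe P (T n))) (hϖ : IsProbabilityMeasure ϖ),
    Tendsto (β := ProbabilityMeasure TreeSpace) (fun n => ⟨expectedFringe P (T n), hT n⟩) atTop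
      (𝓝 ⟨ϖ, hϖ⟩)

/-! ## Network evolution with macroscopic delay and affine attachment function

Vertices are labelled `0, 1, 2, …` in the order of arrival, so that `𝒯(n)` has the vertices
`0, …, n - 1` and the root is `0`. -/

/-- The history of a growing tree: `ω i` is the parent of the vertex `i + 1`, which is one of the
vertices `0, …, i`. -/
abbrev ParentSeq : Type := (i : ℕ) → Fin (i + 1)

namespace ParentSeq

/-- The tree `𝒯(n + 1)`, with the vertices `0, …, n` and the root `0`. -/
def tree (n : ℕ) (ω : ParentSeq) : FinRootedTree where
  V := Fin (n + 1)
  finite_V := inferInstance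
  root := 0
  parent := Fin.cases 0 fun i : Fin n => ⟨ω i, by omega⟩
  parent_root := rfl
  reaches_root := by
    rintro ⟨v, hv⟩
    induction v using Nat.strong_induction_on with | _ v ih =>
    cases v with
    | zero => exact ⟨0, rfl⟩
    | succ v =>
      obtain ⟨k, hk⟩ := ih (ω v) (by omega) (by omega)
      exact ⟨k + 1, hk⟩

/-- The degree of the vertex `v` in `𝒯(m)`: it is `0` before the arrival of `v`, it is initialized
to `1` at the arrival of `v`, and afterwards it is the number of children of `v` in `𝒯(m)`, plus
one for the edge to the parent of `v` if `v` is not the root. -/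
def degree (ω : ParentSeq) (v m : ℕ) : ℕ :=
  if m < v + 1 then 0
  else if m = v + 1 then 1
  else ((Finset.range (m - 1)).filter fun i => (ω i : ℕ) = v).card + if v = 0 then 0 else 1

/-- The number `N_k(n)` of vertices of degree `k` in `𝒯(n)`. -/
def degreeCount (ω : ParentSeq) (k n : ℕ) : ℕ :=
  ((Finset.range n).filter fun v => ω.degree v n = k).card

/-- The attractiveness `f(deg(v, m))`, `f(k) = k + α`, of the vertices `v` of `𝒯(m)`; the vertices
that are not in `𝒯(m)` have weight zero. By convention `𝒯(0) = 𝒯(1)`. -/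
noncomputable def weight (α : ℝ≥0) (ω : ParentSeq) (m v : ℕ) : ℝ≥0∞ :=
  if v < max m 1 then (ω.degree v (max m 1) : ℝ≥0∞) + α else 0

lemma one_le_degree_zero (ω : ParentSeq) (m : ℕ) : 1 ≤ ω.degree 0 (max m 1) := by
  unfold degree
  rcases Nat.lt_or_ge 1 m with h | h
  · rw [max_eq_left h.le, if_neg (by omega), if_neg (by omega), if_pos rfl, add_zero]
    refine Finset.card_pos.2 ⟨0, ?_⟩
    have h0 : ω 0 = 0 := Subsingleton.elim (α := Fin 1) _ _
    simp [h, h0]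
  · simp [h]

lemma sum_weight_ne_zero (α : ℝ≥0) (ω : ParentSeq) (m n : ℕ) :
    ∑ v : Fin (n + 2), ω.weight α m v ≠ 0 := by
  intro h
  have h0 := (Finset.sum_eq_zero_iff.1 h) 0 (Finset.mem_univ _)
  have := one_le_degree_zero ω m
  simp [weight] at h0
  omega

lemma sum_weight_ne_top (α : ℝ≥0) (ω : ParentSeq) (m n : ℕ) :
    ∑ v : Fin (n + 2), ω.weight α m v ≠ ⊤ := by
  refine ENNReal.sum_ne_top.2 fun v _ => ?_
  unfold weight
  split_ifs
  · simp
  · simp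

/-- The law of the parent of the vertex `n + 2` given that the tree `𝒯(m)` is the available
information: a vertex `v` of `𝒯(m)` is chosen with probability proportional to its
attractiveness. -/
noncomputable def attachLaw (α : ℝ≥0) (ω : ParentSeq) (n m : ℕ) : Measure (Fin (n + 2)) :=
  ∑ v : Fin (n + 2), (ω.weight α m v / ∑ w : Fin (n + 2), ω.weight α m w) • Measure.dirac v

instance (α : ℝ≥0) (ω : ParentSeq) (n m : ℕ) : IsProbabilityMeasure (attachLaw α ω n m) where
  measure_univ := by
    simp only [attachLaw, Measure.coe_finsetSum, Finset.sum_apply, Measure.smul_apply,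
      measure_univ, smul_eq_mul, mul_one, ENNReal.div_eq_inv_mul]
    rw [← Finset.mul_sum]
    exact ENNReal.inv_mul_cancel (sum_weight_ne_zero α ω m n) (sum_weight_ne_top α ω m n)

/-- Extends a history up to index `n` (that is, the tree `𝒯(n + 2)`) to an infinite sequence in an
arbitrary way. -/
def extend (n : ℕ) (x : (i : Finset.Iic n) → Fin (i + 1)) : ParentSeq :=
  fun i => if h : i ∈ Finset.Iic n then x ⟨i, h⟩ else 0

/-- The step from `𝒯(n + 2)` to `𝒯(n + 3)`: a delay `ξ ∼ μ` is drawn independently of the past, and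
the new vertex uses the tree `𝒯(⌊(n + 2) - (n + 2) ξ⌋)` to choose its parent. -/
noncomputable def stepKernel (μ : Measure I) (α : ℝ≥0) (n : ℕ) :
    Kernel ((i : Finset.Iic n) → Fin (i + 1)) (Fin (n + 1 + 1)) :=
  Kernel.ofFunOfCountable fun x =>
    μ.bind fun ξ => attachLaw α (extend n x) n ⌊((n : ℝ) + 2) - ((n : ℝ) + 2) * (ξ : ℝ)⌋₊

instance (μ : Measure I) [IsProbabilityMeasure μ] (α : ℝ≥0) (n : ℕ) :
    IsMarkovKernel (stepKernel μ α n) where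
  isProbabilityMeasure x := by
    refine ⟨?_⟩
    change (μ.bind _) _ = 1
    have hm : Measurable fun ξ : I =>
        attachLaw α (extend n x) n ⌊((n : ℝ) + 2) - ((n : ℝ) + 2) * (ξ : ℝ)⌋₊ :=
      (Measurable.of_discrete (f := fun m : ℕ => attachLaw α (extend n x) n m)).comp
        (Nat.measurable_floor.comp (by fun_prop))
    rw [Measure.bind_apply MeasurableSet.univ hm.aemeasurable]
    simp

/-- The law `ℒ(β ≡ 1, μ, f(k) = k + α)` of the growing trees: `𝒯(2)` consists of the vertices
`0, 1` and the edge between them, and each later vertex arrives according to `stepKernel`. -/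
noncomputable def networkLaw (μ : Measure I) [IsProbabilityMeasure μ] (α : ℝ≥0) :
    Measure ParentSeq :=
  Kernel.trajMeasure (X := fun i => Fin (i + 1)) (Measure.dirac 0) (stepKernel μ α)

end ParentSeq

/-! ## The limiting branching process -/

namespace BPMac

/-- The transformed delay `η = - log (1 - ξ) ∈ [0, ∞]`. -/
noncomputable def eta (ξ : I) : ℝ≥0∞ :=
  if (ξ : ℝ) < 1 then ENNReal.ofReal (-Real.log (1 - ξ)) else ⊤

lemma measurable_eta : Measurable eta :=
  Measurable.ite (measurableSet_lt measurable_subtype_coe measurable_const)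
    (ENNReal.measurable_ofReal.comp
      (Real.measurable_log.comp (measurable_const.sub measurable_subtype_coe)).neg)
    measurable_const

/-- The law `dF_η` of `η` on `[0, ∞]`. -/
noncomputable def etaLaw (μ : Measure I) : Measure ℝ≥0∞ := μ.map eta

/-- The hazard function
`h_{i ⇝ i+1}(x) = (2+α)⁻¹ [∑_{j=1}^i ∫_{x+σ_i-σ_j}^{x+σ_i-σ_{j-1}} (j+α) e^u dF_η(u)
  + ∫_0^x (i+1+α) e^u dF_η(u)]`
for given `σ_0, …, σ_i`, which are the entries of `s`. An integral from `a > 0` to `b` is over `(a, b]`, and an integral from `0`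
to `x` is over `[0, x]` and includes an atom of `F_η` at `0`. -/
noncomputable def hazard (μ : Measure I) (α : ℝ≥0) (i : ℕ) (s : Fin (i + 1) → ℝ≥0∞) (x : ℝ≥0∞) :
    ℝ≥0∞ :=
  (2 + α : ℝ≥0∞)⁻¹ *
    (∑ j : Fin i, ∫⁻ u in Set.Ioc (x + s (Fin.last i) - s j.succ)
          (x + s (Fin.last i) - s j.castSucc), (((j : ℕ) + 1 : ℝ≥0∞) + α) * EReal.exp u ∂(etaLaw μ)
      + ∫⁻ u in Set.Icc 0 x, ((i : ℝ≥0∞) + 1 + α) * EReal.exp u ∂(etaLaw μ))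

/-- The cumulative hazard `∫_0^s h(x) dx`. -/
noncomputable def cumHazard (h : ℝ≥0∞ → ℝ≥0∞) (s : ℝ) : ℝ≥0∞ :=
  ∫⁻ x in Set.Ioc 0 s, h (ENNReal.ofReal x)

/-- The first time at which the cumulative hazard reaches the level `e`, which is `∞` if this never
happens. If `e` is a rate one exponential variable, then this is a random variable on `[0, ∞]` with
hazard function `h`; see `expMeasure_hazardTime`. -/
noncomputable def hazardTime (h : ℝ≥0∞ → ℝ≥0∞) (e : ℝ) : ℝ≥0∞ :=
  sInf {t : ℝ≥0∞ | t ≠ ⊤ ∧ ENNReal.ofReal e ≤ cumHazard h t.toReal}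

lemma cumHazard_mono (h : ℝ≥0∞ → ℝ≥0∞) : Monotone (cumHazard h) := fun _ _ hst =>
  lintegral_mono_set (Set.Ioc_subset_Ioc_right hst)

lemma lt_hazardTime_iff {h : ℝ≥0∞ → ℝ≥0∞} (hh : ∀ s, cumHazard h s ≠ ⊤) {s : ℝ} (hs : 0 ≤ s)
    (e : ℝ) : ENNReal.ofReal s < hazardTime h e ↔ cumHazard h s < ENNReal.ofReal e := by
  constructor
  · intro hlt
    by_contra hcon
    refine absurd hlt (not_lt.2 (sInf_le ⟨ENNReal.ofReal_ne_top, ?_⟩))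
    rw [ENNReal.toReal_ofReal hs]
    exact not_lt.1 hcon
  · intro hlt
    have hfin : (volume.restrict (Set.Ioc 0 (s + 1))).withDensity
        (fun x => h (ENNReal.ofReal x)) Set.univ ≠ ⊤ := by
      rw [withDensity_apply _ MeasurableSet.univ, Measure.restrict_univ]
      exact hh (s + 1)
    have hcont : ∃ δ > 0, δ ≤ 1 ∧ cumHazard h (s + δ) < ENNReal.ofReal e := by
      obtain ⟨ε, hε, hεe⟩ : ∃ ε > 0, cumHazard h s + ε < ENNReal.ofReal e := by
        obtain ⟨c, hc1, hc2⟩ := exists_between hlt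
        exact ⟨c - cumHazard h s, tsub_pos_of_lt hc1, by rwa [add_tsub_cancel_of_le hc1.le]⟩
      obtain ⟨δ, hδ, hδ'⟩ := exists_pos_setLIntegral_lt_of_measure_lt (hh (s + 1)) hε.ne'
      obtain ⟨d, hd0, hd1⟩ := exists_between (lt_min hδ one_pos)
      have hdtop : d ≠ ⊤ := (hd1.trans_le (min_le_right _ _)).ne_top
      have hd1' : d.toReal ≤ 1 := by
        simpa using ENNReal.toReal_mono ENNReal.one_ne_top (hd1.trans_le (min_le_right _ _)).le
      have hdpos : 0 < d.toReal := ENNReal.toReal_pos hd0.ne' hdtop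
      refine ⟨d.toReal, hdpos, hd1', lt_of_le_of_lt ?_ hεe⟩
      have hsplit : cumHazard h (s + d.toReal) = cumHazard h s
          + ∫⁻ x in Set.Ioc s (s + d.toReal), h (ENNReal.ofReal x) := by
        rw [cumHazard, ← Set.Ioc_union_Ioc_eq_Ioc hs (by linarith), lintegral_union
          measurableSet_Ioc (Set.Ioc_disjoint_Ioc_of_le le_rfl)]
        rfl
      rw [hsplit]
      gcongr
      have hvol : (volume.restrict (Set.Ioc 0 (s + 1))) (Set.Ioc s (s + d.toReal)) < δ := by
        refine lt_of_le_of_lt (Measure.restrict_apply_le _ _) ?_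
        rw [Real.volume_Ioc, add_sub_cancel_left, ENNReal.ofReal_toReal hdtop]
        exact hd1.trans_le (min_le_left _ _)
      have := (hδ' _ hvol).le
      rwa [Measure.restrict_restrict measurableSet_Ioc, Set.inter_eq_left.2] at this
      exact Set.Ioc_subset_Ioc hs (by linarith)
    obtain ⟨δ, hδ, -, hlt'⟩ := hcont
    refine lt_of_lt_of_le ((ENNReal.ofReal_lt_ofReal_iff (by linarith)).2
      (lt_add_of_pos_right s hδ)) (le_sInf ?_)
    rintro t ⟨ht, hte⟩
    rw [ENNReal.ofReal_le_iff_le_toReal ht]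
    by_contra hcon
    exact absurd (hte.trans (cumHazard_mono h (not_le.1 hcon).le)) (not_le.2 hlt')

instance : IsProbabilityMeasure (expMeasure 1) := isProbabilityMeasure_expMeasure one_pos

/-- `P(𝓔 > s) = exp(-∫_0^s h(x) dx)` for `𝓔 = hazardTime h e` with `e ∼ Exp(1)`. -/
theorem expMeasure_hazardTime {h : ℝ≥0∞ → ℝ≥0∞} (hh : ∀ s, cumHazard h s ≠ ⊤) {s : ℝ}
    (hs : 0 ≤ s) : (expMeasure 1).real {e | ENNReal.ofReal s < hazardTime h e} =
      Real.exp (-(cumHazard h s).toReal) := by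
  have hset : {e | ENNReal.ofReal s < hazardTime h e} = (Set.Iic (cumHazard h s).toReal)ᶜ := by
    ext e
    rw [Set.mem_ofPred_eq, lt_hazardTime_iff hh hs, Set.mem_compl_iff, Set.mem_Iic, not_le,
      ENNReal.lt_ofReal_iff_toReal_lt (hh s)]
  rw [hset, measureReal_compl measurableSet_Iic, ← cdf_eq_real, cdf_expMeasure_eq one_pos]
  simp [ENNReal.toReal_nonneg]

/-- The birth times `σ_0 = 0` and `σ_{i+1} = σ_i + 𝓔_{i ⇝ i+1}` of the children of an individual.
Here `e_0, e_1, …` are the independent rate one exponential variables from which the inter-arrival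
times `𝓔_{i ⇝ i+1}` with the hazard functions `h_{i ⇝ i+1}` given `σ_0, …, σ_i` are built. -/
noncomputable def sigma (μ : Measure I) (α : ℝ≥0) (e : ℕ → ℝ) : ℕ → ℝ≥0∞
  | 0 => 0
  | i + 1 => sigma μ α e i +
      hazardTime (hazard μ α i fun j : Fin (i + 1) => sigma μ α e j) (e i)

/-- The birth times of the individuals of `BP_{Mac,α}`. The individuals are indexed by finite words:
`[]` is the root, `i :: u` is the `(i + 1)`-st child of `u`, and `e u` are the variables that drive
the reproduction of `u`. -/
noncomputable def birth (μ : Measure I) (α : ℝ≥0) (e : List ℕ → ℕ → ℝ) : List ℕ → ℝ≥0∞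
  | [] => 0
  | i :: u => birth μ α e u + sigma μ α (e u) (i + 1)

/-- The individuals that are born by time `t`. -/
def population (μ : Measure I) (α : ℝ≥0) (e : List ℕ → ℕ → ℝ) (t : ℝ) : Set (List ℕ) :=
  {u | birth μ α e u ≤ ENNReal.ofReal t}

lemma tail_mem_population {μ : Measure I} {α : ℝ≥0} {e : List ℕ → ℕ → ℝ} {t : ℝ} {u : List ℕ}
    (hu : u ∈ population μ α e t) : u.tail ∈ population μ α e t := by
  cases u with
  | nil => exact hu
  | cons i u => exact le_trans (b := birth μ α e u + sigma μ α (e u) (i + 1)) le_self_add hu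

open Classical in
/-- The genealogical tree `BP_{Mac,α}(t)` of the individuals that are born by time `t`. (If there
are infinitely many of them, which has probability zero, the value is the one point tree.) -/
noncomputable def tree (μ : Measure I) (α : ℝ≥0) (e : List ℕ → ℕ → ℝ) (t : ℝ) : FinRootedTree :=
  if h : (population μ α e t).Finite then
    { V := population μ α e t
      finite_V := h
      root := ⟨[], zero_le (a := ENNReal.ofReal t)⟩
      parent := fun u => ⟨u.1.tail, tail_mem_population u.2⟩
      parent_root := rfl
      reaches_root := by
        rintro ⟨u, hu⟩
        induction u with
        | nil => exact ⟨0, rfl⟩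
        | cons i u ih =>
          obtain ⟨k, hk⟩ := ih (tail_mem_population hu)
          exact ⟨k + 1, hk⟩ }
  else FinRootedTree.single

/-- The joint law of the independent families of independent rate one exponential variables that
drive the individuals, and of the independent time `T_1 ∼ Exp(1)`. -/
noncomputable def drivingLaw : Measure ((List ℕ → ℕ → ℝ) × ℝ) :=
  (Measure.infinitePi fun _ : List ℕ => Measure.infinitePi fun _ : ℕ => expMeasure 1).prod
    (expMeasure 1)

/-- `ϖ_{Mac,α}`: the law of `BP_{Mac,α}(T_1)` on `𝕋`. -/
noncomputable def limitLaw (μ : Measure I) (α : ℝ≥0) : Measure TreeSpace :=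
  drivingLaw.map fun p => TreeSpace.mk (tree μ α p.1 p.2)

/-- `p_{Mac,α}(k) = P(σ_{k-1} ≤ T_1 < σ_k)`, where `T_1 ∼ Exp(1)` is independent of the
inter-arrival times. -/
noncomputable def limitDegree (μ : Measure I) (α : ℝ≥0) (k : ℕ) : ℝ :=
  ((Measure.infinitePi fun _ : ℕ => expMeasure 1).prod (expMeasure 1)).real
    {p : (ℕ → ℝ) × ℝ | sigma μ α p.1 (k - 1) ≤ ENNReal.ofReal p.2 ∧
      ENNReal.ofReal p.2 < sigma μ α p.1 k}

end BPMac

/-! A vertex other than the root has degree one plus its number of children, and the total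
attractiveness of a tree with m ≥ 2 vertices is (2+α)m - 2. So, given the past, the probability that
a new vertex attaches to v is a superposition: (1+α) units started by the arrival of v, and one unit
started by the arrival of each child, every unit being seen through the delay. Abel summation puts
the hazard of the limit into the same form (`hazard_eq`), and its integral is a sum of translates of
the single function `delayPotential`. With label ratios read on the logarithmic scale, the summed
attachment rates of one unit converge to (2+α)⁻¹ times this potential (`tendsto_sum_attachRate`);
the weight e^η is the factor 1/(1-ξ) by which the observed tree is smaller.

A discrete branching process and the continuous one are driven by the same exponential clocks: the
next child gets the first label at which the summed rates reach the clock. Its rescaled labels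
converge almost surely to the exponentials of the birth times (`birthLabel_limit`). The network has
no independent clocks, but it realizes a given labelled plane tree at v with at least (1 - error)
times the clock probability. One step loses only a second order quantity, of size v⁻², and there are
fewer than N steps with N of the order of v (`clockFactor_le_stepKernel`,
`mul_clockBox_le_networkLaw`). A history determines its labelled plane tree (`consistent_unique`),
so these lower bounds can be added over labellings and over plane trees.

If T is a rate one exponential, then ⌊N e^{-T}⌋ is uniform on the N vertices, and that vertex has
logarithmic age about T. Fatou's lemma then gives the asymptotic lower bound `drivingLaw_le_liminf`
for every set of plane trees. Lower bounds suffice because the limit has full mass on finite trees: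
a comparison with a Yule process excludes explosion (`ae_finite_population`). The portmanteau
theorem for open sets yields fringe convergence, and passing to complements yields the degree
distribution. -/

namespace BPMac

/-! ### The delay potential and the delay rate. -/

/-- The integrand of `delayPotential`. -/
noncomputable def delayPotentialAux (x : ℝ) (ξ : I) : ℝ :=
  (1 - (ξ : ℝ))⁻¹ * max (x + Real.log (1 - ξ)) 0

/-- The function `x ↦ ∫ e^η (x - η)⁺`, the second antiderivative of `e^u dF_η(u)`. -/
noncomputable def delayPotential (μ : Measure I) (x : ℝ) : ℝ := ∫ ξ, delayPotentialAux x ξ ∂μ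

lemma measurable_delayPotentialAux (x : ℝ) : Measurable (delayPotentialAux x) := by
  unfold delayPotentialAux
  fun_prop

lemma one_sub_nonneg (ξ : I) : 0 ≤ 1 - (ξ : ℝ) := sub_nonneg.2 ξ.2.2

lemma delayPotentialAux_nonneg (x : ℝ) (ξ : I) : 0 ≤ delayPotentialAux x ξ :=
  mul_nonneg (inv_nonneg.2 (one_sub_nonneg ξ)) (le_max_right _ _)

lemma log_one_sub_nonpos (ξ : I) : Real.log (1 - ξ) ≤ 0 :=
  Real.log_nonpos (one_sub_nonneg ξ) (by linarith [ξ.2.1])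

/-- The positive part vanishes unless η ≤ x, and then the weight e^η is at most e^x. This truncation
gives integrability for every μ, even when e^η has infinite mean. -/
lemma delayPotentialAux_le (x : ℝ) (ξ : I) : delayPotentialAux x ξ ≤ Real.exp x * |x| := by
  rcases le_total (x + Real.log (1 - ξ)) 0 with h | h
  · rw [delayPotentialAux, max_eq_right h, mul_zero]
    positivity
  · rcases (one_sub_nonneg ξ).eq_or_lt with h0 | h0
    -- At ξ = 1 the convention 0⁻¹ = 0 gives the correct value: an infinite delay never contributes.
    · rw [delayPotentialAux, ← h0, inv_zero, zero_mul]
      positivity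
    rw [delayPotentialAux, max_eq_left h]
    have h1 : (1 - (ξ : ℝ))⁻¹ ≤ Real.exp x := by
      rw [← Real.exp_log h0, ← Real.exp_neg]
      exact Real.exp_le_exp.2 (by linarith)
    exact mul_le_mul h1 (by linarith [log_one_sub_nonpos ξ, le_abs_self x]) h (Real.exp_pos _).le

lemma integrable_delayPotentialAux (μ : Measure I) [IsFiniteMeasure μ] (x : ℝ) :
    Integrable (delayPotentialAux x) μ := by
  refine Integrable.of_bound (measurable_delayPotentialAux x).aestronglyMeasurable
    (Real.exp x * |x|) (ae_of_all _ fun ξ => ?_)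
  rw [Real.norm_of_nonneg (delayPotentialAux_nonneg x ξ)]
  exact delayPotentialAux_le x ξ

lemma delayPotentialAux_mono (ξ : I) : Monotone fun x => delayPotentialAux x ξ := fun x y h =>
  mul_le_mul_of_nonneg_left (max_le_max_right _ (by linarith)) (inv_nonneg.2 (one_sub_nonneg ξ))

lemma delayPotential_mono (μ : Measure I) [IsFiniteMeasure μ] : Monotone (delayPotential μ) :=
  fun x y h => integral_mono (integrable_delayPotentialAux μ x) (integrable_delayPotentialAux μ y)
    fun ξ => delayPotentialAux_mono ξ h

lemma measurable_delayPotential (μ : Measure I) [IsFiniteMeasure μ] :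
    Measurable (delayPotential μ) := (delayPotential_mono μ).measurable

/-- The integral `∫_{[0, x]} e^u dF_η(u)`. -/
noncomputable def delayRate (μ : Measure I) (x : ℝ≥0∞) : ℝ≥0∞ :=
  ∫⁻ u in Set.Icc 0 x, EReal.exp u ∂(etaLaw μ)

lemma measurable_ereal_exp : Measurable fun u : ℝ≥0∞ => EReal.exp (u : EReal) :=
  EReal.measurable_exp.comp measurable_coe_ennreal_ereal

lemma delayRate_mono (μ : Measure I) : Monotone (delayRate μ) := fun _ _ h =>
  lintegral_mono_set (Set.Icc_subset_Icc_right h)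

lemma delayRate_eq (μ : Measure I) (x : ℝ≥0∞) :
    delayRate μ x = ∫⁻ ξ, if eta ξ ≤ x then EReal.exp (eta ξ) else 0 ∂μ := by
  rw [delayRate, etaLaw, ← lintegral_indicator measurableSet_Icc,
    lintegral_map (measurable_ereal_exp.indicator measurableSet_Icc) measurable_eta]
  refine lintegral_congr fun ξ => ?_
  simp [Set.indicator_apply]

/-- Again only delays η ≤ x count. This moment-free bound is what later controls explosion. -/
lemma delayRate_le (μ : Measure I) [IsProbabilityMeasure μ] {x : ℝ} (hx : 0 ≤ x) :
    delayRate μ (ENNReal.ofReal x) ≤ ENNReal.ofReal (Real.exp x) := by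
  rw [delayRate_eq]
  refine (lintegral_mono (g := fun _ => ENNReal.ofReal (Real.exp x)) fun ξ => ?_).trans (by simp)
  dsimp only
  split_ifs with h
  · rw [← EReal.exp_coe, EReal.exp_le_exp_iff]
    have := EReal.coe_ennreal_le_coe_ennreal_iff.2 h
    rwa [EReal.coe_ennreal_ofReal, max_eq_left hx] at this
  · exact zero_le

lemma exp_eta_of_lt {ξ : I} (h : (ξ : ℝ) < 1) :
    EReal.exp (eta ξ) = ENNReal.ofReal (1 - (ξ : ℝ))⁻¹ := by
  rw [eta, if_pos h, EReal.coe_ennreal_ofReal,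
    max_eq_left (neg_nonneg.2 (log_one_sub_nonpos ξ)), EReal.exp_coe, Real.exp_neg,
    Real.exp_log (sub_pos.2 h)]

lemma lintegral_Ioc_step (a d s c : ℝ) (hs : 0 ≤ s) (hc : 0 ≤ c) :
    ∫⁻ x in Set.Ioc 0 s, (if a ≤ x + d then ENNReal.ofReal c else 0) =
      ENNReal.ofReal (c * max (d + s - a) 0 - c * max (d - a) 0) := by
  have h1 : (fun x : ℝ => if a ≤ x + d then ENNReal.ofReal c else 0) =
      (Set.Ici (a - d)).indicator fun _ => ENNReal.ofReal c := by
    ext x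
    simp only [Set.indicator_apply, Set.mem_Ici, tsub_le_iff_right]
  rw [h1, setLIntegral_indicator measurableSet_Ici, setLIntegral_const, ← mul_sub,
    ENNReal.ofReal_mul hc]
  congr 1
  rcases le_or_gt (a - d) 0 with h | h
  · have : Set.Ici (a - d) ∩ Set.Ioc 0 s = Set.Ioc 0 s :=
      Set.inter_eq_right.2 fun x hx => h.trans hx.1.le
    rw [this, Real.volume_Ioc, max_eq_left (by linarith), max_eq_left (by linarith)]
    congr 1; ring
  · have : Set.Ici (a - d) ∩ Set.Ioc 0 s = Set.Icc (a - d) s := by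
      ext x
      simp only [Set.mem_inter_iff, Set.mem_Ici, Set.mem_Ioc, Set.mem_Icc]
      exact ⟨fun h => ⟨h.1, h.2.2⟩, fun h' => ⟨h'.1, h.trans_le h'.1, h'.2⟩⟩
    rw [this, Real.volume_Icc, max_eq_right (a := d - a) (by linarith), sub_zero]
    rcases le_total (d + s - a) 0 with h2 | h2
    · rw [max_eq_right h2, ENNReal.ofReal_of_nonpos (by linarith), ENNReal.ofReal_zero]
    · rw [max_eq_left h2]; congr 1; ring

/-- By Tonelli it suffices to treat a fixed ξ. There the integrand is a step of height e^η at age η,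
whose antiderivative is e^η times a positive part. -/
lemma lintegral_delayRate (μ : Measure I) [IsProbabilityMeasure μ] {d s : ℝ} (hd : 0 ≤ d)
    (hs : 0 ≤ s) : ∫⁻ x in Set.Ioc 0 s, delayRate μ (ENNReal.ofReal (x + d)) =
      ENNReal.ofReal (delayPotential μ (d + s) - delayPotential μ d) := by
  simp only [delayRate_eq]
  rw [lintegral_lintegral_swap]
  · rw [delayPotential, delayPotential, ← integral_sub (integrable_delayPotentialAux μ _)
      (integrable_delayPotentialAux μ _), ofReal_integral_eq_lintegral_ofReal
        (f := fun ξ => delayPotentialAux (d + s) ξ - delayPotentialAux d ξ)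
        ((integrable_delayPotentialAux μ _).sub (integrable_delayPotentialAux μ _))
        (ae_of_all _ fun ξ => sub_nonneg.2 (delayPotentialAux_mono ξ (by linarith)))]
    refine lintegral_congr fun ξ => ?_
    by_cases h : (ξ : ℝ) < 1
    · rw [exp_eta_of_lt h, delayPotentialAux, delayPotentialAux]
      have := lintegral_Ioc_step (-Real.log (1 - ξ)) d s (1 - (ξ : ℝ))⁻¹ hs
        (inv_nonneg.2 (one_sub_nonneg ξ))
      rw [sub_neg_eq_add, sub_neg_eq_add] at this
      rw [← this]
      refine setLIntegral_congr_fun measurableSet_Ioc fun x hx => ?_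
      have hx0 : 0 < x := hx.1
      simp only [eta, if_pos h, ENNReal.ofReal_le_ofReal_iff (add_nonneg hx0.le hd)]
    · have h1 : 1 - (ξ : ℝ) = 0 := le_antisymm (by linarith) (one_sub_nonneg ξ)
      simp [eta, h, delayPotentialAux, h1]
  · refine Measurable.aemeasurable ?_
    refine Measurable.ite (measurableSet_le (measurable_eta.comp measurable_snd) (by fun_prop))
      (measurable_ereal_exp.comp (measurable_eta.comp measurable_snd)) measurable_const

/-! ### The hazard as a superposition of delayed units, and its integral. -/

lemma setLIntegral_Icc_add_Ioc (f : ℝ≥0∞ → ℝ≥0∞) (ν : Measure ℝ≥0∞) {a b : ℝ≥0∞}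
    (h : a ≤ b) : ∫⁻ u in Set.Icc 0 b, f u ∂ν =
      (∫⁻ u in Set.Ioc a b, f u ∂ν) + ∫⁻ u in Set.Icc 0 a, f u ∂ν := by
  rw [← Set.Icc_union_Ioc_eq_Icc (zero_le (a := a)) h, lintegral_union measurableSet_Ioc, add_comm]
  exact Set.disjoint_left.2 fun x hx hx' => absurd hx.2 (not_le.2 hx'.1)

/-- Abel summation. The weight j+1+c rises by one from each delay window to the next, so the
degree-weighted windows become 1+c units for the birth and one unit for each child. -/
lemma sum_weighted_increments (c : ℝ≥0∞) (F D : ℕ → ℝ≥0∞) (i : ℕ)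
    (h : ∀ j < i, F j = D j + F (j + 1)) :
    ∑ j ∈ Finset.range i, ((j : ℝ≥0∞) + 1 + c) * D j + ((i : ℝ≥0∞) + 1 + c) * F i =
      (1 + c) * F 0 + ∑ j ∈ Finset.range i, F (j + 1) := by
  induction i with
  | zero => simp
  | succ i ih =>
    rw [Finset.sum_range_succ, Finset.sum_range_succ, ← add_assoc, ← ih fun j hj => h j (by omega),
      h i (by omega)]
    push_cast
    ring

/-- The hazard function is a superposition of delayed contributions of the birth and of the
earlier reproduction events. -/
lemma hazard_eq (μ : Measure I) (α : ℝ≥0) (i : ℕ) (s : ℕ → ℝ≥0∞) (hs : Monotone s)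
    (h0 : s 0 = 0) (hi : s i ≠ ⊤) (x : ℝ≥0∞) :
    hazard μ α i (fun j => s j) x = (2 + α : ℝ≥0∞)⁻¹ *
      ((1 + α) * delayRate μ (x + s i) +
        ∑ j ∈ Finset.range i, delayRate μ (x + s i - s (j + 1))) := by
  rw [hazard]
  congr 1
  have key := sum_weighted_increments α (fun j => delayRate μ (x + s i - s j))
    (fun j => ∫⁻ u in Set.Ioc (x + s i - s (j + 1)) (x + s i - s j), EReal.exp u ∂(etaLaw μ)) i
    (fun j _ => setLIntegral_Icc_add_Ioc _ _ (tsub_le_tsub_left (hs j.le_succ) _))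
  rw [h0, tsub_zero] at key
  rw [← key]
  congr 1
  · rw [← Fin.sum_univ_eq_sum_range (fun j => ((j : ℝ≥0∞) + 1 + α) *
      ∫⁻ u in Set.Ioc (x + s i - s (j + 1)) (x + s i - s j), EReal.exp u ∂(etaLaw μ))]
    refine Finset.sum_congr rfl fun j _ => ?_
    simp only [Fin.val_last, Fin.val_succ, Fin.val_castSucc]
    exact lintegral_const_mul _ measurable_ereal_exp
  · rw [lintegral_const_mul _ measurable_ereal_exp, delayRate, ENNReal.add_sub_cancel_right hi]

/-- The compensator of the reproduction process of an individual of age `x` with children born at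
the ages `s 1, …, s i`. -/
noncomputable def compensator (μ : Measure I) (α : ℝ≥0) (i : ℕ) (s : ℕ → ℝ) (x : ℝ) : ℝ :=
  (2 + α : ℝ)⁻¹ * ((1 + α) * delayPotential μ x +
    ∑ j ∈ Finset.range i, delayPotential μ (x - s (j + 1)))

lemma compensator_mono (μ : Measure I) [IsFiniteMeasure μ] (α : ℝ≥0) (i : ℕ) (s : ℕ → ℝ) :
    Monotone (compensator μ α i s) := fun x y h => by
  unfold compensator
  have h1 := delayPotential_mono μ h
  have h2 : ∑ j ∈ Finset.range i, delayPotential μ (x - s (j + 1)) ≤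
      ∑ j ∈ Finset.range i, delayPotential μ (y - s (j + 1)) :=
    Finset.sum_le_sum fun j _ => delayPotential_mono μ (by linarith)
  gcongr

/-- Each unit in `hazard_eq` integrates to an increment of the potential, with time shift σ_i -
σ_{j+1}; together they form an increment of the compensator. -/
lemma cumHazard_hazard (μ : Measure I) [IsProbabilityMeasure μ] (α : ℝ≥0) (i : ℕ) (s : ℕ → ℝ≥0∞)
    (hs : Monotone s) (h0 : s 0 = 0) (hi : s i ≠ ⊤) {x : ℝ} (hx : 0 ≤ x) :
    cumHazard (hazard μ α i fun j => s j) x =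
      ENNReal.ofReal (compensator μ α i (fun j => (s j).toReal) ((s i).toReal + x) -
        compensator μ α i (fun j => (s j).toReal) (s i).toReal) := by
  have hm : Measurable (delayRate μ) := (delayRate_mono μ).measurable
  have hfin : ∀ j ≤ i, s j ≠ ⊤ := fun j hj => ne_top_of_le_ne_top hi (hs hj)
  have h2 : (2 + α : ℝ≥0∞)⁻¹ = ENNReal.ofReal (2 + α : ℝ)⁻¹ := by
    rw [ENNReal.ofReal_inv_of_pos (by positivity), ENNReal.ofReal_add (by norm_num) α.coe_nonneg]
    simp
  have h1 : (1 + α : ℝ≥0∞) = ENNReal.ofReal (1 + α : ℝ) := by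
    rw [ENNReal.ofReal_add (by norm_num) α.coe_nonneg]
    simp
  have e1 : ∀ y ∈ Set.Ioc 0 x, hazard μ α i (fun j => s j) (ENNReal.ofReal y) =
      (2 + α : ℝ≥0∞)⁻¹ * ((1 + α) * delayRate μ (ENNReal.ofReal (y + (s i).toReal)) +
        ∑ j ∈ Finset.range i,
          delayRate μ (ENNReal.ofReal (y + ((s i).toReal - (s (j + 1)).toReal)))) := by
    intro y hy
    rw [hazard_eq μ α i s hs h0 hi, ENNReal.ofReal_add hy.1.le ENNReal.toReal_nonneg,
      ENNReal.ofReal_toReal hi]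
    congr 2
    refine Finset.sum_congr rfl fun j hj => ?_
    have hj' : j + 1 ≤ i := Finset.mem_range.1 hj
    rw [← add_sub_assoc, ENNReal.ofReal_sub _ ENNReal.toReal_nonneg,
      ENNReal.ofReal_add hy.1.le ENNReal.toReal_nonneg, ENNReal.ofReal_toReal hi,
      ENNReal.ofReal_toReal (hfin _ hj')]
  have hle : ∀ j ∈ Finset.range i, (s (j + 1)).toReal ≤ (s i).toReal := fun j hj =>
    ENNReal.toReal_mono hi (hs (Finset.mem_range.1 hj))
  rw [cumHazard, setLIntegral_congr_fun measurableSet_Ioc e1, lintegral_const_mul _ (by fun_prop),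
    lintegral_add_left (by fun_prop), lintegral_const_mul _ (by fun_prop),
    lintegral_finsetSum _ (fun j _ => by fun_prop),
    lintegral_delayRate μ ENNReal.toReal_nonneg hx,
    Finset.sum_congr rfl fun j hj => lintegral_delayRate μ (sub_nonneg.2 (hle j hj)) hx,
    ← ENNReal.ofReal_sum_of_nonneg fun j _ => sub_nonneg.2 (delayPotential_mono μ (by linarith)),
    h1, h2, ← ENNReal.ofReal_mul (by positivity), ← ENNReal.ofReal_add
      (mul_nonneg (by positivity) (sub_nonneg.2 (delayPotential_mono μ (by linarith))))
      (Finset.sum_nonneg fun j _ => sub_nonneg.2 (delayPotential_mono μ (by linarith))),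
    ← ENNReal.ofReal_mul (by positivity)]
  congr 1
  rw [compensator, compensator, ← mul_sub, Finset.sum_sub_distrib]
  congr 1
  have : ∀ j, (s i).toReal - (s (j + 1)).toReal + x = (s i).toReal + x - (s (j + 1)).toReal :=
    fun j => by ring
  simp only [this]
  ring

/-! ### Birth times of the children through the accumulated hazard. -/

lemma sigma_zero (μ : Measure I) (α : ℝ≥0) (e : ℕ → ℝ) : sigma μ α e 0 = 0 := by
  rw [sigma]

lemma sigma_succ (μ : Measure I) (α : ℝ≥0) (e : ℕ → ℝ) (i : ℕ) :
    sigma μ α e (i + 1) = sigma μ α e i +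
      hazardTime (hazard μ α i fun j : Fin (i + 1) => sigma μ α e j) (e i) := by
  rw [sigma]

lemma sigma_mono (μ : Measure I) (α : ℝ≥0) (e : ℕ → ℝ) : Monotone (sigma μ α e) :=
  monotone_nat_of_le_succ fun i => by rw [sigma_succ]; exact le_self_add

/-- The ages at the reproduction events, as real numbers. -/
noncomputable def realSigma (μ : Measure I) (α : ℝ≥0) (e : ℕ → ℝ) (i : ℕ) : ℝ :=
  (sigma μ α e i).toReal

lemma realSigma_zero (μ : Measure I) (α : ℝ≥0) (e : ℕ → ℝ) : realSigma μ α e 0 = 0 := by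
  simp [realSigma, sigma_zero]

lemma ofReal_realSigma {μ : Measure I} {α : ℝ≥0} {e : ℕ → ℝ} {i : ℕ} (hi : sigma μ α e i ≠ ⊤) :
    ENNReal.ofReal (realSigma μ α e i) = sigma μ α e i := ENNReal.ofReal_toReal hi

/-- The hazard accumulated between the age `σ_i` and the age `x`. -/
noncomputable def accHazard (μ : Measure I) (α : ℝ≥0) (e : ℕ → ℝ) (i : ℕ) (x : ℝ) : ℝ :=
  compensator μ α i (realSigma μ α e) x -
    compensator μ α i (realSigma μ α e) (realSigma μ α e i)

lemma realSigma_le {μ : Measure I} {α : ℝ≥0} {e : ℕ → ℝ} {i j : ℕ} (h : i ≤ j) (hj : sigma μ α e j ≠ ⊤) :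
    realSigma μ α e i ≤ realSigma μ α e j := ENNReal.toReal_mono hj (sigma_mono μ α e h)

lemma accHazard_self {μ : Measure I} {α : ℝ≥0} {e : ℕ → ℝ} {i : ℕ} : accHazard μ α e i (realSigma μ α e i) = 0 := sub_self _

section Sigma

variable {μ : Measure I} [IsProbabilityMeasure μ] {α : ℝ≥0} {e : ℕ → ℝ} {i : ℕ}

lemma accHazard_mono : Monotone (accHazard μ α e i) := fun _ _ h =>
  sub_le_sub_right (compensator_mono μ α i _ h) _

lemma cumHazard_sigma (hi : sigma μ α e i ≠ ⊤) {x : ℝ} (hx : 0 ≤ x) :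
    cumHazard (hazard μ α i fun j : Fin (i + 1) => sigma μ α e j) x =
      ENNReal.ofReal (accHazard μ α e i (realSigma μ α e i + x)) :=
  cumHazard_hazard μ α i (sigma μ α e) (sigma_mono μ α e) (sigma_zero μ α e) hi hx

lemma cumHazard_sigma_ne_top (hi : sigma μ α e i ≠ ⊤) (x : ℝ) :
    cumHazard (hazard μ α i fun j : Fin (i + 1) => sigma μ α e j) x ≠ ⊤ := by
  refine ne_top_of_le_ne_top ?_ (cumHazard_mono _ (le_max_left x 0))
  rw [cumHazard_sigma hi (le_max_right _ _)]
  exact ENNReal.ofReal_ne_top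

/-- An age `x ≥ σ_i` is before the next reproduction event if and only if the accumulated hazard is
below the driving exponential variable. -/
lemma lt_sigma_succ_iff (hi : sigma μ α e i ≠ ⊤) {x : ℝ}
    (hx : realSigma μ α e i ≤ x) :
    ENNReal.ofReal x < sigma μ α e (i + 1) ↔ accHazard μ α e i x < e i := by
  have h := lt_hazardTime_iff (cumHazard_sigma_ne_top hi) (sub_nonneg.2 hx) (e i)
  rw [cumHazard_sigma hi (sub_nonneg.2 hx), ENNReal.ofReal_lt_ofReal_iff_of_nonneg
    (by rw [← accHazard_self (μ := μ) (α := α) (e := e) (i := i)]; exact accHazard_mono (by linarith)), add_sub_cancel] at h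
  rw [← h, sigma_succ]
  have : ENNReal.ofReal x = sigma μ α e i + ENNReal.ofReal (x - realSigma μ α e i) := by
    have h0 : 0 ≤ realSigma μ α e i := ENNReal.toReal_nonneg
    rw [← ofReal_realSigma hi, ← ENNReal.ofReal_add h0 (sub_nonneg.2 hx), add_sub_cancel]
  rw [this, ENNReal.add_lt_add_iff_left hi]

lemma sigma_lt_sigma_succ (hi : sigma μ α e i ≠ ⊤) (he : 0 < e i) :
    sigma μ α e i < sigma μ α e (i + 1) := by
  rw [← ofReal_realSigma hi, lt_sigma_succ_iff hi le_rfl, accHazard_self]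
  exact he

end Sigma

end BPMac

/-! ### Convexity, unique crossing of the clock level, and measurability of the birth times. -/

namespace BPMac

/-- An average of positive parts with nonnegative weights. Convexity supplies continuity and, in
`lt_accHazard`, strict growth once the hazard has become positive. -/
lemma convexOn_delayPotential (μ : Measure I) [IsFiniteMeasure μ] :
    ConvexOn ℝ Set.univ (delayPotential μ) := by
  refine ⟨convex_univ, fun x _ y _ a b ha hb hab => ?_⟩
  have h : ∀ ξ, delayPotentialAux (a • x + b • y) ξ ≤
      a * delayPotentialAux x ξ + b * delayPotentialAux y ξ := by
    intro ξ
    simp only [delayPotentialAux, smul_eq_mul]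
    set l := Real.log (1 - ξ)
    have h1 : max (a * x + b * y + l) 0 ≤ a * max (x + l) 0 + b * max (y + l) 0 := by
      have e1 : a * x + b * y + l = a * (x + l) + b * (y + l) := by
        linear_combination -l * hab
      rw [e1]
      refine max_le ?_ (by positivity)
      gcongr <;> exact le_max_left _ _
    calc _ ≤ (1 - (ξ : ℝ))⁻¹ * (a * max (x + l) 0 + b * max (y + l) 0) :=
          mul_le_mul_of_nonneg_left h1 (inv_nonneg.2 (one_sub_nonneg ξ))
      _ = _ := by ring
  simp only [smul_eq_mul, delayPotential] at h ⊢
  rw [← integral_const_mul, ← integral_const_mul, ← integral_add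
      ((integrable_delayPotentialAux μ x).const_mul a)
      ((integrable_delayPotentialAux μ y).const_mul b)]
  exact integral_mono (integrable_delayPotentialAux μ _)
    (((integrable_delayPotentialAux μ x).const_mul a).add
      ((integrable_delayPotentialAux μ y).const_mul b)) h

lemma continuous_delayPotential (μ : Measure I) [IsFiniteMeasure μ] :
    Continuous (delayPotential μ) := by
  rw [← continuousOn_univ]
  exact (convexOn_delayPotential μ).continuousOn isOpen_univ

lemma continuous_compensator (μ : Measure I) [IsFiniteMeasure μ] (α : ℝ≥0) (i : ℕ) (s : ℕ → ℝ) :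
    Continuous (compensator μ α i s) := by
  have := continuous_delayPotential μ
  unfold compensator
  fun_prop

lemma convexOn_compensator (μ : Measure I) [IsFiniteMeasure μ] (α : ℝ≥0) (i : ℕ) (s : ℕ → ℝ) :
    ConvexOn ℝ Set.univ (compensator μ α i s) := by
  have h := convexOn_delayPotential μ
  have h2 : ∀ c : ℝ, ConvexOn ℝ Set.univ fun x => delayPotential μ (x - c) := fun c => by
    simpa [Function.comp_def, sub_eq_neg_add] using h.translate_right (-c)
  have h3 : ConvexOn ℝ Set.univ fun x => ∑ j ∈ Finset.range i, delayPotential μ (x - s (j + 1)) := by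
    induction i with
    | zero => simpa using convexOn_const 0 convex_univ
    | succ i ih =>
      simp only [Finset.sum_range_succ]
      exact ih.add (h2 _)
  have h1 : (0 : ℝ) ≤ 1 + α := by positivity
  exact ((h.smul h1).add h3).smul (by positivity)

section Sigma

variable {μ : Measure I} [IsProbabilityMeasure μ] {α : ℝ≥0} {e : ℕ → ℝ} {i : ℕ}

/-- Before the event the accumulated hazard is below the clock, and at the event it is not.
Continuity excludes an overshoot, even if η has atoms. -/
lemma accHazard_realSigma_succ (hi : sigma μ α e (i + 1) ≠ ⊤) (he : 0 < e i) :
    accHazard μ α e i (realSigma μ α e (i + 1)) = e i := by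
  have hi' : sigma μ α e i ≠ ⊤ := ne_top_of_le_ne_top hi (sigma_mono μ α e i.le_succ)
  have hlt : realSigma μ α e i < realSigma μ α e (i + 1) :=
    (ENNReal.toReal_lt_toReal hi' hi).2 (sigma_lt_sigma_succ hi' he)
  refine le_antisymm ?_ ?_
  · have hc : Tendsto (accHazard μ α e i) (𝓝[<] realSigma μ α e (i + 1))
        (𝓝 (accHazard μ α e i (realSigma μ α e (i + 1)))) :=
      (((continuous_compensator μ α i _).sub continuous_const).tendsto _).mono_left
        nhdsWithin_le_nhds
    refine le_of_tendsto hc ?_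
    filter_upwards [Ioo_mem_nhdsLT hlt] with x hx
    refine ((lt_sigma_succ_iff hi' hx.1.le).1 ?_).le
    rw [← ofReal_realSigma hi, ENNReal.ofReal_lt_ofReal_iff
      ((ENNReal.toReal_nonneg : 0 ≤ realSigma μ α e i).trans_lt hlt)]
    exact hx.2
  · rw [← not_lt, ← lt_sigma_succ_iff hi' hlt.le, ofReal_realSigma hi]
    exact lt_irrefl _

/-- A convex function that has climbed from 0 to a positive level keeps at least the same secant
slope afterwards. The clock level is therefore crossed at a single age, which gives the upper bound
for the rescaled discrete labels. -/
lemma lt_accHazard (hi : sigma μ α e (i + 1) ≠ ⊤) (he : 0 < e i) {x : ℝ}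
    (hx : realSigma μ α e (i + 1) < x) : e i < accHazard μ α e i x := by
  have hi' : sigma μ α e i ≠ ⊤ := ne_top_of_le_ne_top hi (sigma_mono μ α e i.le_succ)
  have hlt : realSigma μ α e i < realSigma μ α e (i + 1) :=
    (ENNReal.toReal_lt_toReal hi' hi).2 (sigma_lt_sigma_succ hi' he)
  have h := (convexOn_compensator μ α i (realSigma μ α e)).secant_mono
    (Set.mem_univ (realSigma μ α e i)) (Set.mem_univ (realSigma μ α e (i + 1))) (Set.mem_univ x)
    hlt.ne' (hlt.trans hx).ne' hx.le
  have h1 := accHazard_realSigma_succ hi he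
  change accHazard μ α e i _ / _ ≤ accHazard μ α e i x / _ at h
  rw [h1, div_le_div_iff₀ (sub_pos.2 hlt) (sub_pos.2 (hlt.trans hx))] at h
  by_contra hcon
  nlinarith

lemma measurable_sigma (i : ℕ) : Measurable fun e => sigma μ α e i := by
  induction i using Nat.strong_induction_on with | _ i ih =>
  cases i with
  | zero => simp only [sigma_zero]; exact measurable_const
  | succ i =>
    have hr : ∀ j ≤ i, Measurable fun e => realSigma μ α e j := fun j hj =>
      (ih j (by omega)).ennreal_toReal
    have hd := measurable_delayPotential μ
    have hacc : ∀ x, Measurable fun e => accHazard μ α e i x := by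
      intro x
      have hc : ∀ y : (ℕ → ℝ) → ℝ, Measurable y →
          Measurable fun e => compensator μ α i (realSigma μ α e) (y e) := by
        intro y hy
        refine Measurable.const_mul (Measurable.add ((hd.comp hy).const_mul _) ?_) _
        refine Finset.measurable_fun_sum _ fun j hj => hd.comp (hy.sub (hr _ ?_))
        exact Finset.mem_range.1 hj
      exact (hc _ measurable_const).sub (hc _ (hr i le_rfl))
    refine measurable_of_Ioi fun c => ?_
    by_cases hc : c = ⊤
    · simp [hc]
    -- The accumulated hazard at a fixed age involves only σ_0, …, σ_i, so this replaces the infimum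
    -- in the definition by a condition that the induction hypothesis covers.
    have key : (fun e => sigma μ α e (i + 1)) ⁻¹' Set.Ioi c =
        {e | c < sigma μ α e i} ∪ ({e | sigma μ α e i ≤ c} ∩ {e | accHazard μ α e i c.toReal < e i}) := by
      ext e
      simp only [Set.mem_preimage, Set.mem_Ioi, Set.mem_union, Set.mem_inter_iff, Set.mem_ofPred_eq]
      rcases lt_or_ge c (sigma μ α e i) with h | h
      · simp [h, h.trans_le (sigma_mono μ α e i.le_succ)]
      · have hi : sigma μ α e i ≠ ⊤ := ne_top_of_le_ne_top hc h
        rw [← lt_sigma_succ_iff hi (ENNReal.toReal_mono hc h), ENNReal.ofReal_toReal hc]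
        simp [h, h.not_gt]
    rw [key]
    exact (measurableSet_lt measurable_const (ih i (by omega))).union
      ((measurableSet_le (ih i (by omega)) measurable_const).inter
        (measurableSet_lt (hacc _) (measurable_pi_apply i)))

lemma measurable_accHazard (i : ℕ) {y : (List ℕ → ℕ → ℝ) → ℝ} (hy : Measurable y) (a : List ℕ) :
    Measurable fun e => accHazard μ α (e a) i (y e) := by
  have hd := measurable_delayPotential μ
  have hr : ∀ j, Measurable fun e : List ℕ → ℕ → ℝ => realSigma μ α (e a) j := fun j =>
    ((measurable_sigma j).comp (measurable_pi_apply a)).ennreal_toReal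
  have hc : ∀ y : (List ℕ → ℕ → ℝ) → ℝ, Measurable y →
      Measurable fun e => compensator μ α i (realSigma μ α (e a)) (y e) := by
    intro y hy
    refine Measurable.const_mul (Measurable.add ((hd.comp hy).const_mul _) ?_) _
    exact Finset.measurable_fun_sum _ fun j hj => hd.comp (hy.sub (hr _))
  exact (hc _ hy).sub (hc _ (hr i))

lemma measurable_birth (u : List ℕ) : Measurable fun e => birth μ α e u := by
  induction u with
  | nil => exact measurable_const
  | cons i u ih => exact ih.add ((measurable_sigma (i + 1)).comp (measurable_pi_apply u))

end Sigma

lemma accHazard_congr {μ : Measure I} {α : ℝ≥0} {e e' : ℕ → ℝ} {i : ℕ}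
    (h : ∀ j ≤ i, sigma μ α e j = sigma μ α e' j) (x : ℝ) :
    accHazard μ α e i x = accHazard μ α e' i x := by
  have h1 : ∀ x, compensator μ α i (realSigma μ α e) x = compensator μ α i (realSigma μ α e') x := by
    intro x
    unfold compensator
    congr 2
    refine Finset.sum_congr rfl fun j hj => ?_
    rw [realSigma, realSigma, h (j + 1) (Finset.mem_range.1 hj)]
  rw [accHazard, accHazard, h1, h1, realSigma, realSigma, h i le_rfl]

lemma sigma_congr {μ : Measure I} {α : ℝ≥0} {e e' : ℕ → ℝ} {i : ℕ} (h : ∀ j < i, e j = e' j) :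
    sigma μ α e i = sigma μ α e' i := by
  induction i using Nat.strong_induction_on with | _ i ih =>
  cases i with
  | zero => rw [sigma_zero, sigma_zero]
  | succ i =>
    rw [sigma_succ, sigma_succ, h i i.lt_succ_self, ih i i.lt_succ_self fun j hj => h j (by omega)]
    congr 3
    ext j
    exact ih j (by omega) fun k hk => h k (by omega)

/-- Only clocks on the ancestral line matter, and when the line passes through the child `m :: c`
only the clocks 0, …, m of `c` do. This is the independence needed for resampling one clock. -/
lemma birth_congr {μ : Measure I} {α : ℝ≥0} {e e' : List ℕ → ℕ → ℝ} {u : List ℕ}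
    (h : ∀ m c, m :: c <:+ u → ∀ j ≤ m, e c j = e' c j) : birth μ α e u = birth μ α e' u := by
  induction u with
  | nil => rfl
  | cons i u ih =>
    rw [birth, birth, ih fun m c hc => h m c (hc.trans (List.suffix_cons i u)),
      sigma_congr fun j hj => h i u List.suffix_rfl j (by omega)]

end BPMac

/-! ### Resampling one coordinate of a product measure. -/

section InfinitePiUpdate

variable {ι : Type*} [DecidableEq ι] {X : ι → Type*} [∀ i, MeasurableSpace (X i)]
  (ν : (i : ι) → Measure (X i)) [∀ i, IsProbabilityMeasure (ν i)]

lemma measurable_update_prod (i : ι) :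
    Measurable fun p : ((j : ι) → X j) × X i => Function.update p.1 i p.2 := by
  refine measurable_pi_lambda _ fun j => ?_
  by_cases h : j = i
  · subst h
    simpa using measurable_snd
  · simp only [Function.update_of_ne h]
    fun_prop

/-- Resampling one coordinate preserves a product measure. -/
lemma MeasureTheory.Measure.infinitePi_map_update (i : ι) :
    ((Measure.infinitePi ν).prod (ν i)).map (fun p => Function.update p.1 i p.2) =
      Measure.infinitePi ν := by
  refine Measure.eq_infinitePi ν fun s t ht => ?_
  rw [Measure.map_apply (measurable_update_prod i)
    (MeasurableSet.pi s.countable_toSet fun j _ => ht j)]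
  have : (fun p : ((j : ι) → X j) × X i => Function.update p.1 i p.2) ⁻¹' Set.pi s t =
      (Set.pi (s.erase i : Finset ι) t) ×ˢ (if i ∈ s then t i else Set.univ) := by
    ext p
    simp only [Set.mem_preimage, Set.mem_pi, Finset.mem_coe, Set.mem_prod, Finset.mem_erase]
    constructor
    · intro h
      refine ⟨fun j hj => by simpa [hj.1] using h j hj.2, ?_⟩
      split_ifs with hi
      · simpa using h i hi
      · trivial
    · rintro ⟨h1, h2⟩ j hj
      by_cases hji : j = i
      · subst hji
        simpa [hj] using h2
      · simpa [hji] using h1 j ⟨hji, hj⟩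
  rw [this, Measure.prod_prod, Measure.infinitePi_pi ν fun j _ => ht j]
  split_ifs with hi
  · rw [mul_comm, Finset.mul_prod_erase s (fun j => ν j (t j)) hi]
  · rw [measure_univ, mul_one, Finset.erase_eq_of_notMem hi]

lemma MeasureTheory.lintegral_infinitePi_update (i : ι) {f : ((j : ι) → X j) → ℝ≥0∞}
    (hf : Measurable f) : ∫⁻ x, f x ∂(Measure.infinitePi ν) =
      ∫⁻ x, ∫⁻ y, f (Function.update x i y) ∂(ν i) ∂(Measure.infinitePi ν) := by
  conv_lhs => rw [← Measure.infinitePi_map_update ν i]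
  rw [lintegral_map hf (measurable_update_prod i)]
  exact lintegral_prod _ (hf.comp (measurable_update_prod i)).aemeasurable

end InfinitePiUpdate

lemma lintegral_infinitePi_prod_range {X : Type*} [MeasurableSpace X] (ν : Measure X)
    [IsProbabilityMeasure ν] {f : ℕ → X → ℝ≥0∞} (hf : ∀ j, Measurable (f j)) (n : ℕ) :
    ∫⁻ z, ∏ j ∈ Finset.range n, f j (z j) ∂(Measure.infinitePi fun _ : ℕ => ν) =
      ∏ j ∈ Finset.range n, ∫⁻ y, f j y ∂ν := by
  induction n with
  | zero => simp
  | succ n ih =>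
    have hm : ∀ n, Measurable fun z : ℕ → X => ∏ j ∈ Finset.range n, f j (z j) := fun n =>
      Finset.measurable_fun_prod _ fun j _ => (hf j).comp (measurable_pi_apply j)
    rw [Finset.prod_range_succ, ← ih, lintegral_infinitePi_update (fun _ : ℕ => ν) n (hm _),
      ← lintegral_mul_const _ (hm n)]
    refine lintegral_congr fun z => ?_
    have : ∀ y, ∏ j ∈ Finset.range (n + 1), f j (Function.update z n y j) =
        (∏ j ∈ Finset.range n, f j (z j)) * f n y := fun y => by
      rw [Finset.prod_range_succ, Function.update_self]
      congr 1
      refine Finset.prod_congr rfl fun j hj => ?_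
      rw [Function.update_of_ne (Finset.mem_range.1 hj).ne]
    simp only [this]
    rw [lintegral_const_mul _ (hf n)]

lemma ENNReal.tsum_list_eq {β : Type*} [DecidableEq β] (g : List β → ℝ≥0∞) :
    ∑' u, g u = g [] + ∑' i, ∑' u, g (i :: u) := by
  rw [ENNReal.tsum_eq_add_tsum_ite [], ← ENNReal.tsum_prod]
  congr 1
  have hinj : Function.Injective fun p : β × List β => p.1 :: p.2 := by
    rintro ⟨a, u⟩ ⟨b, v⟩ h
    simpa using h
  rw [← hinj.tsum_eq]
  · simp
  · intro u hu
    cases u with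
    | nil => simp at hu
    | cons i u => exact ⟨(i, u), rfl⟩

/-! ### The exponential clocks. -/

namespace BPMac

/-- The law of the families of variables that drive the individuals. -/
noncomputable def expFamilyLaw : Measure (List ℕ → ℕ → ℝ) :=
  Measure.infinitePi fun _ : List ℕ => Measure.infinitePi fun _ : ℕ => expMeasure 1

instance : IsProbabilityMeasure expFamilyLaw := by
  unfold expFamilyLaw; infer_instance

lemma drivingLaw_eq : drivingLaw = expFamilyLaw.prod (expMeasure 1) := rfl

instance : IsProbabilityMeasure drivingLaw := by
  rw [drivingLaw_eq]; infer_instance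

instance : NullSingletonClass (expMeasure 1) := by
  unfold expMeasure gammaMeasure
  infer_instance

lemma expMeasure_real_Iic {x : ℝ} (hx : 0 ≤ x) :
    (expMeasure 1).real (Set.Iic x) = 1 - Real.exp (-x) := by
  rw [← cdf_eq_real, cdf_expMeasure_eq one_pos, if_pos hx, one_mul]

lemma expMeasure_real_Ioi {x : ℝ} (hx : 0 ≤ x) :
    (expMeasure 1).real (Set.Ioi x) = Real.exp (-x) := by
  rw [← Set.compl_Iic, probReal_compl_eq_one_sub measurableSet_Iic, expMeasure_real_Iic hx]
  ring

lemma expMeasure_real_Ioc {x y : ℝ} (hx : 0 ≤ x) (hxy : x ≤ y) :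
    (expMeasure 1).real (Set.Ioc x y) = Real.exp (-x) - Real.exp (-y) := by
  rw [← Set.Iic_sdiff_Iic, measureReal_sdiff (Set.Iic_subset_Iic.2 hxy) measurableSet_Iic,
    expMeasure_real_Iic hx, expMeasure_real_Iic (hx.trans hxy)]
  ring

lemma ae_pos_expMeasure : ∀ᵐ x ∂(expMeasure 1), 0 < x := by
  rw [ae_iff]
  have : {a : ℝ | ¬0 < a} = Set.Iic 0 := by ext; simp
  rw [this, ← measureReal_eq_zero_iff, expMeasure_real_Iic le_rfl]
  simp

lemma ae_pos_expFamilyLaw : ∀ᵐ e ∂expFamilyLaw, ∀ u i, 0 < e u i := by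
  rw [ae_all_iff]
  refine fun u => ?_
  have h : ∀ᵐ z ∂(Measure.infinitePi fun _ : ℕ => expMeasure 1), ∀ i, 0 < z i :=
    ae_all_iff.2 fun i =>
      (measurePreserving_eval_infinitePi (fun _ : ℕ => expMeasure 1) i).quasiMeasurePreserving.ae
        ae_pos_expMeasure
  exact (measurePreserving_eval_infinitePi (fun _ : List ℕ =>
    Measure.infinitePi fun _ : ℕ => expMeasure 1) u).quasiMeasurePreserving.ae h

/-- A driving variable almost surely differs from every variable that does not depend on it. -/
lemma ae_ne_of_update_eq (a : List ℕ) (i : ℕ) {f : (List ℕ → ℕ → ℝ) → ℝ} (hf : Measurable f)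
    (h : ∀ e y, f (Function.update e a (Function.update (e a) i y)) = f e) :
    ∀ᵐ e ∂expFamilyLaw, e a i ≠ f e := by
  have hA : MeasurableSet {e : List ℕ → ℕ → ℝ | e a i = f e} :=
    measurableSet_eq_fun ((measurable_pi_apply i).comp (measurable_pi_apply a)) hf
  have hind : Measurable ({e : List ℕ → ℕ → ℝ | e a i = f e}.indicator fun _ => (1 : ℝ≥0∞)) :=
    measurable_const.indicator hA
  rw [ae_iff]
  simp only [ne_eq, not_not]
  rw [← lintegral_indicator_one hA, expFamilyLaw]
  change ∫⁻ e, Set.indicator _ (fun _ => 1) e ∂_ = 0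
  rw [lintegral_infinitePi_update _ a hind]
  refine lintegral_eq_zero_of_ae_eq_zero (ae_of_all _ fun e => ?_)
  have hz : Measurable fun z : ℕ → ℝ => Function.update e a z :=
    (measurable_update_prod (X := fun _ : List ℕ => ℕ → ℝ) a).comp measurable_prodMk_left
  refine (lintegral_infinitePi_update _ i (hind.comp hz)).trans ?_
  refine lintegral_eq_zero_of_ae_eq_zero (ae_of_all _ fun z => ?_)
  -- After resampling the word `a` and then its clock `i`, the event says that the fresh value y
  -- hits a point not depending on y. The exponential law has no atoms.
  have : ∀ y, ({e : List ℕ → ℕ → ℝ | e a i = f e}.indicator (fun _ => (1 : ℝ≥0∞)))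
      (Function.update e a (Function.update z i y)) =
      ({f (Function.update e a z)} : Set ℝ).indicator (fun _ => 1) y := fun y => by
    have hf' := h (Function.update e a z) y
    rw [Function.update_self, Function.update_idem] at hf'
    simp [Set.indicator_apply, hf']
  simp only [Function.comp_apply, this]
  rw [lintegral_indicator (measurableSet_singleton _)]
  simp

end BPMac

/-! ### Birth times are almost surely distinct, and distinct from T_1. -/

namespace BPMac

lemma birth_le_append {μ : Measure I} {α : ℝ≥0} (e : List ℕ → ℕ → ℝ) (p u : List ℕ) :
    birth μ α e u ≤ birth μ α e (p ++ u) := by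
  induction p with
  | nil => exact le_rfl
  | cons i p ih => exact ih.trans le_self_add

section Births

variable {μ : Measure I} [IsProbabilityMeasure μ] {α : ℝ≥0}

lemma birth_lt_cons {e : List ℕ → ℕ → ℝ} (he : ∀ u i, 0 < e u i) {u : List ℕ} (i : ℕ)
    (hu : birth μ α e u ≠ ⊤) : birth μ α e u < birth μ α e (i :: u) := by
  have h0 : 0 < sigma μ α (e u) (i + 1) := by
    have h1 := sigma_lt_sigma_succ (μ := μ) (α := α) (e := e u) (i := 0)
      (by simp [sigma_zero]) (he u 0)
    rw [sigma_zero] at h1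
    exact h1.trans_le (sigma_mono μ α (e u) (by omega))
  exact ENNReal.lt_add_right hu h0.ne'

lemma birth_lt_append {e : List ℕ → ℕ → ℝ} (he : ∀ u i, 0 < e u i) {p u : List ℕ} (hp : p ≠ [])
    (hu : birth μ α e u ≠ ⊤) : birth μ α e u < birth μ α e (p ++ u) := by
  rcases List.eq_nil_or_concat p with h | ⟨q, i, rfl⟩
  · exact absurd h hp
  · refine (birth_lt_cons he i hu).trans_le ?_
    rw [List.concat_eq_append, List.append_assoc]
    exact birth_le_append e q (i :: u)

lemma birth_sibling_lt {e : List ℕ → ℕ → ℝ} (he : ∀ u i, 0 < e u i) {u : List ℕ} {i j : ℕ}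
    (hij : i < j) (hu : birth μ α e (i :: u) ≠ ⊤) :
    birth μ α e (i :: u) < birth μ α e (j :: u) := by
  have h1 := ENNReal.add_ne_top.1 hu
  refine (ENNReal.add_lt_add_iff_left h1.1).2 ?_
  exact (sigma_lt_sigma_succ h1.2 (he u (i + 1))).trans_le (sigma_mono μ α (e u) (by omega))

/-- Almost surely no two individuals are born at the same time. -/
lemma ae_birth_ne : ∀ᵐ e ∂expFamilyLaw, ∀ u v, u ≠ v → birth μ α e u ≠ ⊤ →
    birth μ α e u ≠ birth μ α e v := by
  -- If `v` is not in the subtree of a child of `a` with index at least `i`, the births of `v` and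
  -- `a` and the hazard accumulated by `a` after σ_i do not use the clock `e a i`, which therefore
  -- almost surely differs from that hazard.
  have key : ∀ (i : ℕ) (a v : List ℕ), (∀ m, m :: a <:+ v → m < i) → ∀ᵐ e ∂expFamilyLaw,
      e a i ≠ accHazard μ α (e a) i ((birth μ α e v).toReal - (birth μ α e a).toReal) := by
    intro i a v hv
    refine ae_ne_of_update_eq a i (measurable_accHazard i
      ((measurable_birth v).ennreal_toReal.sub (measurable_birth a).ennreal_toReal) a) fun e y => ?_
    have hs : ∀ j ≤ i, sigma μ α (Function.update (e a) i y) j = sigma μ α (e a) j := fun j hj =>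
      sigma_congr fun k hk => by rw [Function.update_of_ne (by omega)]
    have hb : ∀ w, (∀ m, m :: a <:+ w → m < i) →
        birth μ α (Function.update e a (Function.update (e a) i y)) w = birth μ α e w := by
      refine fun w hw => birth_congr fun m c hc j hj => ?_
      by_cases hca : c = a
      · subst hca
        have := hw m hc
        rw [Function.update_self, Function.update_of_ne (by omega)]
      · rw [Function.update_of_ne hca]
    rw [Function.update_self, accHazard_congr hs, hb v hv, hb a]
    intro m hm
    have := hm.length_le
    simp at this
  have key' : ∀ᵐ e ∂expFamilyLaw, ∀ (i : ℕ) (a v : List ℕ), (∀ m, m :: a <:+ v → m < i) →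
      e a i ≠ accHazard μ α (e a) i ((birth μ α e v).toReal - (birth μ α e a).toReal) := by
    rw [ae_all_iff]; intro i
    rw [ae_all_iff]; intro a
    rw [ae_all_iff]; intro v
    by_cases hv : ∀ m, m :: a <:+ v → m < i
    · filter_upwards [key i a v hv] with e he _ using he
    · exact ae_of_all _ fun e h => absurd h hv
  filter_upwards [key', ae_pos_expFamilyLaw] with e hkey he u v huv hu heq
  cases u with
  | nil =>
    have hv : v ≠ [] := fun h => huv h.symm
    have := birth_lt_append (μ := μ) (α := α) he hv hu
    rw [List.append_nil, ← heq] at this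
    exact lt_irrefl _ this
  | cons i a =>
    by_cases hv : ∀ m, m :: a <:+ v → m < i
    -- Equal birth times would make the clock `e a i` equal to the hazard accumulated at the age of
    -- `a` at which `v` is born.
    · refine hkey i a v hv ?_
      have h1 := ENNReal.add_ne_top.1 hu
      rw [← accHazard_realSigma_succ h1.2 (he a i), ← heq, birth,
        ENNReal.toReal_add h1.1 h1.2, add_sub_cancel_left]
      rfl
    -- Otherwise `v` descends from a younger sibling of `u` or from `u` itself, and the order of
    -- births is strict.
    · push Not at hv
      obtain ⟨m, ⟨p, rfl⟩, hm⟩ := hv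
      have hp := birth_le_append (μ := μ) (α := α) e p (m :: a)
      rcases hm.lt_or_eq with hlt | rfl
      · exact (birth_sibling_lt he hlt hu).not_ge (heq ▸ hp)
      · have hp' : p ≠ [] := fun h => huv (by simp [h])
        exact (birth_lt_append he hp' hu).ne heq

lemma ae_birth_ne_time : ∀ᵐ p ∂drivingLaw, 0 < p.2 ∧ ∀ u, birth μ α p.1 u ≠ ENNReal.ofReal p.2 := by
  have h2 : ∀ᵐ p ∂drivingLaw, 0 < p.2 := by
    rw [drivingLaw_eq]
    exact Measure.quasiMeasurePreserving_snd.ae ae_pos_expMeasure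
  have h1 : ∀ᵐ p ∂drivingLaw, ∀ u, (birth μ α p.1 u).toReal ≠ p.2 := by
    rw [ae_all_iff]
    intro u
    rw [drivingLaw_eq, Measure.ae_prod_iff_ae_ae]
    · refine ae_of_all _ fun e => ?_
      filter_upwards [Measure.ae_ne (expMeasure 1) (birth μ α e u).toReal] with t ht
      exact ht.symm
    · exact (measurableSet_eq_fun ((measurable_birth u).ennreal_toReal.comp measurable_fst)
        measurable_snd).compl
  filter_upwards [h1, h2] with p hp hp2
  exact ⟨hp2, fun u hu => hp u (by rw [hu, ENNReal.toReal_ofReal hp2.le])⟩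

end Births

/-! ### Non-explosion by comparison with a Yule process. -/

section Finiteness

lemma lintegral_exp_neg_expMeasure {κ : ℝ} (hκ : 0 ≤ κ) :
    ∫⁻ y, ENNReal.ofReal (Real.exp (-(κ * y))) ∂(expMeasure 1) = ENNReal.ofReal (1 + κ)⁻¹ := by
  have h0 : 0 < 1 + κ := by linarith
  have hpdf : ∀ r, Measurable (exponentialPDF r) := fun r =>
    (measurable_exponentialPDFReal r).ennreal_ofReal
  change ∫⁻ y, _ ∂(volume.withDensity (exponentialPDF 1)) = _
  rw [lintegral_withDensity_eq_lintegral_mul _ (hpdf 1) (by fun_prop)]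
  have : ∀ y : ℝ, (exponentialPDF 1 * fun y => ENNReal.ofReal (Real.exp (-(κ * y)))) y =
      ENNReal.ofReal (1 + κ)⁻¹ * exponentialPDF (1 + κ) y := by
    intro y
    rw [Pi.mul_apply, exponentialPDF_eq, exponentialPDF_eq]
    split_ifs
    · rw [← ENNReal.ofReal_mul (by positivity), ← ENNReal.ofReal_mul (by positivity), ← mul_assoc,
        inv_mul_cancel₀ h0.ne', mul_assoc, ← Real.exp_add, one_mul, one_mul, one_mul]
      congr 2
      ring
    · simp
  rw [lintegral_congr this, lintegral_const_mul _ (hpdf _), lintegral_exponentialPDF_eq_one h0,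
    mul_one]

/-- The birth times of the dominating Yule process. -/
noncomputable def yuleBirth (a : ℝ) (e : List ℕ → ℕ → ℝ) : List ℕ → ℝ
  | [] => 0
  | i :: u => yuleBirth a e u + ∑ j ∈ Finset.range (i + 1), e u j / (j + a)

lemma measurable_yuleBirth (a : ℝ) (u : List ℕ) : Measurable fun e => yuleBirth a e u := by
  induction u with
  | nil => exact measurable_const
  | cons i u ih =>
    refine ih.add (Finset.measurable_fun_sum _ fun j _ => ?_)
    exact ((measurable_pi_apply j).comp (measurable_pi_apply u)).div_const _

lemma yuleBirth_congr {a : ℝ} {e e' : List ℕ → ℕ → ℝ} {u : List ℕ}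
    (h : ∀ v, v.length < u.length → e v = e' v) : yuleBirth a e u = yuleBirth a e' u := by
  induction u with
  | nil => rfl
  | cons i u ih =>
    rw [yuleBirth, yuleBirth, h u (by simp), ih fun v hv => h v (hv.trans (by simp))]

/-- The birth of `u` uses only the clocks of its strict ancestors, so the clocks of `u` can be
integrated out first. The gaps have rates j + a, whose Laplace transforms at L are the factors
(j+a)/(j+a+L). -/
lemma lintegral_exp_yuleBirth_cons {a L : ℝ} (ha : 0 < a) (hL : 0 ≤ L) (i : ℕ) (u : List ℕ) :
    ∫⁻ e, ENNReal.ofReal (Real.exp (-(L * yuleBirth a e (i :: u)))) ∂expFamilyLaw =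
      ENNReal.ofReal (∏ j ∈ Finset.range (i + 1), (j + a) / (j + a + L)) *
        ∫⁻ e, ENNReal.ofReal (Real.exp (-(L * yuleBirth a e u))) ∂expFamilyLaw := by
  have hm : ∀ u, Measurable fun e => ENNReal.ofReal (Real.exp (-(L * yuleBirth a e u))) := fun u =>
    (((measurable_yuleBirth a u).const_mul L).neg.exp).ennreal_ofReal
  rw [expFamilyLaw, lintegral_infinitePi_update _ u (hm _), ← lintegral_const_mul _ (hm u)]
  refine lintegral_congr fun e => ?_
  have h1 : ∀ z, ENNReal.ofReal (Real.exp (-(L * yuleBirth a (Function.update e u z) (i :: u)))) =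
      ENNReal.ofReal (Real.exp (-(L * yuleBirth a e u))) *
        ∏ j ∈ Finset.range (i + 1), ENNReal.ofReal (Real.exp (-(L / (j + a) * z j))) := by
    intro z
    rw [← ENNReal.ofReal_prod_of_nonneg fun j _ => (Real.exp_pos _).le, ← Real.exp_sum,
      ← ENNReal.ofReal_mul (Real.exp_pos _).le, ← Real.exp_add, yuleBirth, Function.update_self,
      yuleBirth_congr (e' := e) fun v hv => Function.update_of_ne (fun h => by simp [h] at hv) _ _,
      mul_add, neg_add, Finset.mul_sum, ← Finset.sum_neg_distrib]
    congr 3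
    refine Finset.sum_congr rfl fun j _ => by ring
  simp only [h1]
  rw [lintegral_const_mul _ (Finset.measurable_fun_prod _ fun j _ => by fun_prop),
    lintegral_infinitePi_prod_range (expMeasure 1)
      (f := fun j y => ENNReal.ofReal (Real.exp (-(L / (j + a) * y)))) (fun j => by fun_prop),
    mul_comm]
  congr 1
  rw [ENNReal.ofReal_prod_of_nonneg fun j _ => by positivity]
  refine Finset.prod_congr rfl fun j _ => ?_
  rw [lintegral_exp_neg_expMeasure (by positivity)]
  congr 1
  have : (j : ℝ) + a ≠ 0 := by positivity
  field_simp

/-- With discount L = 2a+1, the products S_i satisfy 2a·S_{i+1} = (i+a)S_i - (i+1+a)S_{i+1}. The sum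
telescopes and is at most a/(2a). -/
lemma sum_prod_div_le {a : ℝ} (ha : 0 < a) (n : ℕ) :
    ∑ i ∈ Finset.range n, ∏ j ∈ Finset.range (i + 1), ((j : ℝ) + a) / (j + a + (2 * a + 1)) ≤
      1 / 2 := by
  set S : ℕ → ℝ := fun i => ∏ j ∈ Finset.range i, ((j : ℝ) + a) / (j + a + (2 * a + 1)) with hS
  have hpos : ∀ i, 0 ≤ S i := fun i => Finset.prod_nonneg fun j _ => by positivity
  have hstep : ∀ i : ℕ, S (i + 1) = (((i : ℝ) + a) * S i - (((i + 1 : ℕ) : ℝ) + a) * S (i + 1)) /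
      (2 * a) := by
    intro i
    have h : S (i + 1) = S i * (((i : ℝ) + a) / (i + a + (2 * a + 1))) :=
      Finset.prod_range_succ _ _
    rw [h]
    push_cast
    have : (i : ℝ) + a + (2 * a + 1) ≠ 0 := by positivity
    field_simp
    ring
  change ∑ i ∈ Finset.range n, S (i + 1) ≤ 1 / 2
  rw [Finset.sum_congr rfl fun i _ => hstep i, ← Finset.sum_div,
    Finset.sum_range_sub' (fun i : ℕ => ((i : ℝ) + a) * S i), div_le_div_iff₀ (by positivity) two_pos]
  have h1 : 0 ≤ ((n : ℝ) + a) * S n := mul_nonneg (by positivity) (hpos n)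
  have h0 : S 0 = 1 := by simp [hS]
  rw [h0]
  push_cast
  nlinarith

/-- Splitting off the first letter, the discounted expected population M satisfies M ≤ 1 + M/2.
Truncating by generation lets the fixed point 2 be propagated by induction, before M is known to be
finite. -/
lemma tsum_lintegral_exp_yuleBirth_le {a : ℝ} (ha : 0 < a) :
    ∑' u, ∫⁻ e, ENNReal.ofReal (Real.exp (-((2 * a + 1) * yuleBirth a e u))) ∂expFamilyLaw ≤ 2 := by
  set W : List ℕ → ℝ≥0∞ := fun u =>
    ∫⁻ e, ENNReal.ofReal (Real.exp (-((2 * a + 1) * yuleBirth a e u))) ∂expFamilyLaw with hW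
  have hcons : ∀ i u, W (i :: u) = ENNReal.ofReal (∏ j ∈ Finset.range (i + 1),
      (j + a) / (j + a + (2 * a + 1))) * W u := fun i u =>
    lintegral_exp_yuleBirth_cons ha (by positivity) i u
  have hnil : W [] = 1 := by simp [hW, yuleBirth]
  have hq : ∑' i : ℕ, ENNReal.ofReal (∏ j ∈ Finset.range (i + 1),
      ((j : ℝ) + a) / (j + a + (2 * a + 1))) ≤ 2⁻¹ := by
    refine ENNReal.tsum_le_of_sum_range_le fun n => ?_
    rw [← ENNReal.ofReal_sum_of_nonneg fun i _ => Finset.prod_nonneg fun j _ => by positivity]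
    refine (ENNReal.ofReal_le_ofReal (sum_prod_div_le ha n)).trans_eq ?_
    rw [one_div, ENNReal.ofReal_inv_of_pos two_pos]
    simp
  have hn : ∀ n : ℕ, ∑' u : List ℕ, (if u.length < n then W u else 0) ≤ 2 := by
    intro n
    induction n with
    | zero => simp
    | succ n ih =>
      rw [ENNReal.tsum_list_eq]
      have : ∀ i, ∑' u : List ℕ, (if (i :: u).length < n + 1 then W (i :: u) else 0) =
          ENNReal.ofReal (∏ j ∈ Finset.range (i + 1), (j + a) / (j + a + (2 * a + 1))) *
            ∑' u : List ℕ, (if u.length < n then W u else 0) := by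
        intro i
        rw [← ENNReal.tsum_mul_left]
        refine tsum_congr fun u => ?_
        simp only [List.length_cons, Nat.add_lt_add_iff_right, hcons, mul_ite, mul_zero]
      simp only [this]
      rw [ENNReal.tsum_mul_right]
      calc _ ≤ 1 + (2⁻¹ * 2 : ℝ≥0∞) := by
            gcongr
            simp [hnil]
        _ = 2 := by rw [ENNReal.inv_mul_cancel two_ne_zero ENNReal.ofNat_ne_top]; norm_num
  rw [ENNReal.tsum_eq_iSup_sum]
  refine iSup_le fun F => ?_
  obtain ⟨n, hF⟩ : ∃ n, ∀ u ∈ F, u.length < n :=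
    ⟨F.sup List.length + 1, fun u hu => Nat.lt_succ_of_le (Finset.le_sup hu)⟩
  calc ∑ u ∈ F, W u = ∑ u ∈ F, (if u.length < n then W u else 0) :=
        Finset.sum_congr rfl fun u hu => by rw [if_pos (hF u hu)]
    _ ≤ _ := ENNReal.sum_le_tsum F
    _ ≤ 2 := hn n

/-- Each individual born by time t adds at least exp(-(2a+1)t) to an almost surely convergent sum.
-/
lemma ae_finite_yuleBirth_le {a : ℝ} (ha : 0 < a) (t : ℝ) :
    ∀ᵐ e ∂expFamilyLaw, {u | yuleBirth a e u ≤ t}.Finite := by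
  have hm : ∀ u, Measurable fun e =>
      ENNReal.ofReal (Real.exp (-((2 * a + 1) * yuleBirth a e u))) := fun u =>
    (((measurable_yuleBirth a u).const_mul _).neg.exp).ennreal_ofReal
  have h := tsum_lintegral_exp_yuleBirth_le ha
  rw [← lintegral_tsum fun u => (hm u).aemeasurable] at h
  have hfin := ae_lt_top (Measurable.tsum hm) (ne_top_of_le_ne_top ENNReal.ofNat_ne_top h)
  filter_upwards [hfin] with e he
  have hc : ENNReal.ofReal (Real.exp (-((2 * a + 1) * t))) ≠ 0 := by
    simp [Real.exp_pos]
  refine (ENNReal.finite_const_le_of_tsum_ne_top he.ne hc).subset fun u hu => ?_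
  refine ENNReal.ofReal_le_ofReal (Real.exp_le_exp.2 ?_)
  have : yuleBirth a e u ≤ t := hu
  have : (2 * a + 1) * yuleBirth a e u ≤ (2 * a + 1) * t := by gcongr
  linarith

/-- The process grows at most as fast as a Yule process. -/
lemma yuleSum_le_sigma {μ : Measure I} [IsProbabilityMeasure μ] {α : ℝ≥0} {z : ℕ → ℝ} {t : ℝ}
    (ht : 0 ≤ t) {i : ℕ} (hi : sigma μ α z i ≤ ENNReal.ofReal t) :
    ENNReal.ofReal (∑ j ∈ Finset.range i, z j / (j + (1 + α))) ≤
      ENNReal.ofReal (Real.exp t) * sigma μ α z i := by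
  induction i with
  | zero => simp
  | succ i ih =>
    have hle := (sigma_mono μ α z i.le_succ).trans hi
    have hfin : sigma μ α z i ≠ ⊤ := ne_top_of_le_ne_top ENNReal.ofReal_ne_top hle
    rw [Finset.sum_range_succ, sigma_succ, mul_add]
    refine ENNReal.ofReal_add_le.trans (add_le_add (ih hle) ?_)
    set x := hazardTime (hazard μ α i fun j : Fin (i + 1) => sigma μ α z j) (z i) with hx
    have hxt : sigma μ α z i + x ≤ ENNReal.ofReal t := by rwa [sigma_succ] at hi
    have hxfin : x ≠ ⊤ := ne_top_of_le_ne_top ENNReal.ofReal_ne_top (le_add_self.trans hxt)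
    have h1 : ENNReal.ofReal (z i) ≤
        cumHazard (hazard μ α i fun j : Fin (i + 1) => sigma μ α z j) x.toReal := by
      rw [← not_lt, ← lt_hazardTime_iff (cumHazard_sigma_ne_top hfin) ENNReal.toReal_nonneg,
        ENNReal.ofReal_toReal hxfin]
      exact lt_irrefl _
    -- Up to age t every delayed unit is at most e^t, there are i + 1 + α of them, and the prefactor
    -- (2+α)⁻¹ is bounded by 1.
    have h2 : cumHazard (hazard μ α i fun j : Fin (i + 1) => sigma μ α z j) x.toReal ≤
        ENNReal.ofReal (Real.exp t * (i + (1 + α))) * x := by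
      have hb : ∀ y ∈ Set.Ioc 0 x.toReal,
          hazard μ α i (fun j : Fin (i + 1) => sigma μ α z j) (ENNReal.ofReal y) ≤
            ENNReal.ofReal (Real.exp t * (i + (1 + α))) := by
        intro y hy
        have hyx : ENNReal.ofReal y ≤ x := (ENNReal.ofReal_le_iff_le_toReal hxfin).2 hy.2
        have hyt : ENNReal.ofReal y + sigma μ α z i ≤ ENNReal.ofReal t := by
          rw [add_comm]
          exact (add_le_add_right hyx _).trans hxt
        have hr : ∀ w ≤ ENNReal.ofReal t, delayRate μ w ≤ ENNReal.ofReal (Real.exp t) :=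
          fun w hw => (delayRate_mono μ hw).trans (delayRate_le μ ht)
        rw [hazard_eq μ α i (sigma μ α z) (sigma_mono μ α z) (sigma_zero μ α z) hfin]
        calc _ ≤ 1 * ((1 + α) * ENNReal.ofReal (Real.exp t) +
              ∑ j ∈ Finset.range i, ENNReal.ofReal (Real.exp t)) := by
              gcongr
              · exact ENNReal.inv_le_one.2 (le_add_right one_le_two)
              · exact hr _ hyt
              · exact hr _ (tsub_le_self.trans hyt)
          _ = _ := by
              rw [one_mul, Finset.sum_const, Finset.card_range, nsmul_eq_mul, ← add_mul, mul_comm,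
                ENNReal.ofReal_mul (Real.exp_pos _).le, ENNReal.ofReal_add (by positivity)
                  (by positivity), ENNReal.ofReal_add (by norm_num) α.coe_nonneg]
              simp [add_comm]
      calc _ ≤ ∫⁻ _ in Set.Ioc 0 x.toReal, ENNReal.ofReal (Real.exp t * (i + (1 + α))) :=
            setLIntegral_mono measurable_const hb
        _ = _ := by
            rw [setLIntegral_const, Real.volume_Ioc, sub_zero, ENNReal.ofReal_toReal hxfin]
    have hpos : (0 : ℝ) < i + (1 + α) := by positivity
    rw [ENNReal.ofReal_div_of_pos hpos]
    refine ENNReal.div_le_of_le_mul ((h1.trans h2).trans_eq ?_)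
    rw [ENNReal.ofReal_mul (Real.exp_pos _).le]
    ring

lemma yuleBirth_le_birth {μ : Measure I} [IsProbabilityMeasure μ] {α : ℝ≥0}
    {e : List ℕ → ℕ → ℝ} {t : ℝ} (ht : 0 ≤ t) {u : List ℕ}
    (hu : birth μ α e u ≤ ENNReal.ofReal t) :
    ENNReal.ofReal (yuleBirth (1 + α) e u) ≤ ENNReal.ofReal (Real.exp t) * birth μ α e u := by
  induction u with
  | nil => simp [yuleBirth]
  | cons i u ih =>
    rw [birth] at hu
    rw [yuleBirth, birth, mul_add]
    exact ENNReal.ofReal_add_le.trans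
      (add_le_add (ih (le_self_add.trans hu)) (yuleSum_le_sigma ht (le_add_self.trans hu)))

/-- The branching process does not explode. -/
lemma ae_finite_population (μ : Measure I) [IsProbabilityMeasure μ] (α : ℝ≥0) :
    ∀ᵐ p ∂drivingLaw, (population μ α p.1 p.2).Finite := by
  have h : ∀ᵐ e ∂expFamilyLaw, ∀ n : ℕ, {u | yuleBirth (1 + α) e u ≤ n}.Finite :=
    ae_all_iff.2 fun n => ae_finite_yuleBirth_le (by positivity) n
  rw [drivingLaw_eq]
  filter_upwards [Measure.quasiMeasurePreserving_fst.ae h] with p hp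
  -- The process up to time t embeds in the Yule process up to time t·e^t. Integer horizons give one
  -- null set that serves all values of T_1.
  obtain ⟨n, hn⟩ := exists_nat_ge (Real.exp (max p.2 0) * max p.2 0)
  refine (hp n).subset fun u hu => ?_
  have hu' : birth μ α p.1 u ≤ ENNReal.ofReal (max p.2 0) :=
    le_trans hu (ENNReal.ofReal_le_ofReal (le_max_left _ _))
  have h1 := (yuleBirth_le_birth (le_max_right _ _) hu').trans (mul_le_mul_right hu' _)
  rw [← ENNReal.ofReal_mul (Real.exp_pos _).le] at h1
  exact ((ENNReal.ofReal_le_ofReal_iff (by positivity)).1 h1).trans hn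

end Finiteness

/-- The event that the population equals a given finite set is measurable. -/
lemma measurableSet_population_eq {μ : Measure I} [IsProbabilityMeasure μ] {α : ℝ≥0}
    (S : Finset (List ℕ)) :
    MeasurableSet {p : (List ℕ → ℕ → ℝ) × ℝ | population μ α p.1 p.2 = S} := by
  have : {p : (List ℕ → ℕ → ℝ) × ℝ | population μ α p.1 p.2 = S} =
      ⋂ u, {p | birth μ α p.1 u ≤ ENNReal.ofReal p.2 ↔ u ∈ S} := by
    ext p
    simp [population, Set.ext_iff]
  rw [this]
  refine MeasurableSet.iInter fun u => ?_
  have hm : MeasurableSet {p : (List ℕ → ℕ → ℝ) × ℝ | birth μ α p.1 u ≤ ENNReal.ofReal p.2} :=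
    measurableSet_le ((measurable_birth u).comp measurable_fst)
      (ENNReal.measurable_ofReal.comp measurable_snd)
  by_cases hu : u ∈ S
  · simpa [hu] using hm
  · simp only [hu, iff_false]
    exact hm.compl

lemma measurableSet_population_mem {μ : Measure I} [IsProbabilityMeasure μ] {α : ℝ≥0}
    (𝒮 : Set (Finset (List ℕ))) :
    MeasurableSet {p : (List ℕ → ℕ → ℝ) × ℝ | ∃ S ∈ 𝒮, population μ α p.1 p.2 = S} := by
  have : {p : (List ℕ → ℕ → ℝ) × ℝ | ∃ S ∈ 𝒮, population μ α p.1 p.2 = S} =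
      ⋃ S ∈ 𝒮, {p | population μ α p.1 p.2 = S} := by
    ext p
    simp
  rw [this]
  exact MeasurableSet.biUnion 𝒮.to_countable fun S _ => measurableSet_population_eq S

end BPMac

/-! ### Attachment rates of one unit of degree and their scaling limit. -/

namespace ParentSeq

/-- The contribution of a degree increment that happened at the arrival of the vertex `a` to the
probability of an attachment of the vertex `l` with delay `ξ`. -/
noncomputable def attachAux (α : ℝ≥0) (l a : ℕ) (ξ : I) : ℝ :=
  if a < ⌊(l : ℝ) - l * ξ⌋₊ then ((2 + α) * (⌊(l : ℝ) - l * ξ⌋₊ : ℝ) - 2)⁻¹ else 0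

/-- The contribution of a degree increment that happened at the arrival of the vertex `a` to the
probability of an attachment of the vertex `l`. -/
noncomputable def attachRate (μ : Measure I) (α : ℝ≥0) (l a : ℕ) : ℝ := ∫ ξ, attachAux α l a ξ ∂μ

lemma measurable_attachAux (α : ℝ≥0) (l a : ℕ) : Measurable (attachAux α l a) := by
  have h : Measurable fun ξ : I => ⌊(l : ℝ) - l * ξ⌋₊ := Nat.measurable_floor.comp (by fun_prop)
  exact (Measurable.of_discrete
    (f := fun m : ℕ => if a < m then ((2 + α) * (m : ℝ) - 2)⁻¹ else 0)).comp h

lemma floor_sub_mul_le (l : ℕ) (ξ : I) : ⌊(l : ℝ) - l * ξ⌋₊ ≤ l := by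
  refine Nat.floor_le_of_le ?_
  have : 0 ≤ (l : ℝ) * ξ := mul_nonneg l.cast_nonneg ξ.2.1
  linarith

/-- For a ≥ 1 only trees with m ≥ 2 vertices enter. There (2+α)m - 2 is the true total
attractiveness, whereas at m = 1 it would be α instead of 1+α. -/
lemma le_attach_denom {α : ℝ≥0} {a m : ℕ} (ha : 1 ≤ a) (h : a < m) :
    (m : ℝ) ≤ (2 + α) * (m : ℝ) - 2 := by
  have h2 : (2 : ℝ) ≤ m := by exact_mod_cast (by omega : 2 ≤ m)
  nlinarith [α.coe_nonneg]

lemma attachAux_nonneg (α : ℝ≥0) {l a : ℕ} (ha : 1 ≤ a) (ξ : I) : 0 ≤ attachAux α l a ξ := by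
  unfold attachAux
  split_ifs with h
  · exact inv_nonneg.2 (le_trans (Nat.cast_nonneg _) (le_attach_denom ha h))
  · exact le_rfl

lemma attachAux_le (α : ℝ≥0) {l a : ℕ} (ha : 1 ≤ a) (ξ : I) : attachAux α l a ξ ≤ (a : ℝ)⁻¹ := by
  have ha' : (0 : ℝ) < a := by exact_mod_cast ha
  unfold attachAux
  split_ifs with h
  · refine inv_anti₀ ha' (le_trans ?_ (le_attach_denom ha h))
    exact_mod_cast h.le
  · positivity

lemma attachAux_eq_zero (α : ℝ≥0) {l a : ℕ} (h : l ≤ a) (ξ : I) : attachAux α l a ξ = 0 :=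
  if_neg (not_lt.2 ((floor_sub_mul_le l ξ).trans h))

lemma integrable_attachAux (μ : Measure I) [IsFiniteMeasure μ] (α : ℝ≥0) {l a : ℕ} (ha : 1 ≤ a) : Integrable (attachAux α l a) μ := by
  refine Integrable.of_bound (measurable_attachAux α l a).aestronglyMeasurable (a : ℝ)⁻¹
    (ae_of_all _ fun ξ => ?_)
  rw [Real.norm_of_nonneg (attachAux_nonneg α ha ξ)]
  exact attachAux_le α ha ξ

lemma attachRate_nonneg (μ : Measure I) (α : ℝ≥0) {l a : ℕ} (ha : 1 ≤ a) : 0 ≤ attachRate μ α l a :=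
  integral_nonneg fun ξ => attachAux_nonneg α ha ξ

lemma attachRate_le (μ : Measure I) [IsProbabilityMeasure μ] (α : ℝ≥0) {l a : ℕ} (ha : 1 ≤ a) : attachRate μ α l a ≤ (a : ℝ)⁻¹ := by
  refine (integral_mono (integrable_attachAux μ α ha) (integrable_const _)
    fun ξ => attachAux_le α ha ξ).trans_eq ?_
  simp

lemma attachRate_eq_zero (μ : Measure I) (α : ℝ≥0) {l a : ℕ} (h : l ≤ a) :
    attachRate μ α l a = 0 := by
  simp [attachRate, attachAux_eq_zero α h]

lemma intervalIntegral_ceil (h : ℕ → ℝ) {a b : ℕ} (hab : a ≤ b) :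
    IntervalIntegrable (fun y : ℝ => h ⌈y⌉₊) volume a b ∧
      ∫ y in (a : ℝ)..b, h ⌈y⌉₊ = ∑ l ∈ Finset.Ioc a b, h l := by
  induction b, hab using Nat.le_induction with
  | base => simp
  | succ b hab ih =>
    have hc : Set.EqOn (fun _ : ℝ => h (b + 1)) (fun y : ℝ => h ⌈y⌉₊)
        (Set.uIoc (b : ℝ) (b + 1 : ℕ)) := by
      intro y hy
      rw [Set.uIoc_of_le (by push_cast; linarith)] at hy
      have : ⌈y⌉₊ = b + 1 := by
        rw [Nat.ceil_eq_iff (by omega)]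
        exact ⟨by simpa using hy.1, hy.2⟩
      simp [this]
    have hint : IntervalIntegrable (fun y : ℝ => h ⌈y⌉₊) volume b (b + 1 : ℕ) :=
      (intervalIntegrable_const (c := h (b + 1))).congr hc
    refine ⟨ih.1.trans hint, ?_⟩
    rw [← intervalIntegral.integral_add_adjacent_intervals ih.1 hint, ih.2,
      Finset.sum_Ioc_succ_top hab]
    congr 1
    rw [← intervalIntegral.integral_congr_ae (ae_of_all _ fun y hy => hc hy)]
    simp

/-- Writing the sum over the ratio r = l/a prepares dominated convergence. -/
lemma sum_Ioc_eq_integral (h : ℕ → ℝ) {a b : ℕ} (ha : 1 ≤ a) (hab : a ≤ b) :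
    ∑ l ∈ Finset.Ioc a b, h l = ∫ r in (1 : ℝ)..(b / a), a * h ⌈(a : ℝ) * r⌉₊ := by
  have ha' : (a : ℝ) ≠ 0 := by positivity
  rw [← (intervalIntegral_ceil h hab).2, intervalIntegral.integral_const_mul,
    intervalIntegral.integral_comp_mul_left (fun y : ℝ => h ⌈y⌉₊) ha', mul_one,
    mul_div_cancel₀ _ ha', smul_eq_mul, mul_inv_cancel_left₀ ha']

/-- For c = 1 - ξ this is the source of `delayPotentialAux`: the unit becomes visible at the ratio r
= 1/c, and ∫ dr/r turns ratios into logarithmic ages. -/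
lemma integral_indicator_inv {c x : ℝ} (hc : 0 < c) (hc1 : c ≤ 1) (hx : 0 ≤ x) :
    ∫ r in (1 : ℝ)..(Real.exp x), (if 1 < r * c then (r * c)⁻¹ else 0) =
      c⁻¹ * max (x + Real.log c) 0 := by
  have h1 : 1 ≤ Real.exp x := Real.one_le_exp hx
  rw [intervalIntegral.integral_of_le h1]
  have h2 : (fun r : ℝ => if 1 < r * c then (r * c)⁻¹ else 0) =
      (Set.Ioi c⁻¹).indicator fun r => (r * c)⁻¹ := by
    ext r
    simp only [Set.indicator_apply, Set.mem_Ioi, inv_lt_iff_one_lt_mul₀ hc]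
  have h3 : Set.Ioc 1 (Real.exp x) ∩ Set.Ioi c⁻¹ = Set.Ioc c⁻¹ (Real.exp x) := by
    ext r
    have := (one_le_inv₀ hc).2 hc1
    simp only [Set.mem_inter_iff, Set.mem_Ioc, Set.mem_Ioi]
    exact ⟨fun h => ⟨h.2, h.1.2⟩, fun h => ⟨⟨this.trans_lt h.1, h.2⟩, h.1⟩⟩
  rw [h2, setIntegral_indicator measurableSet_Ioi, h3]
  rcases le_total (Real.exp x) c⁻¹ with h | h
  · have hl : x + Real.log c ≤ 0 := by
      have := Real.log_le_log (Real.exp_pos x) h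
      rw [Real.log_exp, Real.log_inv] at this
      linarith
    rw [Set.Ioc_eq_empty (not_lt.2 h), setIntegral_empty, max_eq_right hl, mul_zero]
  · have hl : 0 ≤ x + Real.log c := by
      have := Real.log_le_log (inv_pos.2 hc) h
      rw [Real.log_exp, Real.log_inv] at this
      linarith
    rw [← intervalIntegral.integral_of_le h]
    simp only [mul_inv]
    rw [intervalIntegral.integral_mul_const, integral_inv_of_pos (inv_pos.2 hc) (Real.exp_pos x),
      Real.log_div (Real.exp_pos x).ne' (inv_ne_zero hc.ne'), Real.log_exp, Real.log_inv,
      max_eq_left hl]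
    ring

lemma tendsto_floor_div {a : ℕ → ℕ} (ha : Tendsto a atTop atTop) {y : ℕ → ℝ} {c : ℝ}
    (hy : ∀ n, 0 ≤ y n) (h : Tendsto (fun n => y n / a n) atTop (𝓝 c)) :
    Tendsto (fun n => (⌊y n⌋₊ : ℝ) / a n) atTop (𝓝 c) := by
  have ha' : Tendsto (fun n => (a n : ℝ)) atTop atTop := tendsto_natCast_atTop_atTop.comp ha
  have h0 : Tendsto (fun n => (1 : ℝ) / a n) atTop (𝓝 0) := tendsto_const_nhds.div_atTop ha'
  have h1 : Tendsto (fun n => (y n - 1) / a n) atTop (𝓝 c) := by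
    have := h.sub h0
    rw [sub_zero] at this
    exact this.congr fun n => by ring
  refine tendsto_of_tendsto_of_tendsto_of_le_of_le h1 h (fun n => ?_) fun n => ?_
  · exact div_le_div_of_nonneg_right (by linarith [Nat.lt_floor_add_one (y n)]) (Nat.cast_nonneg _)
  · exact div_le_div_of_nonneg_right (Nat.floor_le (hy n)) (Nat.cast_nonneg _)

lemma tendsto_ceil_mul_div {a : ℕ → ℕ} (ha : Tendsto a atTop atTop) {r : ℝ} (hr : 0 ≤ r) :
    Tendsto (fun n => (⌈(a n : ℝ) * r⌉₊ : ℝ) / a n) atTop (𝓝 r) := by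
  have ha' : Tendsto (fun n => (a n : ℝ)) atTop atTop := tendsto_natCast_atTop_atTop.comp ha
  have h0 : Tendsto (fun n => r + (1 : ℝ) / a n) atTop (𝓝 (r + 0)) :=
    tendsto_const_nhds.add (tendsto_const_nhds.div_atTop ha')
  rw [add_zero] at h0
  refine tendsto_of_tendsto_of_tendsto_of_le_of_le' tendsto_const_nhds h0 ?_ ?_
  · filter_upwards [ha.eventually_ge_atTop 1] with n hn
    have hn' : (0 : ℝ) < a n := by exact_mod_cast hn
    rw [le_div_iff₀ hn', mul_comm]
    exact Nat.le_ceil _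
  · filter_upwards [ha.eventually_ge_atTop 1] with n hn
    have hn' : (0 : ℝ) < a n := by exact_mod_cast hn
    rw [div_le_iff₀ hn', add_mul, div_mul_cancel₀ _ hn'.ne', mul_comm r]
    exact (Nat.ceil_lt_add_one (by positivity)).le

/-- The observed tree has about a·r(1-ξ) vertices. The excluded value r(1-ξ) = 1 is the jump at
which the vertex a enters it. -/
lemma tendsto_mul_attachAux (α : ℝ≥0) {a l : ℕ → ℕ} (ha : Tendsto a atTop atTop) {r : ℝ}
    (hl : Tendsto (fun n => (l n : ℝ) / a n) atTop (𝓝 r)) (ξ : I)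
    (hne : r * (1 - ξ) ≠ 1) :
    Tendsto (fun n => (a n : ℝ) * attachAux α (l n) (a n) ξ) atTop
      (𝓝 ((2 + α : ℝ)⁻¹ * if 1 < r * (1 - ξ) then (r * (1 - ξ))⁻¹ else 0)) := by
  have ha' : Tendsto (fun n => (a n : ℝ)) atTop atTop := tendsto_natCast_atTop_atTop.comp ha
  have hm : Tendsto (fun n => (⌊(l n : ℝ) - l n * ξ⌋₊ : ℝ) / a n) atTop (𝓝 (r * (1 - ξ))) := by
    refine tendsto_floor_div ha (fun n => ?_) ?_
    · rw [← mul_one_sub]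
      exact mul_nonneg (Nat.cast_nonneg _) (BPMac.one_sub_nonneg ξ)
    · refine (hl.mul_const (1 - (ξ : ℝ))).congr fun n => ?_
      ring
  rcases hne.lt_or_gt with h | h
  · rw [if_neg h.not_gt, mul_zero]
    refine tendsto_const_nhds.congr' ?_
    filter_upwards [hm.eventually_lt_const h, ha.eventually_ge_atTop 1] with n hn hn1
    have hn' : (0 : ℝ) < a n := by exact_mod_cast hn1
    rw [div_lt_one hn'] at hn
    rw [attachAux, if_neg (by exact_mod_cast hn.not_gt), mul_zero]
  · rw [if_pos h, ← mul_inv]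
    have hlim : Tendsto (fun n => ((2 + α) * ((⌊(l n : ℝ) - l n * ξ⌋₊ : ℝ) / a n) - 2 / a n)⁻¹)
        atTop (𝓝 ((2 + α : ℝ) * (r * (1 - ξ)))⁻¹) := by
      have h0 : Tendsto (fun n => (2 : ℝ) / a n) atTop (𝓝 0) := tendsto_const_nhds.div_atTop ha'
      have := ((hm.const_mul (2 + α : ℝ)).sub h0)
      rw [sub_zero] at this
      exact this.inv₀ (mul_ne_zero (by positivity) (by linarith))
    refine hlim.congr' ?_
    filter_upwards [hm.eventually_const_lt h, ha.eventually_ge_atTop 1] with n hn hn1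
    have hn' : (0 : ℝ) < a n := by exact_mod_cast hn1
    rw [one_lt_div hn'] at hn
    rw [attachAux, if_pos (by exact_mod_cast hn), ← mul_div_assoc, ← sub_div, inv_div, div_eq_mul_inv]

lemma tendsto_sum_attachAux (α : ℝ≥0) {a b : ℕ → ℕ} (ha : Tendsto a atTop atTop) {x : ℝ}
    (hx : 0 ≤ x) (hb : Tendsto (fun n => (b n : ℝ) / a n) atTop (𝓝 (Real.exp x)))
    (hab : ∀ᶠ n in atTop, a n ≤ b n) (ξ : I) :
    Tendsto (fun n => ∑ l ∈ Finset.Ioc (a n) (b n), attachAux α l (a n) ξ) atTop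
      (𝓝 ((2 + α : ℝ)⁻¹ * BPMac.delayPotentialAux x ξ)) := by
  -- A fixed interval (1, R] that eventually contains the moving endpoint b/a.
  set R := Real.exp x + 1 with hR
  have hex : 1 ≤ Real.exp x := Real.one_le_exp hx
  rcases (BPMac.one_sub_nonneg ξ).eq_or_lt with hc | hc
  · have h1 : (ξ : ℝ) = 1 := by linarith
    simp [BPMac.delayPotentialAux, attachAux, h1]
  have hlim : (2 + α : ℝ)⁻¹ * BPMac.delayPotentialAux x ξ = ∫ r in Set.Ioc 1 R,
      (Set.Iic (Real.exp x)).indicator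
        (fun r => (2 + α : ℝ)⁻¹ * if 1 < r * (1 - ξ) then (r * (1 - ξ))⁻¹ else 0) r := by
    rw [setIntegral_indicator measurableSet_Iic, Set.Ioc_inter_Iic, min_eq_right (by linarith),
      ← intervalIntegral.integral_of_le hex, intervalIntegral.integral_const_mul,
      integral_indicator_inv hc (by linarith [ξ.2.1]) hx]
    rfl
  have hsum : ∀ᶠ n in atTop, ∫ r in Set.Ioc 1 R, (Set.Iic ((b n : ℝ) / a n)).indicator
      (fun r => (a n : ℝ) * attachAux α ⌈(a n : ℝ) * r⌉₊ (a n) ξ) r =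
        ∑ l ∈ Finset.Ioc (a n) (b n), attachAux α l (a n) ξ := by
    filter_upwards [hab, ha.eventually_ge_atTop 1,
      hb.eventually_lt_const (show Real.exp x < R by linarith)] with n hn hn1 hn2
    have hn' : (0 : ℝ) < a n := by exact_mod_cast hn1
    rw [setIntegral_indicator measurableSet_Iic, Set.Ioc_inter_Iic, min_eq_right hn2.le,
      ← intervalIntegral.integral_of_le, sum_Ioc_eq_integral _ hn1 hn]
    rw [one_le_div hn']
    exact_mod_cast hn
  rw [hlim]
  refine Tendsto.congr' hsum ?_
  refine tendsto_integral_filter_of_dominated_convergence (fun _ => 1) ?_ ?_ (by simp) ?_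
  · refine Eventually.of_forall fun n => Measurable.aestronglyMeasurable ?_
    refine Measurable.indicator (Measurable.const_mul ?_ _) measurableSet_Iic
    exact (Measurable.of_discrete (f := fun l : ℕ => attachAux α l (a n) ξ)).comp
      (Nat.measurable_ceil.comp (by fun_prop))
  · filter_upwards [ha.eventually_ge_atTop 1] with n hn
    refine ae_of_all _ fun r => ?_
    have hn' : (0 : ℝ) < a n := by exact_mod_cast hn
    refine (norm_indicator_le_norm_self _ _).trans ?_
    rw [Real.norm_of_nonneg (mul_nonneg hn'.le (attachAux_nonneg α hn ξ))]
    refine (mul_le_mul_of_nonneg_left (attachAux_le α hn ξ) hn'.le).trans_eq ?_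
    exact mul_inv_cancel₀ hn'.ne'
  -- Two ratios are excepted: the endpoint e^x and the visibility threshold 1/(1-ξ).
  · have hne : ∀ᵐ r ∂(volume.restrict (Set.Ioc 1 R)), r ≠ Real.exp x ∧ r ≠ (1 - (ξ : ℝ))⁻¹ :=
      (Measure.ae_ne _ _).and (Measure.ae_ne _ _)
    filter_upwards [hne, ae_restrict_mem measurableSet_Ioc] with r hr hrm
    have hr0 : 0 < r := one_pos.trans hrm.1
    have ht := tendsto_mul_attachAux α ha (tendsto_ceil_mul_div ha hr0.le) ξ
      (fun h => hr.2 (eq_inv_of_mul_eq_one_left h))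
    rcases hr.1.lt_or_gt with h | h
    · rw [Set.indicator_of_mem (show r ∈ Set.Iic (Real.exp x) from h.le)]
      refine ht.congr' ?_
      filter_upwards [hb.eventually_const_lt h] with n hn
      rw [Set.indicator_of_mem (show r ∈ Set.Iic ((b n : ℝ) / a n) from hn.le)]
    · rw [Set.indicator_of_notMem (show r ∉ Set.Iic (Real.exp x) from h.not_ge)]
      refine tendsto_const_nhds.congr' ?_
      filter_upwards [hb.eventually_lt_const h] with n hn
      rw [Set.indicator_of_notMem (show r ∉ Set.Iic ((b n : ℝ) / a n) from hn.not_ge)]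

/-- The accumulated attachment rates converge to the delay potential. -/
lemma tendsto_sum_attachRate (μ : Measure I) [IsProbabilityMeasure μ] (α : ℝ≥0) {a b : ℕ → ℕ}
    (ha : Tendsto a atTop atTop) {x : ℝ} (hx : 0 ≤ x)
    (hb : Tendsto (fun n => (b n : ℝ) / a n) atTop (𝓝 (Real.exp x)))
    (hab : ∀ᶠ n in atTop, a n ≤ b n) :
    Tendsto (fun n => ∑ l ∈ Finset.Ioc (a n) (b n), attachRate μ α l (a n)) atTop
      (𝓝 ((2 + α : ℝ)⁻¹ * BPMac.delayPotential μ x)) := by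
  rw [BPMac.delayPotential, ← integral_const_mul]
  have hsum : ∀ᶠ n in atTop, ∫ ξ, ∑ l ∈ Finset.Ioc (a n) (b n), attachAux α l (a n) ξ ∂μ =
      ∑ l ∈ Finset.Ioc (a n) (b n), attachRate μ α l (a n) := by
    filter_upwards [ha.eventually_ge_atTop 1] with n hn
    rw [integral_finsetSum _ fun l _ => integrable_attachAux μ α hn]
    rfl
  refine Tendsto.congr' hsum ?_
  refine tendsto_integral_filter_of_dominated_convergence (fun _ => Real.exp x + 1) ?_ ?_
    (integrable_const _) (ae_of_all _ fun ξ => tendsto_sum_attachAux α ha hx hb hab ξ)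
  · exact Eventually.of_forall fun n => (Finset.measurable_fun_sum _ fun l _ =>
      measurable_attachAux α l (a n)).aestronglyMeasurable
  · filter_upwards [ha.eventually_ge_atTop 1,
      hb.eventually_lt_const (show Real.exp x < Real.exp x + 1 by linarith)] with n hn hn2
    refine ae_of_all _ fun ξ => ?_
    have hn' : (0 : ℝ) < a n := by exact_mod_cast hn
    rw [Real.norm_of_nonneg (Finset.sum_nonneg fun l _ => attachAux_nonneg α hn ξ)]
    calc _ ≤ ∑ l ∈ Finset.Ioc (a n) (b n), (a n : ℝ)⁻¹ :=
          Finset.sum_le_sum fun l _ => attachAux_le α hn ξ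
      _ = ((b n - a n : ℕ) : ℝ) / a n := by simp [div_eq_mul_inv]
      _ ≤ (b n : ℝ) / a n := by
          gcongr
          exact Nat.sub_le _ _
      _ ≤ _ := hn2.le

end ParentSeq

/-! ### The discrete branching process driven by clocks, and its scaling limit. -/

namespace ParentSeq

/-- The probability that the vertex `l` attaches to the vertex `L 0` whose children so far are
`L 1, …, L i`. -/
noncomputable def childRate (μ : Measure I) (α : ℝ≥0) (L : ℕ → ℕ) (i l : ℕ) : ℝ :=
  (1 + α) * attachRate μ α l (L 0) + ∑ j ∈ Finset.range i, attachRate μ α l (L (j + 1))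

lemma childRate_nonneg (μ : Measure I) (α : ℝ≥0) {L : ℕ → ℕ} {i : ℕ} (hL : ∀ j ≤ i, 1 ≤ L j)
    (l : ℕ) : 0 ≤ childRate μ α L i l :=
  add_nonneg (mul_nonneg (by positivity) (attachRate_nonneg μ α (hL 0 i.zero_le)))
    (Finset.sum_nonneg fun j hj => attachRate_nonneg μ α (hL _ (Finset.mem_range.1 hj)))

lemma childRate_congr (μ : Measure I) (α : ℝ≥0) {L L' : ℕ → ℕ} {i : ℕ}
    (h : ∀ j ≤ i, L j = L' j) (l : ℕ) : childRate μ α L i l = childRate μ α L' i l := by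
  unfold childRate
  rw [h 0 i.zero_le]
  congr 1
  exact Finset.sum_congr rfl fun j hj => by rw [h (j + 1) (Finset.mem_range.1 hj)]

lemma sum_Ioc_sub_sum_Ioc {a b c : ℕ} (hab : a ≤ b) (hbc : b ≤ c) (f : ℕ → ℝ) :
    ∑ l ∈ Finset.Ioc b c, f l = ∑ l ∈ Finset.Ioc a c, f l - ∑ l ∈ Finset.Ioc a b, f l := by
  rw [eq_sub_iff_add_eq', ← Finset.sum_union]
  · rw [Finset.Ioc_union_Ioc_eq_Ioc hab hbc]
  · exact Finset.disjoint_left.2 fun x hx hx' => by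
      simp only [Finset.mem_Ioc] at hx hx'
      omega

lemma sum_childRate_eq (μ : Measure I) (α : ℝ≥0) {L : ℕ → ℕ} (hL : Monotone L) (i : ℕ) {b : ℕ}
    (hb : L i ≤ b) : ∑ l ∈ Finset.Ioc (L i) b, childRate μ α L i l =
      (1 + α) * (∑ l ∈ Finset.Ioc (L 0) b, attachRate μ α l (L 0) -
        ∑ l ∈ Finset.Ioc (L 0) (L i), attachRate μ α l (L 0)) +
      ∑ j ∈ Finset.range i, (∑ l ∈ Finset.Ioc (L (j + 1)) b, attachRate μ α l (L (j + 1)) -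
        ∑ l ∈ Finset.Ioc (L (j + 1)) (L i), attachRate μ α l (L (j + 1))) := by
  simp only [childRate]
  rw [Finset.sum_add_distrib, ← Finset.mul_sum, Finset.sum_comm,
    sum_Ioc_sub_sum_Ioc (hL i.zero_le) hb]
  congr 1
  exact Finset.sum_congr rfl fun j hj =>
    sum_Ioc_sub_sum_Ioc (hL (Finset.mem_range.1 hj)) hb _

/-- The first time after `prev` at which the rates `p` accumulate to `x`, or at least `N`. -/
noncomputable def nextLabel (N : ℕ) (p : ℕ → ℝ) (x : ℝ) (prev : ℕ) : ℕ :=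
  sInf {l | prev < l ∧ (N ≤ l ∨ x ≤ ∑ j ∈ Finset.Ioc prev l, p j)}

/-- The alternative N ≤ l keeps the defining set nonempty even if the rates never reach the clock;
labels from N on stand for children that are not yet present. -/
lemma nextLabel_spec (N : ℕ) (p : ℕ → ℝ) (x : ℝ) (prev : ℕ) :
    prev < nextLabel N p x prev ∧ (N ≤ nextLabel N p x prev ∨
      x ≤ ∑ j ∈ Finset.Ioc prev (nextLabel N p x prev), p j) :=
  Nat.sInf_mem (s := {l | prev < l ∧ (N ≤ l ∨ x ≤ ∑ j ∈ Finset.Ioc prev l, p j)})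
    ⟨max (prev + 1) N, lt_of_lt_of_le prev.lt_succ_self (le_max_left _ _),
      Or.inl (le_max_right _ _)⟩

lemma nextLabel_le {N : ℕ} {p : ℕ → ℝ} {x : ℝ} {prev l : ℕ} (h : prev < l)
    (h' : x ≤ ∑ j ∈ Finset.Ioc prev l, p j) : nextLabel N p x prev ≤ l :=
  Nat.sInf_le (s := {l | prev < l ∧ (N ≤ l ∨ x ≤ ∑ j ∈ Finset.Ioc prev l, p j)}) ⟨h, Or.inr h'⟩

lemma sum_lt_of_lt_nextLabel {N : ℕ} {p : ℕ → ℝ} {x : ℝ} (hx : 0 < x) {prev l : ℕ}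
    (h : l < nextLabel N p x prev) : ∑ j ∈ Finset.Ioc prev l, p j < x := by
  rcases le_or_gt l prev with hl | hl
  · rw [Finset.Ioc_eq_empty (by omega), Finset.sum_empty]
    exact hx
  · by_contra hcon
    exact absurd (nextLabel_le (N := N) hl (not_lt.1 hcon)) (not_le.2 h)

lemma lt_nextLabel {N : ℕ} {p : ℕ → ℝ} (hp : ∀ l, 0 ≤ p l) {x : ℝ} {prev b : ℕ} (hbN : b < N)
    (h : ∑ j ∈ Finset.Ioc prev b, p j < x) : b < nextLabel N p x prev := by
  by_contra hcon
  have hle := not_lt.1 hcon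
  rcases (nextLabel_spec N p x prev).2 with h1 | h1
  · omega
  · have : ∑ j ∈ Finset.Ioc prev (nextLabel N p x prev), p j ≤ ∑ j ∈ Finset.Ioc prev b, p j :=
      Finset.sum_le_sum_of_subset_of_nonneg (Finset.Ioc_subset_Ioc_right hle) fun j _ _ => hp j
    linarith

/-- The labels of the children of the vertex `v` driven by the variables `z`, together with the
current attachment probabilities. -/
noncomputable def labelState (μ : Measure I) (α : ℝ≥0) (N v : ℕ) (z : ℕ → ℝ) : ℕ → ℕ × (ℕ → ℝ)
  | 0 => (v, fun l => (1 + α) * attachRate μ α l v)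
  | i + 1 =>
    (nextLabel N (labelState μ α N v z i).2 (z i) (labelState μ α N v z i).1, fun l =>
      (labelState μ α N v z i).2 l + attachRate μ α l
        (nextLabel N (labelState μ α N v z i).2 (z i) (labelState μ α N v z i).1))

/-- The label of the `i`-th child of the vertex `v` driven by the variables `z`. -/
noncomputable def label (μ : Measure I) (α : ℝ≥0) (N v : ℕ) (z : ℕ → ℝ) (i : ℕ) : ℕ :=
  (labelState μ α N v z i).1

lemma label_zero (μ : Measure I) (α : ℝ≥0) (N v : ℕ) (z : ℕ → ℝ) : label μ α N v z 0 = v := rfl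

lemma labelState_snd (μ : Measure I) (α : ℝ≥0) (N v : ℕ) (z : ℕ → ℝ) (i : ℕ) :
    (labelState μ α N v z i).2 = childRate μ α (label μ α N v z) i := by
  induction i with
  | zero => ext l; simp [labelState, childRate, label_zero]
  | succ i ih =>
    ext l
    rw [childRate, Finset.sum_range_succ, ← add_assoc, ← childRate, ← ih]
    rfl

lemma label_succ (μ : Measure I) (α : ℝ≥0) (N v : ℕ) (z : ℕ → ℝ) (i : ℕ) :
    label μ α N v z (i + 1) =
      nextLabel N (childRate μ α (label μ α N v z) i) (z i) (label μ α N v z i) := by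
  rw [← labelState_snd]
  rfl

lemma label_strictMono (μ : Measure I) (α : ℝ≥0) (N v : ℕ) (z : ℕ → ℝ) :
    StrictMono (label μ α N v z) :=
  strictMono_nat_of_lt_succ fun i => by
    rw [label_succ]
    exact (nextLabel_spec _ _ _ _).1

/-- The labels of the individuals of the discrete branching process driven by `e`. -/
noncomputable def birthLabel (μ : Measure I) (α : ℝ≥0) (N v : ℕ) (e : List ℕ → ℕ → ℝ) :
    List ℕ → ℕ
  | [] => v
  | i :: u => label μ α N (birthLabel μ α N v e u) (e u) (i + 1)

lemma childRate_label_nonneg {μ : Measure I} {α : ℝ≥0} {N v : ℕ} (hv : 1 ≤ v) (z : ℕ → ℝ) (i l : ℕ) :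
    0 ≤ childRate μ α (label μ α N v z) i l :=
  childRate_nonneg μ α (fun j _ => hv.trans ((label_strictMono μ α N v z).monotone j.zero_le)) l

section Convergence

open BPMac

variable {μ : Measure I} [IsProbabilityMeasure μ] {α : ℝ≥0}

/-- Each unit's sum over (L_i, b] is its sum up to b minus its sum up to L_i, both counted from the
arrival that started the unit. Both converge to the potential, and the limits assemble to the
compensator increment. -/
lemma tendsto_sum_childRate {z : ℕ → ℝ} {i : ℕ} (hi : sigma μ α z i ≠ ⊤) {L : ℕ → ℕ → ℕ}
    (hmono : ∀ n, Monotone (L n)) (h0 : Tendsto (fun n => L n 0) atTop atTop)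
    (hL : ∀ j ≤ i, Tendsto (fun n => (L n j : ℝ) / L n 0) atTop (𝓝 (Real.exp (realSigma μ α z j))))
    {b : ℕ → ℕ} {x : ℝ} (hx : realSigma μ α z i < x)
    (hb : Tendsto (fun n => (b n : ℝ) / L n 0) atTop (𝓝 (Real.exp x))) :
    Tendsto (fun n => ∑ l ∈ Finset.Ioc (L n i) (b n), childRate μ α (L n) i l) atTop
      (𝓝 (accHazard μ α z i x)) := by
  have hev : ∀ᶠ n in atTop, L n i ≤ b n := by
    obtain ⟨y, hy1, hy2⟩ := exists_between (Real.exp_lt_exp.2 hx)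
    filter_upwards [(hL i le_rfl).eventually_lt_const hy1, hb.eventually_const_lt hy2,
      h0.eventually_ge_atTop 1] with n h1 h2 h3
    have h3' : (0 : ℝ) < L n 0 := by exact_mod_cast h3
    have := (div_lt_div_iff_of_pos_right h3').1 (h1.trans h2)
    exact_mod_cast this.le
  have hat : ∀ j, Tendsto (fun n => L n j) atTop atTop := fun j =>
    tendsto_atTop_mono (fun n => hmono n j.zero_le) h0
  have hratio : ∀ {c : ℕ → ℕ} {y : ℝ}, Tendsto (fun n => (c n : ℝ) / L n 0) atTop (𝓝 (Real.exp y)) →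
      ∀ j ≤ i, Tendsto (fun n => (c n : ℝ) / L n j) atTop
        (𝓝 (Real.exp (y - realSigma μ α z j))) := by
    intro c y hc j hj
    rw [Real.exp_sub]
    refine (hc.div (hL j hj) (Real.exp_pos _).ne').congr' ?_
    filter_upwards [h0.eventually_ge_atTop 1] with n h3
    have h3' : (L n 0 : ℝ) ≠ 0 := by positivity
    exact div_div_div_cancel_right₀ h3' _ _
  have hψ : ∀ j ≤ i, Tendsto (fun n => ∑ l ∈ Finset.Ioc (L n j) (b n), attachRate μ α l (L n j) -
      ∑ l ∈ Finset.Ioc (L n j) (L n i), attachRate μ α l (L n j)) atTop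
      (𝓝 ((2 + α : ℝ)⁻¹ * delayPotential μ (x - realSigma μ α z j) -
        (2 + α : ℝ)⁻¹ * delayPotential μ (realSigma μ α z i - realSigma μ α z j))) := by
    intro j hj
    have hji := realSigma_le hj hi
    refine (tendsto_sum_attachRate μ α (hat j) (by linarith) (hratio hb j hj) ?_).sub
      (tendsto_sum_attachRate μ α (hat j) (by linarith) (hratio (hL i le_rfl) j hj)
        (Eventually.of_forall fun n => hmono n hj))
    filter_upwards [hev] with n hn using (hmono n hj).trans hn
  have hlim := ((hψ 0 i.zero_le).const_mul (1 + α : ℝ)).add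
    (tendsto_finsetSum (Finset.range i) fun j hj => hψ (j + 1) (Finset.mem_range.1 hj))
  have heq : accHazard μ α z i x = (1 + α : ℝ) *
      ((2 + α : ℝ)⁻¹ * delayPotential μ (x - realSigma μ α z 0) -
        (2 + α : ℝ)⁻¹ * delayPotential μ (realSigma μ α z i - realSigma μ α z 0)) +
      ∑ j ∈ Finset.range i, ((2 + α : ℝ)⁻¹ * delayPotential μ (x - realSigma μ α z (j + 1)) -
        (2 + α : ℝ)⁻¹ * delayPotential μ (realSigma μ α z i - realSigma μ α z (j + 1))) := by
    rw [accHazard, compensator, compensator, Finset.sum_sub_distrib, ← Finset.mul_sum,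
      ← Finset.mul_sum, realSigma_zero]
    simp only [sub_zero]
    ring
  rw [heq]
  refine hlim.congr' ?_
  filter_upwards [hev] with n hn
  rw [sum_childRate_eq μ α (hmono n) i hn]

lemma tendsto_floor_mul_div {v : ℕ → ℕ} (hv : Tendsto v atTop atTop) {c : ℝ} (hc : 0 ≤ c) :
    Tendsto (fun n => (⌊(v n : ℝ) * c⌋₊ : ℝ) / v n) atTop (𝓝 c) := by
  refine tendsto_floor_div hv (fun n => by positivity) (tendsto_const_nhds.congr' ?_)
  filter_upwards [hv.eventually_ge_atTop 1] with n hn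
  have : (v n : ℝ) ≠ 0 := by positivity
  field_simp

/-- Convergence of the rescaled labels of the children of a vertex. -/
lemma label_limit {z : ℕ → ℝ} (hz : ∀ i, 0 < z i) {v N : ℕ → ℕ} (hv : Tendsto v atTop atTop)
    {t : ℝ} (ht : 0 < t) (hN : Tendsto (fun n => (N n : ℝ) / v n) atTop (𝓝 (Real.exp t)))
    (hne : ∀ i, sigma μ α z i ≠ ENNReal.ofReal t) (i : ℕ) :
    (sigma μ α z i < ENNReal.ofReal t →
      Tendsto (fun n => (label μ α (N n) (v n) z i : ℝ) / v n) atTop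
        (𝓝 (Real.exp (realSigma μ α z i)))) ∧
    (ENNReal.ofReal t < sigma μ α z i → ∀ᶠ n in atTop, N n ≤ label μ α (N n) (v n) z i) := by
  induction i using Nat.strong_induction_on with | _ i ih =>
  cases i with
  | zero =>
    refine ⟨fun _ => ?_, fun h => absurd h (by simp [sigma_zero])⟩
    rw [realSigma_zero, Real.exp_zero]
    refine tendsto_const_nhds.congr' ?_
    filter_upwards [hv.eventually_ge_atTop 1] with n hn
    have : (v n : ℝ) ≠ 0 := by positivity
    rw [label_zero, div_self this]
  | succ i =>
    have hmono := sigma_mono μ α z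
    rcases (hne i).lt_or_gt with hit | hit
    swap
    · refine ⟨fun h => absurd (hit.trans_le (hmono i.le_succ)) h.not_gt, fun _ => ?_⟩
      filter_upwards [(ih i i.lt_succ_self).2 hit] with n hn
      exact hn.trans ((label_strictMono μ α _ _ z).monotone i.le_succ)
    have hi : sigma μ α z i ≠ ⊤ := ne_top_of_lt hit
    have hit' : realSigma μ α z i < t := by
      rwa [← ofReal_realSigma hi, ENNReal.ofReal_lt_ofReal_iff ht] at hit
    have hL : ∀ j ≤ i, Tendsto (fun n => (label μ α (N n) (v n) z j : ℝ) /
        label μ α (N n) (v n) z 0) atTop (𝓝 (Real.exp (realSigma μ α z j))) := fun j hj =>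
      (ih j (by omega)).1 ((hmono hj).trans_lt hit)
    have hsum : ∀ {b : ℕ → ℕ} {x : ℝ}, realSigma μ α z i < x →
        Tendsto (fun n => (b n : ℝ) / v n) atTop (𝓝 (Real.exp x)) →
        Tendsto (fun n => ∑ l ∈ Finset.Ioc (label μ α (N n) (v n) z i) (b n),
          childRate μ α (label μ α (N n) (v n) z) i l) atTop (𝓝 (accHazard μ α z i x)) :=
      fun hx hb => tendsto_sum_childRate hi (fun n => (label_strictMono μ α _ _ z).monotone)
        hv hL hx hb
    have hfl : ∀ x, Tendsto (fun n => (⌊(v n : ℝ) * Real.exp x⌋₊ : ℝ) / v n) atTop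
        (𝓝 (Real.exp x)) := fun x => tendsto_floor_mul_div hv (Real.exp_pos x).le
    have hcmp : ∀ {c d : ℕ → ℕ} {x y : ℝ}, x < y →
        Tendsto (fun n => (c n : ℝ) / v n) atTop (𝓝 (Real.exp x)) →
        Tendsto (fun n => (d n : ℝ) / v n) atTop (𝓝 (Real.exp y)) → ∀ᶠ n in atTop, c n < d n := by
      intro c d x y hxy hc hd
      obtain ⟨w, hw1, hw2⟩ := exists_between (Real.exp_lt_exp.2 hxy)
      filter_upwards [hc.eventually_lt_const hw1, hd.eventually_const_lt hw2,
        hv.eventually_ge_atTop 1] with n h1 h2 h3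
      have h3' : (0 : ℝ) < v n := by exact_mod_cast h3
      exact_mod_cast (div_lt_div_iff_of_pos_right h3').1 (h1.trans h2)
    constructor
    · intro h
      have hi1 : sigma μ α z (i + 1) ≠ ⊤ := ne_top_of_lt h
      have hlt : realSigma μ α z i < realSigma μ α z (i + 1) :=
        (ENNReal.toReal_lt_toReal hi hi1).2 (sigma_lt_sigma_succ hi (hz i))
      have ht1 : realSigma μ α z (i + 1) < t := by
        rwa [← ofReal_realSigma hi1, ENNReal.ofReal_lt_ofReal_iff ht] at h
      refine tendsto_order.2 ⟨fun y hy => ?_, fun y hy => ?_⟩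
      -- Lower bound: choose an age x just before σ_{i+1}. The rates summed up to v·e^x stay below
      -- the clock, so the child comes later.
      · obtain ⟨x, hx1, hx2⟩ := (((Real.continuous_exp.tendsto _).eventually_const_lt hy).filter_mono
          nhdsWithin_le_nhds |>.and (Ioo_mem_nhdsLT hlt)).exists
        have hacc : accHazard μ α z i x < z i := by
          rw [← lt_sigma_succ_iff hi hx2.1.le, ← ofReal_realSigma hi1, ENNReal.ofReal_lt_ofReal_iff
            ((ENNReal.toReal_nonneg : 0 ≤ realSigma μ α z i).trans_lt hlt)]
          exact hx2.2
        filter_upwards [(hsum hx2.1 (hfl x)).eventually_lt_const hacc,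
          (hfl x).eventually_const_lt hx1, hcmp (hx2.2.trans ht1) (hfl x) hN,
          hv.eventually_ge_atTop 1] with n h1 h2 h3 h4
        have := lt_nextLabel (childRate_label_nonneg h4 z i) h3 h1
        rw [← label_succ] at this
        refine h2.trans_le (div_le_div_of_nonneg_right ?_ (Nat.cast_nonneg _))
        exact_mod_cast this.le
      -- Upper bound: just after σ_{i+1} the limit exceeds the clock strictly, so the rates summed
      -- up to v·e^x eventually exceed it too.
      · obtain ⟨x, hx1, hx2⟩ := (((Real.continuous_exp.tendsto _).eventually_lt_const hy).filter_mono
          nhdsWithin_le_nhds |>.and (Ioo_mem_nhdsGT ht1)).exists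
        have hacc := lt_accHazard hi1 (hz i) hx2.1
        filter_upwards [(hsum (hlt.trans hx2.1) (hfl x)).eventually_const_lt hacc,
          (hfl x).eventually_lt_const hx1, hcmp (hlt.trans hx2.1) (hL i le_rfl) (hfl x)]
          with n h1 h2 h3
        have := nextLabel_le (N := N n) h3 h1.le
        rw [← label_succ] at this
        refine lt_of_le_of_lt (div_le_div_of_nonneg_right ?_ (Nat.cast_nonneg _)) h2
        exact_mod_cast this
    · intro h
      have hacc : accHazard μ α z i t < z i := (lt_sigma_succ_iff hi hit'.le).1 h
      -- The clock is tested at N - 1, the last label below the cut-off; a next label beyond it is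
      -- at least N.
      have hN1 : Tendsto (fun n => ((N n - 1 : ℕ) : ℝ) / v n) atTop (𝓝 (Real.exp t)) := by
        have hv' : Tendsto (fun n => (v n : ℝ)) atTop atTop :=
          tendsto_natCast_atTop_atTop.comp hv
        have h0 : Tendsto (fun n => (1 : ℝ) / v n) atTop (𝓝 0) := tendsto_const_nhds.div_atTop hv'
        have h1 := hN.sub h0
        rw [sub_zero] at h1
        refine h1.congr' ?_
        filter_upwards [hcmp ht (show Tendsto (fun n => (v n : ℝ) / v n) atTop (𝓝 (Real.exp 0)) from
          (ih 0 (by omega)).1 (by simpa [sigma_zero] using ht) |> fun h' => by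
            simpa [label_zero, realSigma_zero] using h') hN] with n hn
        rw [Nat.cast_sub (by omega), Nat.cast_one, sub_div]
      filter_upwards [(hsum hit' hN1).eventually_lt_const hacc, hv.eventually_ge_atTop 1]
        with n h1 h2
      rcases Nat.eq_zero_or_pos (N n) with h3 | h3
      · omega
      · have := lt_nextLabel (childRate_label_nonneg h2 z i) (show N n - 1 < N n by omega) h1
        rw [← label_succ] at this
        omega

/-- Convergence of the rescaled labels of the individuals of the discrete branching process. -/
lemma birthLabel_limit {e : List ℕ → ℕ → ℝ} (he : ∀ u i, 0 < e u i) {v N : ℕ → ℕ}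
    (hv : Tendsto v atTop atTop) {t : ℝ} (ht : 0 < t)
    (hN : Tendsto (fun n => (N n : ℝ) / v n) atTop (𝓝 (Real.exp t)))
    (hne : ∀ u, birth μ α e u ≠ ENNReal.ofReal t) (u : List ℕ) :
    (birth μ α e u < ENNReal.ofReal t →
      Tendsto (fun n => (birthLabel μ α (N n) (v n) e u : ℝ) / v n) atTop
        (𝓝 (Real.exp (birth μ α e u).toReal))) ∧
    (ENNReal.ofReal t < birth μ α e u →
      ∀ᶠ n in atTop, N n ≤ birthLabel μ α (N n) (v n) e u) := by
  induction u with
  | nil =>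
    refine ⟨fun _ => ?_, fun h => absurd h (by simp [birth])⟩
    simp only [birth, ENNReal.toReal_zero, Real.exp_zero]
    refine tendsto_const_nhds.congr' ?_
    filter_upwards [hv.eventually_ge_atTop 1] with n hn
    have : (v n : ℝ) ≠ 0 := by positivity
    rw [birthLabel, div_self this]
  | cons i u ih =>
    rcases (hne u).lt_or_gt with hu | hu
    swap
    · refine ⟨fun h => absurd (hu.trans_le le_self_add) (not_lt.2 (by rw [← birth]; exact h.le)),
        fun _ => ?_⟩
      filter_upwards [ih.2 hu] with n hn
      exact hn.trans ((label_strictMono μ α _ _ _).monotone (Nat.zero_le _))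
    have hutop := ne_top_of_lt hu
    -- The convergence for children is restarted at the label of `u`, which plays the part of v with
    -- remaining horizon t - β.
    set β := (birth μ α e u).toReal with hβ
    have hβof : ENNReal.ofReal β = birth μ α e u := ENNReal.ofReal_toReal hutop
    have hβ0 : 0 ≤ β := ENNReal.toReal_nonneg
    have hβt : β < t := by rwa [← hβof, ENNReal.ofReal_lt_ofReal_iff ht] at hu
    have htβ : ENNReal.ofReal t = birth μ α e u + ENNReal.ofReal (t - β) := by
      rw [← hβof, ← ENNReal.ofReal_add hβ0 (by linarith), add_sub_cancel]
    have hlab := ih.1 hu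
    have hv1 : Tendsto (fun n => birthLabel μ α (N n) (v n) e u) atTop atTop := by
      have hv' : Tendsto (fun n => (v n : ℝ)) atTop atTop := tendsto_natCast_atTop_atTop.comp hv
      rw [← tendsto_natCast_atTop_iff (R := ℝ)]
      refine (hlab.pos_mul_atTop (Real.exp_pos _) hv').congr' ?_
      filter_upwards [hv.eventually_ge_atTop 1] with n hn
      have : (v n : ℝ) ≠ 0 := by positivity
      rw [div_mul_cancel₀ _ this]
    have hN1 : Tendsto (fun n => (N n : ℝ) / birthLabel μ α (N n) (v n) e u) atTop
        (𝓝 (Real.exp (t - β))) := by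
      rw [Real.exp_sub]
      refine (hN.div hlab (Real.exp_pos _).ne').congr' ?_
      filter_upwards [hv.eventually_ge_atTop 1] with n h3
      have h3' : (v n : ℝ) ≠ 0 := by positivity
      exact div_div_div_cancel_right₀ h3' _ _
    have hne1 : ∀ i, sigma μ α (e u) i ≠ ENNReal.ofReal (t - β) := by
      intro i hi
      cases i with
      | zero =>
        rw [sigma_zero] at hi
        exact absurd hi.symm (ENNReal.ofReal_pos.2 (by linarith)).ne'
      | succ i => exact hne (i :: u) (by rw [birth, hi, htβ])
    have hlim := label_limit (he u) hv1 (sub_pos.2 hβt) hN1 hne1 (i + 1)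
    constructor
    · intro h
      rw [birth, htβ, ENNReal.add_lt_add_iff_left hutop] at h
      have h1 := (hlim.1 h).mul hlab
      rw [← Real.exp_add] at h1
      rw [birth, ENNReal.toReal_add hutop (ne_top_of_lt h), add_comm]
      refine h1.congr' ?_
      filter_upwards [hv1.eventually_ge_atTop 1] with n hn
      have : (birthLabel μ α (N n) (v n) e u : ℝ) ≠ 0 := by positivity
      rw [birthLabel, div_mul_div_cancel₀ this]
    · intro h
      rw [birth, htβ, ENNReal.add_lt_add_iff_left hutop] at h
      exact hlim.2 h

end Convergence

end ParentSeq

/-! ### One step of the network, and histories that respect a labelled plane tree. -/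

namespace ParentSeq

instance (μ : Measure I) [IsProbabilityMeasure μ] (α : ℝ≥0) :
    IsProbabilityMeasure (networkLaw μ α) := by
  unfold networkLaw; infer_instance

/-- One step of the growing trees. -/
lemma mul_networkLaw_le (μ : Measure I) [IsProbabilityMeasure μ] (α : ℝ≥0) (n : ℕ)
    (B : Set ((i : Finset.Iic n) → Fin (i + 1))) (C : Set (Fin (n + 2))) {q : ℝ≥0∞}
    (hq : ∀ x ∈ B, q ≤ stepKernel μ α n x C) :
    q * networkLaw μ α {ω | Preorder.frestrictLe n ω ∈ B} ≤
      networkLaw μ α {ω | Preorder.frestrictLe n ω ∈ B ∧ ω (n + 1) ∈ C} := by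
  have hB : MeasurableSet B := B.to_countable.measurableSet
  have hC : MeasurableSet C := C.to_countable.measurableSet
  have key := Kernel.map_frestrictLe_trajMeasure_compProd_eq_map_trajMeasure
    (μ₀ := Measure.dirac (0 : Fin 1)) (X := fun i => Fin (i + 1)) (κ := stepKernel μ α) (a := n)
  have h2 := congrArg (fun m => m (B ×ˢ C)) key
  have hm : Measurable fun x : ParentSeq => (Preorder.frestrictLe (π := fun i => Fin (i + 1)) n x, x (n + 1)) := by
    fun_prop
  rw [Measure.map_apply hm (hB.prod hC), Measure.compProd_apply_prod hB hC] at h2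
  have hset : {ω : ParentSeq | Preorder.frestrictLe n ω ∈ B ∧ ω (n + 1) ∈ C} =
      (fun x : ParentSeq => (Preorder.frestrictLe (π := fun i => Fin (i + 1)) n x, x (n + 1))) ⁻¹' (B ×ˢ C) := by
    ext; simp
  rw [hset, networkLaw, ← h2]
  calc _ = q * (Measure.map (Preorder.frestrictLe (π := fun i => Fin (i + 1)) n)
        (Kernel.trajMeasure (X := fun i => Fin (i + 1)) (Measure.dirac 0) (stepKernel μ α))) B := by
        rw [Measure.map_apply (by fun_prop) hB]; rfl
    _ ≤ _ := by
        rw [← setLIntegral_const]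
        exact setLIntegral_mono' hB hq

lemma degree_eq (ω : ParentSeq) {v m : ℕ} (hm : 2 ≤ m) (hv : v < m) :
    ω.degree v m = ((Finset.range (m - 1)).filter fun i => (ω i : ℕ) = v).card +
      if v = 0 then 0 else 1 := by
  unfold degree
  rw [if_neg (by omega)]
  split_ifs with h1 h2 h2
  · omega
  · rw [Finset.card_eq_zero.2]
    refine Finset.filter_eq_empty_iff.2 fun i hi hi' => ?_
    have := (ω i).2
    rw [Finset.mem_range] at hi
    omega
  · rfl
  · rfl

lemma sum_degree (ω : ParentSeq) {m : ℕ} (hm : 2 ≤ m) :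
    ∑ v ∈ Finset.range m, ω.degree v m = 2 * (m - 1) := by
  rw [Finset.sum_congr rfl fun v hv => degree_eq ω hm (Finset.mem_range.1 hv),
    Finset.sum_add_distrib, ← Finset.card_eq_sum_card_fiberwise, Finset.card_range]
  · obtain ⟨k, rfl⟩ : ∃ k, m = k + 1 := ⟨m - 1, by omega⟩
    rw [Finset.sum_range_succ']
    simp
    omega
  · intro i hi
    have := (ω i).2
    simp only [Finset.coe_range, Set.mem_Iio] at hi ⊢
    omega

lemma sum_weight_eq (α : ℝ≥0) (ω : ParentSeq) {m n : ℕ} (hm : 2 ≤ m) (hmn : m ≤ n + 2) :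
    ∑ v : Fin (n + 2), ω.weight α m v = ENNReal.ofReal ((2 + α) * m - 2) := by
  have h1 : max m 1 = m := max_eq_left (by omega)
  rw [Fin.sum_univ_eq_sum_range (fun v => ω.weight α m v), ← Finset.sum_subset
    (Finset.range_subset_range.2 hmn) fun v _ hv => by
      rw [weight, h1, if_neg (by simpa using hv)]]
  have h2 : ∀ v ∈ Finset.range m, ω.weight α m v = ENNReal.ofReal (ω.degree v m + α) := by
    intro v hv
    rw [weight, h1, if_pos (Finset.mem_range.1 hv), ENNReal.ofReal_add (Nat.cast_nonneg _)
      α.coe_nonneg]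
    simp
  rw [Finset.sum_congr rfl h2, ← ENNReal.ofReal_sum_of_nonneg fun v _ => by positivity,
    Finset.sum_add_distrib, ← Nat.cast_sum, sum_degree ω hm, Finset.sum_const, Finset.card_range,
    nsmul_eq_mul]
  congr 1
  push_cast [Nat.cast_sub (by omega : 1 ≤ m)]
  ring

/-- The contribution of a degree increment at the arrival of `a` to the probability of an
attachment that uses the tree with `m` vertices. -/
noncomputable def unitWeight (α : ℝ≥0) (m a : ℕ) : ℝ :=
  if a < m then ((2 + α) * (m : ℝ) - 2)⁻¹ else 0

/-- The degree of a in the observed tree is one plus the number of its children with label below m;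
index i of the history is the arrival of vertex i + 1. So every increment has its own indicator of
being visible. -/
lemma attachLaw_apply (α : ℝ≥0) (ω : ParentSeq) {n m a : ℕ} (hmn : m ≤ n + 2) (ha : 1 ≤ a)
    (han : a < n + 2) :
    attachLaw α ω n m {b | (b : ℕ) = a} = ENNReal.ofReal ((1 + α) * unitWeight α m a +
      ∑ i ∈ (Finset.range (n + 1)).filter fun i => (ω i : ℕ) = a, unitWeight α m (i + 1)) := by
  have hset : {b : Fin (n + 2) | (b : ℕ) = a} = {⟨a, han⟩} := by
    ext b
    simp [Fin.ext_iff]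
  have h1 : attachLaw α ω n m {b | (b : ℕ) = a} =
      ω.weight α m a / ∑ w : Fin (n + 2), ω.weight α m w := by
    rw [attachLaw, hset]
    simp only [Measure.coe_finsetSum, Finset.sum_apply, Measure.smul_apply, smul_eq_mul]
    rw [Finset.sum_eq_single ⟨a, han⟩]
    · simp
    · intro b _ hb
      simp [hb]
    · simp
  rw [h1]
  by_cases ham : a < m
  · have hm : 2 ≤ m := by omega
    have hcard : ((Finset.range (n + 1)).filter fun i => (ω i : ℕ) = a).filter (fun i => i + 1 < m) =
        (Finset.range (m - 1)).filter fun i => (ω i : ℕ) = a := by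
      ext i
      simp only [Finset.mem_filter, Finset.mem_range]
      constructor
      · rintro ⟨⟨_, h⟩, h'⟩
        exact ⟨by omega, h⟩
      · rintro ⟨h, h'⟩
        exact ⟨⟨by omega, h'⟩, by omega⟩
    have hpos : 0 < (2 + α : ℝ) * m - 2 :=
      lt_of_lt_of_le (by positivity) (le_attach_denom ha ham)
    rw [sum_weight_eq α ω hm hmn, weight, max_eq_left (by omega), if_pos ham, degree_eq ω hm ham,
      if_neg (by omega)]
    simp only [unitWeight, if_pos ham]
    rw [← Finset.sum_filter, hcard, Finset.sum_const, nsmul_eq_mul, ← add_mul, ← div_eq_mul_inv,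
      ENNReal.ofReal_div_of_pos hpos]
    congr 1
    rw [ENNReal.ofReal_add (by positivity) (by positivity), ENNReal.ofReal_add (by norm_num)
      α.coe_nonneg]
    simp
    ring
  · have hz : ∀ i ∈ (Finset.range (n + 1)).filter fun i => (ω i : ℕ) = a,
        unitWeight α m (i + 1) = 0 := by
      intro i hi
      have := (ω i).2
      rw [Finset.mem_filter] at hi
      exact if_neg (by omega)
    rw [weight, if_neg (by omega), ENNReal.zero_div, Finset.sum_eq_zero hz, unitWeight, if_neg ham]
    simp

lemma stepKernel_apply (μ : Measure I) [IsProbabilityMeasure μ] (α : ℝ≥0) {n a : ℕ} (ha : 1 ≤ a)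
    (han : a < n + 2) (x : (i : Finset.Iic n) → Fin (i + 1)) :
    stepKernel μ α n x {b | (b : ℕ) = a} = ENNReal.ofReal ((1 + α) * attachRate μ α (n + 2) a +
      ∑ i ∈ (Finset.range (n + 1)).filter fun i => (extend n x i : ℕ) = a,
        attachRate μ α (n + 2) (i + 1)) := by
  change (μ.bind _) _ = _
  have hm : Measurable fun ξ : I =>
      attachLaw α (extend n x) n ⌊((n : ℝ) + 2) - ((n : ℝ) + 2) * (ξ : ℝ)⌋₊ :=
    (Measurable.of_discrete (f := fun m : ℕ => attachLaw α (extend n x) n m)).comp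
      (Nat.measurable_floor.comp (by fun_prop))
  rw [Measure.bind_apply (Set.to_countable _).measurableSet hm.aemeasurable]
  have h1 : ∀ ξ : I, attachLaw α (extend n x) n ⌊((n : ℝ) + 2) - ((n : ℝ) + 2) * (ξ : ℝ)⌋₊
      {b | (b : ℕ) = a} = ENNReal.ofReal ((1 + α) * attachAux α (n + 2) a ξ +
        ∑ i ∈ (Finset.range (n + 1)).filter fun i => (extend n x i : ℕ) = a,
          attachAux α (n + 2) (i + 1) ξ) := by
    intro ξ
    have h2 : ((n : ℝ) + 2) = ((n + 2 : ℕ) : ℝ) := by push_cast; ring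
    rw [h2, attachLaw_apply α _ (floor_sub_mul_le _ ξ) ha han]
    rfl
  have hint : ∀ b, 1 ≤ b → Integrable (attachAux α (n + 2) b) μ := fun b hb =>
    integrable_attachAux μ α hb
  simp only [h1]
  rw [← ofReal_integral_eq_lintegral_ofReal, integral_add, integral_const_mul, integral_finsetSum]
  · rfl
  · exact fun i _ => hint _ (by omega)
  · exact (hint a ha).const_mul _
  · exact integrable_finsetSum _ fun i _ => hint _ (by omega)
  · exact ((hint a ha).const_mul _).add (integrable_finsetSum _ fun i _ => hint _ (by omega))
  · refine ae_of_all _ fun ξ => add_nonneg (mul_nonneg (by positivity) (attachAux_nonneg α ha ξ))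
      (Finset.sum_nonneg fun i _ => attachAux_nonneg α (by omega) ξ)

/-- A finite set of words that is closed under taking parents and older siblings, in which the word
`u` has `k u` children. -/
structure IsPlaneTree (S : Finset (List ℕ)) (k : List ℕ → ℕ) : Prop where
  nil_mem : [] ∈ S
  cons_mem_iff : ∀ i u, i :: u ∈ S ↔ u ∈ S ∧ i < k u

/-- The labels of a word and of its children. -/
def childLabel (w : List ℕ → ℕ) (u : List ℕ) : ℕ → ℕ
  | 0 => w u
  | i + 1 => w (i :: u)

/-- A labelling of a plane tree that is increasing along edges and among siblings. -/
structure IsLabelling (S : Finset (List ℕ)) (w : List ℕ → ℕ) (v N : ℕ) : Prop where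
  pos : 1 ≤ v
  nil : w [] = v
  lt_cons : ∀ i u, i :: u ∈ S → childLabel w u i < w (i :: u)
  lt : ∀ u ∈ S, w u < N
  inj : Set.InjOn w S

/-- The parents of the vertices in `(v, l)` are as prescribed by the labelling `w`. -/
def Consistent (S : Finset (List ℕ)) (w : List ℕ → ℕ) (v l : ℕ) (ω : ParentSeq) : Prop :=
  ∀ j, v < j + 1 → j + 1 < l →
    (∀ i u, i :: u ∈ S → j + 1 = w (i :: u) → (ω j : ℕ) = w u) ∧
    ((∀ u ∈ S, j + 1 ≠ w u) → ∀ u ∈ S, (ω j : ℕ) ≠ w u)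

section Labelling

variable {S : Finset (List ℕ)} {k : List ℕ → ℕ} {w : List ℕ → ℕ} {v N : ℕ}

lemma childLabel_mono (hS : IsPlaneTree S k) (hw : IsLabelling S w v N) {u : List ℕ} (hu : u ∈ S)
    {i j : ℕ} (hij : i < j) (hj : j ≤ k u) : childLabel w u i < childLabel w u j := by
  induction j, hij using Nat.le_induction with
  | base => exact hw.lt_cons i u ((hS.cons_mem_iff i u).2 ⟨hu, hj⟩)
  | succ j hij ih => exact (ih (by omega)).trans (hw.lt_cons j u ((hS.cons_mem_iff j u).2 ⟨hu, hj⟩))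

lemma label_lt_cons (hS : IsPlaneTree S k) (hw : IsLabelling S w v N) {i : ℕ} {u : List ℕ}
    (h : i :: u ∈ S) : w u < w (i :: u) := by
  obtain ⟨hu, hi⟩ := (hS.cons_mem_iff i u).1 h
  exact childLabel_mono hS hw hu (i := 0) (j := i + 1) (by omega) hi

lemma le_label (hS : IsPlaneTree S k) (hw : IsLabelling S w v N) {u : List ℕ} (hu : u ∈ S) :
    v ≤ w u := by
  induction u with
  | nil => exact hw.nil.ge
  | cons i u ih => exact (ih ((hS.cons_mem_iff i u).1 hu).1).trans (label_lt_cons hS hw hu).le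

lemma lt_label_cons (hS : IsPlaneTree S k) (hw : IsLabelling S w v N) {i : ℕ} {u : List ℕ}
    (h : i :: u ∈ S) : v < w (i :: u) :=
  (le_label hS hw ((hS.cons_mem_iff i u).1 h).1).trans_lt (label_lt_cons hS hw h)

/-- The children of a labelled vertex in a consistent history are the labelled ones. -/
lemma parent_eq_iff (hS : IsPlaneTree S k) (hw : IsLabelling S w v N) {l : ℕ} {ω : ParentSeq}
    (h : Consistent S w v l ω) {u : List ℕ} (hu : u ∈ S) {j : ℕ} (hj : j + 1 < l) :
    (ω j : ℕ) = w u ↔ ∃ i < k u, j + 1 = w (i :: u) := by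
  constructor
  · intro hω
    have hv : v < j + 1 := (le_label hS hw hu).trans_lt (hω ▸ (ω j).2)
    obtain ⟨h1, h2⟩ := h j hv hj
    by_cases hex : ∀ u ∈ S, j + 1 ≠ w u
    · exact absurd hω (h2 hex u hu)
    · push Not at hex
      obtain ⟨u', hu', he⟩ := hex
      cases u' with
      | nil => rw [hw.nil] at he; omega
      | cons i u'' =>
        have h3 := h1 i u'' hu' he
        obtain ⟨hu'', hi⟩ := (hS.cons_mem_iff i u'').1 hu'
        have : u'' = u := hw.inj hu'' hu (h3.symm.trans hω)
        subst this
        exact ⟨i, hi, he⟩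
  · rintro ⟨i, hi, he⟩
    have hiu := (hS.cons_mem_iff i u).2 ⟨hu, hi⟩
    exact (h j (he ▸ lt_label_cons hS hw hiu) hj).1 i u hiu he

/-- Children that have not arrived have rate zero, so the sum may run over all prescribed children.
The attachment probability then depends on the labelling alone and no longer on the history. -/
lemma sum_children_attachRate (μ : Measure I) (α : ℝ≥0) (hS : IsPlaneTree S k)
    (hw : IsLabelling S w v N) {n : ℕ} {ω : ParentSeq} (h : Consistent S w v (n + 2) ω)
    {u : List ℕ} (hu : u ∈ S) :
    ∑ i ∈ (Finset.range (n + 1)).filter fun i => (ω i : ℕ) = w u, attachRate μ α (n + 2) (i + 1) =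
      ∑ i ∈ Finset.range (k u), attachRate μ α (n + 2) (w (i :: u)) := by
  rw [← Finset.sum_filter_of_ne (s := Finset.range (k u)) (p := fun i => w (i :: u) < n + 2)]
  swap
  · intro i _ hne
    by_contra hcon
    exact hne (attachRate_eq_zero μ α (not_lt.1 hcon))
  symm
  refine Finset.sum_bij (fun i _ => w (i :: u) - 1) ?_ ?_ ?_ ?_
  · intro i hi
    simp only [Finset.mem_filter, Finset.mem_range] at hi ⊢
    have hiu := (hS.cons_mem_iff i u).2 ⟨hu, hi.1⟩
    have := lt_label_cons hS hw hiu
    refine ⟨by omega, (parent_eq_iff hS hw h hu (by omega)).2 ⟨i, hi.1, by omega⟩⟩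
  · intro i hi i' hi' heq
    simp only [Finset.mem_filter, Finset.mem_range] at hi hi'
    have hiu := (hS.cons_mem_iff i u).2 ⟨hu, hi.1⟩
    have hiu' := (hS.cons_mem_iff i' u).2 ⟨hu, hi'.1⟩
    have h1 := lt_label_cons hS hw hiu
    have h2 := lt_label_cons hS hw hiu'
    have := hw.inj hiu hiu' (by omega)
    simpa using this
  · intro j hj
    simp only [Finset.mem_filter, Finset.mem_range] at hj
    obtain ⟨i, hi, he⟩ := (parent_eq_iff hS hw h hu (by omega)).1 hj.2
    exact ⟨i, by simp only [Finset.mem_filter, Finset.mem_range]; omega, by omega⟩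
  · intro i hi
    simp only [Finset.mem_filter, Finset.mem_range] at hi
    have := lt_label_cons hS hw ((hS.cons_mem_iff i u).2 ⟨hu, hi.1⟩)
    rw [Nat.sub_add_cancel (by omega)]

/-- The probability that the vertex `l` attaches to the vertex labelled by the word `u`. -/
noncomputable def wordRate (μ : Measure I) (α : ℝ≥0) (k : List ℕ → ℕ) (w : List ℕ → ℕ)
    (u : List ℕ) (l : ℕ) : ℝ := childRate μ α (childLabel w u) (k u) l

lemma stepKernel_word (μ : Measure I) [IsProbabilityMeasure μ] (α : ℝ≥0) (hS : IsPlaneTree S k)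
    (hw : IsLabelling S w v N) {n : ℕ} {x : (i : Finset.Iic n) → Fin (i + 1)}
    (h : Consistent S w v (n + 2) (extend n x)) {u : List ℕ} (hu : u ∈ S) (hun : w u < n + 2) :
    stepKernel μ α n x {b | (b : ℕ) = w u} = ENNReal.ofReal (wordRate μ α k w u (n + 2)) := by
  rw [stepKernel_apply μ α (hw.pos.trans (le_label hS hw hu)) hun,
    sum_children_attachRate μ α hS hw h hu]
  rfl

lemma wordRate_nonneg (μ : Measure I) (α : ℝ≥0) (hS : IsPlaneTree S k) (hw : IsLabelling S w v N)
    {u : List ℕ} (hu : u ∈ S) (l : ℕ) : 0 ≤ wordRate μ α k w u l := by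
  refine childRate_nonneg μ α (fun j hj => hw.pos.trans ?_) l
  cases j with
  | zero => exact le_label hS hw hu
  | succ j => exact le_label hS hw ((hS.cons_mem_iff j u).2 ⟨hu, hj⟩)

lemma wordRate_eq_zero (μ : Measure I) (α : ℝ≥0) (hS : IsPlaneTree S k) (hw : IsLabelling S w v N)
    {u : List ℕ} (hu : u ∈ S) {l : ℕ} (hl : l ≤ w u) : wordRate μ α k w u l = 0 := by
  rw [wordRate, childRate, childLabel, attachRate_eq_zero μ α hl, Finset.sum_eq_zero]
  · simp
  · intro i hi
    refine attachRate_eq_zero μ α (hl.trans ?_)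
    exact (label_lt_cons hS hw ((hS.cons_mem_iff i u).2 ⟨hu, Finset.mem_range.1 hi⟩)).le

lemma k_le_card (hS : IsPlaneTree S k) {u : List ℕ} (hu : u ∈ S) : k u ≤ S.card := by
  rw [← Finset.card_range (k u)]
  refine Finset.card_le_card_of_injOn (fun i => i :: u) ?_ ?_
  · intro i hi
    exact (hS.cons_mem_iff i u).2 ⟨hu, by simpa using hi⟩
  · intro i _ j _ h
    simpa using h

/-- All labels are at least v, so each of the at most 1 + α + |S| units has rate at most 1/v. -/
lemma wordRate_le (μ : Measure I) [IsProbabilityMeasure μ] (α : ℝ≥0) (hS : IsPlaneTree S k)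
    (hw : IsLabelling S w v N) {u : List ℕ} (hu : u ∈ S) (l : ℕ) :
    wordRate μ α k w u l ≤ (1 + α + S.card) / v := by
  have hv : (0 : ℝ) < v := by exact_mod_cast hw.pos
  have h1 : ∀ b, v ≤ b → attachRate μ α l b ≤ (v : ℝ)⁻¹ := fun b hb =>
    (attachRate_le μ α (hw.pos.trans hb)).trans (inv_anti₀ hv (by exact_mod_cast hb))
  have h2 : ∑ i ∈ Finset.range (k u), attachRate μ α l (w (i :: u)) ≤ S.card * (v : ℝ)⁻¹ := by
    calc _ ≤ ∑ i ∈ Finset.range (k u), (v : ℝ)⁻¹ := Finset.sum_le_sum fun i hi =>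
          h1 _ (le_label hS hw ((hS.cons_mem_iff i u).2 ⟨hu, Finset.mem_range.1 hi⟩))
      _ = (k u : ℝ) * (v : ℝ)⁻¹ := by simp
      _ ≤ _ := by
          have : (k u : ℝ) ≤ S.card := by exact_mod_cast k_le_card hS hu
          gcongr
  have h3 : (1 + α : ℝ) * attachRate μ α l (w u) ≤ (1 + α) * (v : ℝ)⁻¹ :=
    mul_le_mul_of_nonneg_left (h1 _ (le_label hS hw hu)) (by positivity)
  calc wordRate μ α k w u l ≤ (1 + α) * (v : ℝ)⁻¹ + S.card * (v : ℝ)⁻¹ := add_le_add h3 h2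
    _ = _ := by ring

/-- The factor of the word `u` and the vertex `l` in the probability that the independent
exponential clocks produce the labelling `w`. -/
noncomputable def clockFactor (μ : Measure I) (α : ℝ≥0) (k : List ℕ → ℕ) (w : List ℕ → ℕ)
    (u : List ℕ) (l : ℕ) : ℝ :=
  open Classical in
  if ∃ i < k u, l = w (i :: u) then wordRate μ α k w u l else Real.exp (-wordRate μ α k w u l)

lemma clockFactor_nonneg (μ : Measure I) (α : ℝ≥0) (hS : IsPlaneTree S k)
    (hw : IsLabelling S w v N) {u : List ℕ} (hu : u ∈ S) (l : ℕ) :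
    0 ≤ clockFactor μ α k w u l := by
  unfold clockFactor
  split_ifs
  · exact wordRate_nonneg μ α hS hw hu l
  · exact (Real.exp_pos _).le

/-- Factor 1 - p² = (1-p)(1+p) and use 1 + p ≤ e^p. This is the whole loss in replacing a step
without attachment by independent clocks. -/
lemma one_sub_sq_mul_exp_neg_le {p : ℝ} (h1 : p ≤ 1) :
    (1 - p ^ 2) * Real.exp (-p) ≤ 1 - p := by
  rw [Real.exp_neg, ← div_eq_mul_inv, div_le_iff₀ (Real.exp_pos p)]
  nlinarith [Real.add_one_le_exp p]

/-- The next vertex respects the labelling with a probability that is almost the product of the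
factors of the independent clocks. -/
lemma clockFactor_le_stepKernel (μ : Measure I) [IsProbabilityMeasure μ] (α : ℝ≥0)
    (hS : IsPlaneTree S k) (hw : IsLabelling S w v N) {n : ℕ}
    {x : (i : Finset.Iic n) → Fin (i + 1)} (h : Consistent S w v (n + 2) (extend n x))
    (hP : ∑ u ∈ S, wordRate μ α k w u (n + 2) ≤ 1) :
    ENNReal.ofReal ((1 - (∑ u ∈ S, wordRate μ α k w u (n + 2)) ^ 2) *
      ∏ u ∈ S, clockFactor μ α k w u (n + 2)) ≤
    stepKernel μ α n x {b | (∀ i u, i :: u ∈ S → n + 2 = w (i :: u) → (b : ℕ) = w u) ∧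
      ((∀ u ∈ S, n + 2 ≠ w u) → ∀ u ∈ S, (b : ℕ) ≠ w u)} := by
  have hnn : ∀ u ∈ S, 0 ≤ wordRate μ α k w u (n + 2) := fun u hu => wordRate_nonneg μ α hS hw hu _
  have hP0 : 0 ≤ ∑ u ∈ S, wordRate μ α k w u (n + 2) := Finset.sum_nonneg hnn
  have hcf := fun u hu => clockFactor_nonneg μ α hS hw (u := u) hu (n + 2)
  -- If the new vertex n + 2 is a prescribed child, injectivity of the labels leaves one possible
  -- parent, and the factors of the other words are at most 1.
  by_cases hex : ∃ i u, i :: u ∈ S ∧ n + 2 = w (i :: u)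
  · obtain ⟨i, u, hiu, he⟩ := hex
    obtain ⟨hu, hi⟩ := (hS.cons_mem_iff i u).1 hiu
    have huniq : ∀ i' u', i' :: u' ∈ S → n + 2 = w (i' :: u') → u' = u := by
      intro i' u' h1 h2
      have := hw.inj h1 hiu (by rw [← h2, he])
      exact (List.cons.inj this).2
    have hset : {b : Fin (n + 2) | (b : ℕ) = w u} ⊆
        {b | (∀ i u, i :: u ∈ S → n + 2 = w (i :: u) → (b : ℕ) = w u) ∧
      ((∀ u ∈ S, n + 2 ≠ w u) → ∀ u ∈ S, (b : ℕ) ≠ w u)} := by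
      intro b hb
      refine ⟨fun i' u' h1 h2 => ?_, fun hall => absurd he (hall _ hiu)⟩
      rw [huniq i' u' h1 h2]
      exact hb
    refine le_trans ?_ (measure_mono hset)
    rw [stepKernel_word μ α hS hw h hu (he ▸ label_lt_cons hS hw hiu)]
    refine ENNReal.ofReal_le_ofReal ?_
    rw [← Finset.mul_prod_erase S _ hu]
    have h1 : clockFactor μ α k w u (n + 2) = wordRate μ α k w u (n + 2) :=
      if_pos ⟨i, hi, he⟩
    have h2 : ∏ u' ∈ S.erase u, clockFactor μ α k w u' (n + 2) ≤ 1 := by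
      refine Finset.prod_le_one (fun u' hu' => hcf u' (Finset.mem_of_mem_erase hu'))
        fun u' hu' => ?_
      have hu'S := Finset.mem_of_mem_erase hu'
      rw [clockFactor, if_neg]
      · exact Real.exp_le_one_iff.2 (neg_nonpos.2 (hnn u' hu'S))
      · rintro ⟨i', hi', he'⟩
        exact (Finset.ne_of_mem_erase hu')
          (huniq i' u' ((hS.cons_mem_iff i' u').2 ⟨hu'S, hi'⟩) he')
    have h3 : 0 ≤ ∏ u' ∈ S.erase u, clockFactor μ α k w u' (n + 2) :=
      Finset.prod_nonneg fun u' hu' => hcf u' (Finset.mem_of_mem_erase hu')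
    rw [h1]
    calc _ ≤ 1 * (wordRate μ α k w u (n + 2) * 1) := by
          refine mul_le_mul (by nlinarith) (mul_le_mul_of_nonneg_left h2 (hnn u hu))
            (mul_nonneg (hnn u hu) h3) zero_le_one
      _ = _ := by ring
  · push Not at hex
    -- Otherwise the new vertex must avoid all labelled vertices, and a union bound over the words
    -- controls the opposite event.
    have hset : {b : Fin (n + 2) | ∃ u ∈ S, (b : ℕ) = w u}ᶜ ⊆
        {b | (∀ i u, i :: u ∈ S → n + 2 = w (i :: u) → (b : ℕ) = w u) ∧
      ((∀ u ∈ S, n + 2 ≠ w u) → ∀ u ∈ S, (b : ℕ) ≠ w u)} := by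
      intro b hb
      refine ⟨fun i' u' h1 h2 => absurd h2 (hex i' u' h1), fun _ u hu hbu => hb ⟨u, hu, hbu⟩⟩
    refine le_trans ?_ (measure_mono hset)
    have hle : stepKernel μ α n x {b : Fin (n + 2) | ∃ u ∈ S, (b : ℕ) = w u} ≤
        ENNReal.ofReal (∑ u ∈ S, wordRate μ α k w u (n + 2)) := by
      have : {b : Fin (n + 2) | ∃ u ∈ S, (b : ℕ) = w u} =
          ⋃ u ∈ S, {b : Fin (n + 2) | (b : ℕ) = w u} := by
        ext; simp
      rw [this, ENNReal.ofReal_sum_of_nonneg hnn]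
      refine (measure_biUnion_finset_le _ _).trans (Finset.sum_le_sum fun u hu => ?_)
      by_cases hun : w u < n + 2
      · exact (stepKernel_word μ α hS hw h hu hun).le
      · have : {b : Fin (n + 2) | (b : ℕ) = w u} = ∅ := by
          ext b
          have := b.2
          simp only [Set.mem_ofPred_eq, Set.mem_empty_iff_false, iff_false]
          omega
        rw [this, measure_empty]
        exact zero_le
    rw [prob_compl_eq_one_sub (Set.to_countable _).measurableSet]
    refine le_trans ?_ (tsub_le_tsub_left hle 1)
    rw [← ENNReal.ofReal_one, ← ENNReal.ofReal_sub _ hP0]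
    refine ENNReal.ofReal_le_ofReal ?_
    have h1 : ∏ u ∈ S, clockFactor μ α k w u (n + 2) =
        Real.exp (-∑ u ∈ S, wordRate μ α k w u (n + 2)) := by
      rw [← Finset.sum_neg_distrib, Real.exp_sum]
      refine Finset.prod_congr rfl fun u hu => ?_
      rw [clockFactor, if_neg]
      rintro ⟨i, hi, he⟩
      exact hex i u ((hS.cons_mem_iff i u).2 ⟨hu, hi⟩) he
    rw [h1]
    exact one_sub_sq_mul_exp_neg_le hP

lemma extend_frestrictLe (n : ℕ) (ω : ParentSeq) {j : ℕ} (hj : j ≤ n) :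
    extend n (Preorder.frestrictLe (π := fun i => Fin (i + 1)) n ω) j = ω j := by
  rw [extend, dif_pos (Finset.mem_Iic.2 hj)]
  rfl

lemma consistent_congr {l : ℕ} {ω ω' : ParentSeq} (h : ∀ j, j + 1 < l → ω j = ω' j) :
    Consistent S w v l ω ↔ Consistent S w v l ω' := by
  unfold Consistent
  refine forall_congr' fun j => ?_
  refine imp_congr_right fun _ => forall_congr' fun hj => ?_
  rw [h j hj]

lemma consistent_succ_iff {n : ℕ} (hv : v < n + 2) {ω : ParentSeq} :
    Consistent S w v (n + 3) ω ↔ Consistent S w v (n + 2) ω ∧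
      (∀ i u, i :: u ∈ S → n + 2 = w (i :: u) → (ω (n + 1) : ℕ) = w u) ∧
        ((∀ u ∈ S, n + 2 ≠ w u) → ∀ u ∈ S, (ω (n + 1) : ℕ) ≠ w u) := by
  constructor
  · exact fun h => ⟨fun j hj hj' => h j hj (by omega), h (n + 1) hv (by omega)⟩
  · rintro ⟨h1, h2⟩ j hj hj'
    rcases Nat.lt_or_ge (j + 1) (n + 2) with h | h
    · exact h1 j hj h
    · obtain rfl : j = n + 1 := by omega
      exact h2

/-- A lower bound for the probability that the network respects a labelling. -/
lemma prod_clockFactor_le_networkLaw (μ : Measure I) [IsProbabilityMeasure μ] (α : ℝ≥0)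
    (hS : IsPlaneTree S k) (hw : IsLabelling S w v N)
    (hP : ∀ l, ∑ u ∈ S, wordRate μ α k w u l ≤ 1) {l : ℕ} (hl : v + 1 ≤ l) :
    ∏ j ∈ Finset.Ioo v l, ENNReal.ofReal ((1 - (∑ u ∈ S, wordRate μ α k w u j) ^ 2) *
      ∏ u ∈ S, clockFactor μ α k w u j) ≤ networkLaw μ α {ω | Consistent S w v l ω} := by
  induction l, hl using Nat.le_induction with
  | base =>
    have : {ω | Consistent S w v (v + 1) ω} = Set.univ := by
      ext ω
      simp only [Set.mem_ofPred_eq, Set.mem_univ, iff_true]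
      intro j h1 h2
      omega
    rw [this, measure_univ, Finset.prod_eq_one]
    intro j hj
    rw [Finset.mem_Ioo] at hj
    omega
  | succ l hl ih =>
    have hv := hw.pos
    obtain ⟨n, rfl⟩ : ∃ n, l = n + 2 := ⟨l - 2, by omega⟩
    have hIoo : Finset.Ioo v (n + 2 + 1) = insert (n + 2) (Finset.Ioo v (n + 2)) := by
      ext j
      simp only [Finset.mem_Ioo, Finset.mem_insert]
      omega
    rw [hIoo, Finset.prod_insert (by simp)]
    refine (mul_le_mul_right ih _).trans ?_
    have key := mul_networkLaw_le μ α n {x | Consistent S w v (n + 2) (extend n x)} _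
      fun x hx => clockFactor_le_stepKernel μ α hS hw hx (hP _)
    have hext : ∀ ω : ParentSeq, Consistent S w v (n + 2) (extend n (Preorder.frestrictLe n ω)) ↔
        Consistent S w v (n + 2) ω := fun ω =>
      consistent_congr fun j hj => extend_frestrictLe n ω (by omega)
    simp only [Set.mem_ofPred_eq, hext] at key
    simpa only [consistent_succ_iff (show v < n + 2 by omega)] using key

end Labelling

end ParentSeq

/-! ### Clock probabilities of a labelling compared with network probabilities. -/

namespace ParentSeq

open BPMac

/-- The values of the clock `i` of the word `u` for which the labels of the children are those
prescribed by `w`. -/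
noncomputable def clockInterval (μ : Measure I) (α : ℝ≥0) (k : List ℕ → ℕ) (w : List ℕ → ℕ)
    (N : ℕ) (u : List ℕ) (i : ℕ) : Set ℝ :=
  if i < k u then
    Set.Ioc (∑ l ∈ Finset.Ioc (childLabel w u i) (w (i :: u) - 1), childRate μ α (childLabel w u) i l)
      (∑ l ∈ Finset.Ioc (childLabel w u i) (w (i :: u)), childRate μ α (childLabel w u) i l)
  else Set.Ioi (∑ l ∈ Finset.Ioc (childLabel w u i) (N - 1), childRate μ α (childLabel w u) i l)

/-- The clocks that produce the labelling `w` of the plane tree `S`. -/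
noncomputable def clockBox (μ : Measure I) (α : ℝ≥0) (S : Finset (List ℕ)) (k : List ℕ → ℕ)
    (w : List ℕ → ℕ) (N : ℕ) : Set (List ℕ → ℕ → ℝ) :=
  Set.pi S fun u => Set.pi (Finset.range (k u + 1)) (clockInterval μ α k w N u)

lemma measurableSet_clockInterval (μ : Measure I) (α : ℝ≥0) (k : List ℕ → ℕ) (w : List ℕ → ℕ)
    (N : ℕ) (u : List ℕ) (i : ℕ) : MeasurableSet (clockInterval μ α k w N u i) := by
  unfold clockInterval
  split_ifs
  · exact measurableSet_Ioc
  · exact measurableSet_Ioi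

lemma measurableSet_clockBox (μ : Measure I) (α : ℝ≥0) (S : Finset (List ℕ)) (k : List ℕ → ℕ)
    (w : List ℕ → ℕ) (N : ℕ) : MeasurableSet (clockBox μ α S k w N) :=
  MeasurableSet.pi S.countable_toSet fun _ _ =>
    MeasurableSet.pi (Finset.countable_toSet _) fun _ _ => measurableSet_clockInterval μ α k w N _ _

lemma expFamilyLaw_clockBox (μ : Measure I) (α : ℝ≥0) (S : Finset (List ℕ)) (k : List ℕ → ℕ)
    (w : List ℕ → ℕ) (N : ℕ) : expFamilyLaw (clockBox μ α S k w N) =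
      ∏ u ∈ S, ∏ i ∈ Finset.range (k u + 1), expMeasure 1 (clockInterval μ α k w N u i) := by
  rw [clockBox, expFamilyLaw, Measure.infinitePi_pi]
  · refine Finset.prod_congr rfl fun u _ => ?_
    rw [Measure.infinitePi_pi]
    exact fun i _ => measurableSet_clockInterval μ α k w N u i
  · exact fun u _ => MeasurableSet.pi (Finset.countable_toSet _)
      fun _ _ => measurableSet_clockInterval μ α k w N _ _

section Labelling

variable {S : Finset (List ℕ)} {k : List ℕ → ℕ} {w : List ℕ → ℕ} {v N : ℕ}

/-- Up to and including the arrival of child m, the children from m on have zero rate, so the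
current rate and the full rate agree. -/
lemma childRate_eq_wordRate (μ : Measure I) (α : ℝ≥0) (hS : IsPlaneTree S k)
    (hw : IsLabelling S w v N) {u : List ℕ} (hu : u ∈ S) {m l : ℕ} (hm : m ≤ k u)
    (hl : m < k u → l ≤ w (m :: u)) :
    childRate μ α (childLabel w u) m l = wordRate μ α k w u l := by
  rw [wordRate, childRate, childRate]
  congr 1
  refine Finset.sum_subset (Finset.range_subset_range.2 hm) fun j hj hj' => ?_
  simp only [Finset.mem_range, not_lt] at hj hj'
  refine attachRate_eq_zero μ α ((hl (by omega)).trans ?_)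
  rcases hj'.eq_or_lt with rfl | h
  · exact le_rfl
  · exact (childLabel_mono hS hw hu (i := m + 1) (j := j + 1) (by omega) (by omega)).le

lemma clockFactor_eq_exp (μ : Measure I) (α : ℝ≥0) (hS : IsPlaneTree S k)
    (hw : IsLabelling S w v N) {u : List ℕ} (hu : u ∈ S) {m l : ℕ} (hm : m ≤ k u)
    (h1 : childLabel w u m < l) (h2 : m < k u → l < w (m :: u)) :
    clockFactor μ α k w u l = Real.exp (-childRate μ α (childLabel w u) m l) := by
  rw [childRate_eq_wordRate μ α hS hw hu hm fun h => (h2 h).le, clockFactor, if_neg]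
  rintro ⟨i, hi, rfl⟩
  rcases lt_or_ge i m with h | h
  · rcases (Nat.succ_le_of_lt h).eq_or_lt with h' | h'
    · subst h'; exact lt_irrefl _ h1
    · exact h1.not_gt (childLabel_mono hS hw hu (i := i + 1) h' hm)
  · have h3 := h2 (h.trans_lt hi)
    rcases h.eq_or_lt with rfl | h'
    · exact lt_irrefl _ h3
    · exact h3.not_gt (childLabel_mono hS hw hu (i := m + 1) (j := i + 1) (by omega) (by omega))

lemma prod_clockFactor_eq_exp (μ : Measure I) (α : ℝ≥0) (hS : IsPlaneTree S k)
    (hw : IsLabelling S w v N) {u : List ℕ} (hu : u ∈ S) {m b : ℕ} (hm : m ≤ k u)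
    (hb : m < k u → b < w (m :: u)) :
    ∏ l ∈ Finset.Ioc (childLabel w u m) b, clockFactor μ α k w u l =
      Real.exp (-∑ l ∈ Finset.Ioc (childLabel w u m) b, childRate μ α (childLabel w u) m l) := by
  rw [← Finset.sum_neg_distrib, Real.exp_sum]
  refine Finset.prod_congr rfl fun l hl => ?_
  rw [Finset.mem_Ioc] at hl
  exact clockFactor_eq_exp μ α hS hw hu hm hl.1 fun h => hl.2.trans_lt (hb h)

lemma childRate_childLabel_nonneg (μ : Measure I) (α : ℝ≥0) (hS : IsPlaneTree S k)
    (hw : IsLabelling S w v N) {u : List ℕ} (hu : u ∈ S) {m : ℕ} (hm : m ≤ k u) (l : ℕ) :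
    0 ≤ childRate μ α (childLabel w u) m l := by
  refine childRate_nonneg μ α (fun j hj => hw.pos.trans ?_) l
  cases j with
  | zero => exact le_label hS hw hu
  | succ j => exact le_label hS hw ((hS.cons_mem_iff j u).2 ⟨hu, by omega⟩)

/-- A clock prescribes the next label when it falls in (A, A+p], where A is the rate summed before
that label and p the rate at it. This has probability e^{-A}(1 - e^{-p}) ≤ e^{-A}p: survival factors
followed by one hit. -/
lemma prod_clockInterval_le (μ : Measure I) (α : ℝ≥0) (hS : IsPlaneTree S k)
    (hw : IsLabelling S w v N) {u : List ℕ} (hu : u ∈ S) {m : ℕ} (hm : m ≤ k u) :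
    ∏ i ∈ Finset.range m, (expMeasure 1).real (clockInterval μ α k w N u i) ≤
      ∏ l ∈ Finset.Ioc (w u) (childLabel w u m), clockFactor μ α k w u l := by
  induction m with
  | zero => simp [childLabel]
  | succ m ih =>
    have hlt : childLabel w u m < w (m :: u) :=
      childLabel_mono hS hw hu (i := m) (j := m + 1) (by omega) hm
    have hle : w u ≤ childLabel w u m := by
      rcases Nat.eq_zero_or_pos m with rfl | h
      · exact le_rfl
      · exact (childLabel_mono hS hw hu (i := 0) h (by omega)).le
    obtain ⟨b, hb⟩ : ∃ b, w (m :: u) = b + 1 := ⟨w (m :: u) - 1, by omega⟩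
    have hcb : childLabel w u m ≤ b := by omega
    have hp := childRate_childLabel_nonneg μ α hS hw hu (m := m) (by omega)
    have hlast : clockFactor μ α k w u (b + 1) = childRate μ α (childLabel w u) m (b + 1) := by
      rw [childRate_eq_wordRate μ α hS hw hu (by omega) fun _ => hb.ge]
      exact if_pos ⟨m, hm, hb.symm⟩
    have hstep : (expMeasure 1).real (clockInterval μ α k w N u m) ≤
        ∏ l ∈ Finset.Ioc (childLabel w u m) (b + 1), clockFactor μ α k w u l := by
      rw [Finset.prod_Ioc_succ_top hcb, prod_clockFactor_eq_exp μ α hS hw hu (by omega)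
        fun _ => by omega, hlast, clockInterval, if_pos (show m < k u from hm), hb, Nat.add_sub_cancel,
        expMeasure_real_Ioc (Finset.sum_nonneg fun l _ => hp l)
          (Finset.sum_le_sum_of_subset_of_nonneg (Finset.Ioc_subset_Ioc_right b.le_succ)
            fun l _ _ => hp l), Finset.sum_Ioc_succ_top hcb, neg_add, Real.exp_add, ← mul_one_sub]
      refine mul_le_mul_of_nonneg_left ?_ (Real.exp_pos _).le
      linarith [Real.add_one_le_exp (-childRate μ α (childLabel w u) m (b + 1))]
    rw [Finset.prod_range_succ]
    have hcl : childLabel w u (m + 1) = b + 1 := hb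
    rw [hcl, ← Finset.prod_Ioc_consecutive _ hle (by omega : childLabel w u m ≤ b + 1)]
    exact mul_le_mul (ih (by omega)) hstep measureReal_nonneg
      (Finset.prod_nonneg fun l _ => clockFactor_nonneg μ α hS hw hu l)

/-- The clock after the last prescribed child has to survive up to N - 1, and the factors before the
arrival of `u` are 1. -/
lemma prod_clockInterval_succ_le (μ : Measure I) (α : ℝ≥0) (hS : IsPlaneTree S k)
    (hw : IsLabelling S w v N) {u : List ℕ} (hu : u ∈ S) :
    ∏ i ∈ Finset.range (k u + 1), (expMeasure 1).real (clockInterval μ α k w N u i) ≤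
      ∏ l ∈ Finset.Ioo v N, clockFactor μ α k w u l := by
  have hlast : childLabel w u (k u) ≤ N - 1 := by
    rcases hk : k u with _ | m
    · exact Nat.le_pred_of_lt (hw.lt u hu)
    · exact Nat.le_pred_of_lt (hw.lt _ ((hS.cons_mem_iff m u).2 ⟨hu, by omega⟩))
  have hle : w u ≤ childLabel w u (k u) := by
    rcases Nat.eq_zero_or_pos (k u) with h | h
    · rw [h]; exact le_rfl
    · exact (childLabel_mono hS hw hu (i := 0) h le_rfl).le
  have hIoo : Finset.Ioo v N = Finset.Ioc v (N - 1) := by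
    ext l
    have := hw.lt u hu
    simp only [Finset.mem_Ioo, Finset.mem_Ioc]
    omega
  have hone : ∏ l ∈ Finset.Ioc v (w u), clockFactor μ α k w u l = 1 := by
    refine Finset.prod_eq_one fun l hl => ?_
    rw [Finset.mem_Ioc] at hl
    rw [clockFactor, if_neg, wordRate_eq_zero μ α hS hw hu hl.2, neg_zero, Real.exp_zero]
    rintro ⟨i, hi, rfl⟩
    exact hl.2.not_gt (label_lt_cons hS hw ((hS.cons_mem_iff i u).2 ⟨hu, hi⟩))
  rw [hIoo, ← Finset.prod_Ioc_consecutive _ (le_label hS hw hu) (hle.trans hlast), hone, one_mul,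
    ← Finset.prod_Ioc_consecutive _ hle hlast, Finset.prod_range_succ]
  refine mul_le_mul (prod_clockInterval_le μ α hS hw hu le_rfl) ?_ measureReal_nonneg
    (Finset.prod_nonneg fun l _ => clockFactor_nonneg μ α hS hw hu l)
  rw [prod_clockFactor_eq_exp μ α hS hw hu le_rfl fun h => absurd h (lt_irrefl _), clockInterval,
    if_neg (lt_irrefl _), expMeasure_real_Ioi]
  exact Finset.sum_nonneg fun l _ => childRate_childLabel_nonneg μ α hS hw hu le_rfl l

lemma expFamilyLaw_clockBox_le (μ : Measure I) (α : ℝ≥0) (hS : IsPlaneTree S k)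
    (hw : IsLabelling S w v N) : expFamilyLaw (clockBox μ α S k w N) ≤
      ENNReal.ofReal (∏ l ∈ Finset.Ioo v N, ∏ u ∈ S, clockFactor μ α k w u l) := by
  rw [expFamilyLaw_clockBox, Finset.prod_comm, ENNReal.ofReal_prod_of_nonneg
    fun u hu => Finset.prod_nonneg fun l _ => clockFactor_nonneg μ α hS hw hu l]
  refine Finset.prod_le_prod' fun u hu => ?_
  refine le_trans (le_of_eq ?_) (ENNReal.ofReal_le_ofReal (prod_clockInterval_succ_le μ α hS hw hu))
  rw [ENNReal.ofReal_prod_of_nonneg fun i _ => measureReal_nonneg]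
  exact Finset.prod_congr rfl fun i _ => (ofReal_measureReal (measure_ne_top _ _)).symm

/-- The relative error of the approximation by independent clocks. -/
noncomputable def clockError (α : ℝ≥0) (S : Finset (List ℕ)) (N v : ℕ) : ℝ :=
  N * (S.card * (1 + α + S.card) / v) ^ 2

lemma mul_clockBox_le_networkLaw (μ : Measure I) [IsProbabilityMeasure μ] (α : ℝ≥0)
    (hS : IsPlaneTree S k) (hw : IsLabelling S w v N) :
    ENNReal.ofReal (1 - clockError α S N v) * expFamilyLaw (clockBox μ α S k w N) ≤
      networkLaw μ α {ω | Consistent S w v N ω} := by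
  have hvN : v < N := hw.nil ▸ hw.lt [] hS.nil_mem
  have hv : (0 : ℝ) < v := by exact_mod_cast hw.pos
  set K : ℝ := S.card * (1 + α + S.card) / v with hK
  have hK0 : 0 ≤ K := by positivity
  have hPK : ∀ l, ∑ u ∈ S, wordRate μ α k w u l ≤ K := fun l => by
    calc _ ≤ ∑ u ∈ S, (1 + α + S.card : ℝ) / v :=
          Finset.sum_le_sum fun u hu => wordRate_le μ α hS hw hu l
      _ = K := by rw [Finset.sum_const, nsmul_eq_mul, hK, mul_div_assoc]
  have hP0 : ∀ l, 0 ≤ ∑ u ∈ S, wordRate μ α k w u l := fun l =>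
    Finset.sum_nonneg fun u hu => wordRate_nonneg μ α hS hw hu l
  have hN1 : (1 : ℝ) ≤ N := by exact_mod_cast (by omega : 1 ≤ N)
  rcases le_or_gt K 1 with hK1 | hK1
  swap
  -- If K > 1 the error is already at least 1 and the bound is void.
  · rw [ENNReal.ofReal_of_nonpos, zero_mul]
    · exact zero_le
    · rw [clockError, sub_nonpos]
      nlinarith
  refine le_trans ?_ (prod_clockFactor_le_networkLaw μ α hS hw (fun l => (hPK l).trans hK1) hvN)
  have h1 : ∀ l, 1 - K ^ 2 ≤ 1 - (∑ u ∈ S, wordRate μ α k w u l) ^ 2 := fun l => by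
    nlinarith [hPK l, hP0 l]
  have h2 : 0 ≤ 1 - K ^ 2 := by nlinarith
  have h3 : ∀ l, 0 ≤ ∏ u ∈ S, clockFactor μ α k w u l := fun l =>
    Finset.prod_nonneg fun u hu => clockFactor_nonneg μ α hS hw hu l
  rw [← ENNReal.ofReal_prod_of_nonneg fun l _ => mul_nonneg (h2.trans (h1 l)) (h3 l),
    Finset.prod_mul_distrib, ENNReal.ofReal_mul (Finset.prod_nonneg fun l _ => h2.trans (h1 l))]
  refine mul_le_mul' (ENNReal.ofReal_le_ofReal ?_) (expFamilyLaw_clockBox_le μ α hS hw)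
  -- Bernoulli's inequality over fewer than N steps, each with loss at most K².
  calc 1 - clockError α S N v ≤ 1 + ((Finset.Ioo v N).card : ℝ) * (-K ^ 2) := by
        have : ((Finset.Ioo v N).card : ℝ) ≤ N := by
          rw [Nat.card_Ioo]
          exact_mod_cast (by omega : N - v - 1 ≤ N)
        rw [clockError, ← hK]
        nlinarith [sq_nonneg K]
    _ ≤ (1 + -K ^ 2) ^ (Finset.Ioo v N).card := one_add_mul_le_pow (by nlinarith) _
    _ = ∏ l ∈ Finset.Ioo v N, (1 - K ^ 2) := by
        rw [Finset.prod_const, sub_eq_add_neg]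
    _ ≤ _ := Finset.prod_le_prod (fun _ _ => h2) fun l _ => h1 l

/-- A history is consistent with at most one labelled plane tree. -/
lemma consistent_unique {S' : Finset (List ℕ)} {k' : List ℕ → ℕ} {w' : List ℕ → ℕ}
    (hS : IsPlaneTree S k) (hw : IsLabelling S w v N) (hS' : IsPlaneTree S' k')
    (hw' : IsLabelling S' w' v N) {ω : ParentSeq} (h : Consistent S w v N ω)
    (h' : Consistent S' w' v N ω) {u : List ℕ} (hu : u ∈ S) : u ∈ S' ∧ w u = w' u := by
  induction u with
  | nil => exact ⟨hS'.nil_mem, hw.nil.trans hw'.nil.symm⟩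
  | cons i u ih =>
    obtain ⟨huS, hi⟩ := (hS.cons_mem_iff i u).1 hu
    obtain ⟨huS', hwu⟩ := ih huS
    clear ih
    induction i using Nat.strong_induction_on with | _ i ih =>
    have ih' : ∀ j < i, j :: u ∈ S ∧ w (j :: u) = w' (j :: u) := fun j hj => by
      have hj' := (hS.cons_mem_iff j u).2 ⟨huS, hj.trans hi⟩
      exact ⟨hj', (ih j hj hj' (hj.trans hi)).2⟩
    have hlt := hw.lt _ hu
    have hpos := lt_label_cons hS hw hu
    obtain ⟨l, hl⟩ : ∃ l, w (i :: u) = l + 1 := ⟨w (i :: u) - 1, by omega⟩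
    -- The history makes this vertex a child of the common label of `u`, so the second labelling
    -- also names it, say as child i'. The task is to show i' = i, given agreement on the older
    -- siblings.
    obtain ⟨i', hi', he'⟩ := (parent_eq_iff hS' hw' h' huS' (by omega)).1
      (hwu ▸ (parent_eq_iff hS hw h huS (by omega)).2 ⟨i, hi, hl.symm⟩)
    rcases lt_trichotomy i' i with hlt' | rfl | hgt
    · obtain ⟨hmem, heq⟩ := ih' i' hlt'
      have := hw.inj hmem hu (by rw [heq, ← he', hl])
      simp only [List.cons.injEq, and_true] at this
      omega
    · exact ⟨(hS'.cons_mem_iff i' u).2 ⟨huS', hi'⟩, by rw [hl, he']⟩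
    · exfalso
      -- If i' > i, the second labelling has an earlier vertex as child i. The first labelling must
      -- name it i'' < i, where the two already agree; this contradicts injectivity.
      have hiS' := (hS'.cons_mem_iff i u).2 ⟨huS', hgt.trans hi'⟩
      have hlt1 : w' (i :: u) < w' (i' :: u) :=
        childLabel_mono hS' hw' huS' (i := i + 1) (j := i' + 1) (by omega) (by omega)
      have hpos' := lt_label_cons hS' hw' hiS'
      obtain ⟨m, hm⟩ : ∃ m, w' (i :: u) = m + 1 := ⟨w' (i :: u) - 1, by omega⟩
      obtain ⟨i'', hi'', he''⟩ := (parent_eq_iff hS hw h huS (by omega)).1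
        (hwu ▸ (parent_eq_iff hS' hw' h' huS' (by omega)).2 ⟨i, hgt.trans hi', hm.symm⟩)
      have hlt2 : i'' < i := by
        by_contra hcon
        rcases (not_lt.1 hcon).eq_or_lt with rfl | h3
        · omega
        · have := childLabel_mono hS hw huS (i := i + 1) (j := i'' + 1) (by omega) (by omega)
          simp only [childLabel] at this
          omega
      obtain ⟨hmem, heq⟩ := ih' i'' hlt2
      have hmem' := (ih i'' hlt2 hmem hi'').1
      have := hw'.inj hmem' hiS' (by rw [← heq, ← he'', hm])
      simp only [List.cons.injEq, and_true] at this
      omega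

lemma measurableSet_consistent (S : Finset (List ℕ)) (w : List ℕ → ℕ) (v l : ℕ) :
    MeasurableSet {ω | Consistent S w v l ω} := by
  have : {ω | Consistent S w v l ω} =
      Preorder.frestrictLe (π := fun i => Fin (i + 1)) l ⁻¹'
        {x | Consistent S w v l (extend l x)} := by
    ext ω
    exact consistent_congr fun j hj => (extend_frestrictLe l ω (by omega)).symm
  rw [this]
  exact (Preorder.measurable_frestrictLe l) (Set.to_countable _).measurableSet

/-- Extends a labelling of the words of `S` by zero. -/
noncomputable def extendLabel (S : Finset (List ℕ)) (f : S → Fin N) (u : List ℕ) : ℕ :=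
  if h : u ∈ S then f ⟨u, h⟩ else 0

lemma extendLabel_of_mem (S : Finset (List ℕ)) (f : S → Fin N) {u : List ℕ} (h : u ∈ S) :
    extendLabel S f u = f ⟨u, h⟩ := dif_pos h

/-- The clocks that produce the plane tree `S` from the vertex `v`. -/
def clockEvent (μ : Measure I) (α : ℝ≥0) (S : Finset (List ℕ)) (k : List ℕ → ℕ) (N v : ℕ) :
    Set (List ℕ → ℕ → ℝ) :=
  ⋃ f : S → Fin N, {e | IsLabelling S (extendLabel S f) v N ∧
    e ∈ clockBox μ α S k (extendLabel S f) N}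

/-- The histories for which the fringe at `v` of the tree with `N` vertices is `S`. -/
def treeEvent (S : Finset (List ℕ)) (N v : ℕ) : Set ParentSeq :=
  ⋃ f : S → Fin N, {ω | IsLabelling S (extendLabel S f) v N ∧
    Consistent S (extendLabel S f) v N ω}

lemma measurableSet_clockEvent (μ : Measure I) (α : ℝ≥0) (S : Finset (List ℕ)) (k : List ℕ → ℕ)
    (N v : ℕ) : MeasurableSet (clockEvent μ α S k N v) :=
  MeasurableSet.iUnion fun _ => (MeasurableSet.const _).inter (measurableSet_clockBox μ α S k _ N)

lemma measurableSet_treeEvent (S : Finset (List ℕ)) (N v : ℕ) :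
    MeasurableSet (treeEvent S N v) :=
  MeasurableSet.iUnion fun _ => (MeasurableSet.const _).inter (measurableSet_consistent S _ v N)

/-- Only a lower bound for the network is wanted: subadditivity is enough on the clock side, and
disjointness of the labellings is needed only on the network side. -/
lemma mul_clockEvent_le (μ : Measure I) [IsProbabilityMeasure μ] (α : ℝ≥0)
    (hS : IsPlaneTree S k) (N v : ℕ) :
    ENNReal.ofReal (1 - clockError α S N v) * expFamilyLaw (clockEvent μ α S k N v) ≤
      networkLaw μ α (treeEvent S N v) := by
  have hd : Pairwise (Function.onFun Disjoint fun f : S → Fin N =>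
      {ω | IsLabelling S (extendLabel S f) v N ∧ Consistent S (extendLabel S f) v N ω}) := by
    intro f g hfg
    refine Set.disjoint_left.2 fun ω hf hg => hfg ?_
    ext ⟨u, hu⟩
    have := (consistent_unique hS hf.1 hS hg.1 hf.2 hg.2 hu).2
    rwa [extendLabel_of_mem S f hu, extendLabel_of_mem S g hu] at this
  rw [treeEvent, measure_iUnion hd fun f => (MeasurableSet.const _).inter
    (measurableSet_consistent S _ v N)]
  refine (mul_le_mul_right (measure_iUnion_le _) _).trans ?_
  rw [← ENNReal.tsum_mul_left]
  refine ENNReal.tsum_le_tsum fun f => ?_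
  by_cases hf : IsLabelling S (extendLabel S f) v N
  · simpa [hf] using mul_clockBox_le_networkLaw μ α hS hf
  · simp [hf]

end Labelling

end ParentSeq

/-! ### A finite population is a plane tree. -/

namespace BPMac

/-- Siblings are born in order, so the children present form an initial segment, whose length is
finite because S is. -/
lemma exists_isPlaneTree_of_population_eq {μ : Measure I} {α : ℝ≥0} {e : List ℕ → ℕ → ℝ} {t : ℝ}
    {S : Finset (List ℕ)} (h : population μ α e t = S) : ∃ k, ParentSeq.IsPlaneTree S k := by
  have hmem : ∀ u, u ∈ S ↔ birth μ α e u ≤ ENNReal.ofReal t := fun u => by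
    rw [← Finset.mem_coe, ← h]
    rfl
  have hex : ∀ u, ∃ i, i :: u ∉ S := fun u => by
    by_contra hcon
    push Not at hcon
    refine Set.infinite_range_of_injective (f := fun i : ℕ => i :: u)
      (fun i j hij => by simpa using hij) (S.finite_toSet.subset ?_)
    rintro _ ⟨i, rfl⟩
    exact hcon i
  classical
  refine ⟨fun u => Nat.find (hex u), (hmem _).2 zero_le, fun i u => ?_⟩
  have hsib : ∀ {i j : ℕ}, i ≤ j → j :: u ∈ S → i :: u ∈ S := fun {i j} hij hj => by
    rw [hmem] at hj ⊢
    refine le_trans ?_ hj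
    rw [birth, birth]
    exact add_le_add le_rfl (sigma_mono μ α (e u) (by omega))
  constructor
  · refine fun hi => ⟨?_, ?_⟩
    · rw [hmem] at hi ⊢
      exact le_trans le_self_add hi
    · by_contra hcon
      exact Nat.find_spec (hex u) (hsib (not_lt.1 hcon) hi)
  · exact fun hi => not_not.1 (Nat.find_min (hex u) hi.2)

end BPMac

/-! ### The fringe at a vertex of exponential age, and the lower bound by Fatou. -/

namespace ParentSeq

open BPMac

lemma birthLabel_cons (μ : Measure I) (α : ℝ≥0) (N v : ℕ) (e : List ℕ → ℕ → ℝ) (i : ℕ)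
    (u : List ℕ) : birthLabel μ α N v e (i :: u) =
      nextLabel N (childRate μ α (label μ α N (birthLabel μ α N v e u) (e u)) i) (e u i)
        (label μ α N (birthLabel μ α N v e u) (e u) i) := label_succ _ _ _ _ _ _

/-- The labels driven by `e` realize a plane tree once they have the right order. -/
lemma mem_clockEvent (μ : Measure I) (α : ℝ≥0) {S : Finset (List ℕ)} {k : List ℕ → ℕ}
    (hS : IsPlaneTree S k) {N v : ℕ} (hv : 1 ≤ v) {e : List ℕ → ℕ → ℝ} (he : ∀ u i, 0 < e u i)
    (hlt : ∀ u ∈ S, birthLabel μ α N v e u < N)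
    (hinj : Set.InjOn (birthLabel μ α N v e) S)
    (hge : ∀ u ∈ S, N ≤ birthLabel μ α N v e (k u :: u)) : e ∈ clockEvent μ α S k N v := by
  set f : S → Fin N := fun u => ⟨birthLabel μ α N v e u, hlt u u.2⟩ with hf
  have hw : ∀ u ∈ S, extendLabel S f u = birthLabel μ α N v e u := fun u hu => by
    rw [extendLabel_of_mem S f hu]
  have hchild : ∀ u ∈ S, ∀ i ≤ k u, childLabel (extendLabel S f) u i =
      label μ α N (birthLabel μ α N v e u) (e u) i := by
    intro u hu i hi
    cases i with
    | zero => exact hw u hu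
    | succ i => exact hw _ ((hS.cons_mem_iff i u).2 ⟨hu, hi⟩)
  refine Set.mem_iUnion.2 ⟨f, ⟨hv, ?_, ?_, ?_, ?_⟩, ?_⟩
  · exact hw [] hS.nil_mem
  · intro i u hi
    obtain ⟨hu, hik⟩ := (hS.cons_mem_iff i u).1 hi
    rw [hchild u hu i hik.le, hw _ hi]
    exact label_strictMono μ α _ _ _ i.lt_succ_self
  · intro u hu
    rw [hw u hu]
    exact hlt u hu
  · intro u hu u' hu' h
    rw [hw u hu, hw u' hu'] at h
    exact hinj hu hu' h
  · intro u hu i hi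
    have hu' : u ∈ S := hu
    have hik : i ≤ k u := by
      have : i < k u + 1 := by simpa using hi
      omega
    have hr : childRate μ α (childLabel (extendLabel S f) u) i =
        childRate μ α (label μ α N (birthLabel μ α N v e u) (e u)) i :=
      funext fun l => childRate_congr μ α (fun j hj => hchild u hu' j (hj.trans hik)) l
    have hspec := nextLabel_spec N (childRate μ α (label μ α N (birthLabel μ α N v e u) (e u)) i)
      (e u i) (label μ α N (birthLabel μ α N v e u) (e u) i)
    rw [clockInterval, hchild u hu' i hik, hr]
    split_ifs with h
    · have hi' := (hS.cons_mem_iff i u).2 ⟨hu', h⟩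
      have hlt' := hlt _ hi'
      rw [hw _ hi']
      rw [birthLabel_cons] at hlt' ⊢
      exact ⟨sum_lt_of_lt_nextLabel (N := N) (he u i) (by omega),
        hspec.2.resolve_left (not_le.2 hlt')⟩
    · obtain rfl : i = k u := by omega
      have h1 := hge u hu'
      rw [birthLabel_cons] at h1
      have h2 := hlt u hu'
      exact sum_lt_of_lt_nextLabel (N := N) (he u _) (by omega)

/-- Membership is decided by finitely many words: those of S and the first absent child of each. All
the comparisons between the limits are strict, so they pass to the labels for large n. -/
lemma eventually_mem_clockEvent {μ : Measure I} [IsProbabilityMeasure μ] {α : ℝ≥0}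
    {S : Finset (List ℕ)} {k : List ℕ → ℕ} (hS : IsPlaneTree S k) {e : List ℕ → ℕ → ℝ} {t : ℝ}
    (he : ∀ u i, 0 < e u i) (ht : 0 < t) (hne : ∀ u, birth μ α e u ≠ ENNReal.ofReal t)
    (hd : ∀ u u', u ≠ u' → birth μ α e u ≠ ⊤ → birth μ α e u ≠ birth μ α e u')
    (hpop : population μ α e t = S) {N v : ℕ → ℕ} (hv : Tendsto v atTop atTop)
    (hN : Tendsto (fun n => (N n : ℝ) / v n) atTop (𝓝 (Real.exp t))) :
    ∀ᶠ n in atTop, e ∈ clockEvent μ α S k (N n) (v n) := by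
  have hmem : ∀ u, u ∈ S ↔ birth μ α e u ≤ ENNReal.ofReal t := fun u => by
    rw [← Finset.mem_coe, ← hpop]
    rfl
  have hlim := birthLabel_limit (μ := μ) (α := α) he hv ht hN hne
  have hlt : ∀ u ∈ S, birth μ α e u < ENNReal.ofReal t := fun u hu =>
    lt_of_le_of_ne ((hmem u).1 hu) (hne u)
  have h1 : ∀ᶠ n in atTop, ∀ u ∈ S, birthLabel μ α (N n) (v n) e u < N n := by
    refine (Finset.eventually_all S).2 fun u hu => ?_
    have hlt' : Real.exp (birth μ α e u).toReal < Real.exp t := by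
      rw [Real.exp_lt_exp, ← ENNReal.lt_ofReal_iff_toReal_lt (ne_top_of_lt (hlt u hu))]
      exact hlt u hu
    filter_upwards [((hlim u).1 (hlt u hu)).eventually_lt hN hlt', hv.eventually_ge_atTop 1]
      with n hn hn1
    have : (0 : ℝ) < v n := by exact_mod_cast hn1
    exact_mod_cast (div_lt_div_iff_of_pos_right this).1 hn
  have h2 : ∀ᶠ n in atTop, ∀ u ∈ S, ∀ u' ∈ S, u ≠ u' →
      birthLabel μ α (N n) (v n) e u ≠ birthLabel μ α (N n) (v n) e u' := by
    refine (Finset.eventually_all S).2 fun u hu => (Finset.eventually_all S).2 fun u' hu' => ?_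
    by_cases huu : u = u'
    · exact Eventually.of_forall fun n h => absurd huu h
    have hne' : Real.exp (birth μ α e u).toReal ≠ Real.exp (birth μ α e u').toReal := by
      rw [Ne, Real.exp_eq_exp, ENNReal.toReal_eq_toReal_iff' (ne_top_of_lt (hlt u hu))
        (ne_top_of_lt (hlt u' hu'))]
      exact hd u u' huu (ne_top_of_lt (hlt u hu))
    filter_upwards [(((hlim u).1 (hlt u hu)).sub ((hlim u').1 (hlt u' hu'))).eventually_ne
      (sub_ne_zero.2 hne')] with n hn _ h
    exact hn (by rw [h, sub_self])
  have h3 : ∀ᶠ n in atTop, ∀ u ∈ S, N n ≤ birthLabel μ α (N n) (v n) e (k u :: u) := by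
    refine (Finset.eventually_all S).2 fun u hu => (hlim _).2 ?_
    have : k u :: u ∉ S := fun h => lt_irrefl _ ((hS.cons_mem_iff _ u).1 h).2
    rw [hmem, not_le] at this
    exact this
  filter_upwards [h1, h2, h3, hv.eventually_ge_atTop 1] with n h1 h2 h3 h4
  exact mem_clockEvent μ α hS h4 he h1
    (fun u hu u' hu' h => by_contra fun huu => h2 u hu u' hu' huu h) h3

/-- The vertex of age `t` on the logarithmic scale in the tree with `n + 1` vertices. -/
noncomputable def ageVertex (n : ℕ) (t : ℝ) : ℕ := ⌊((n + 1 : ℕ) : ℝ) * Real.exp (-t)⌋₊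

lemma measurable_ageVertex (n : ℕ) : Measurable (ageVertex n) :=
  Nat.measurable_floor.comp (by fun_prop)

lemma ageVertex_lt (n : ℕ) {t : ℝ} (ht : 0 < t) : ageVertex n t < n + 1 := by
  refine (Nat.floor_lt (by positivity)).2 ?_
  have : Real.exp (-t) < 1 := by rw [Real.exp_lt_one_iff]; linarith
  have h0 : (0 : ℝ) < ((n + 1 : ℕ) : ℝ) := by positivity
  nlinarith

lemma tendsto_succ_mul_exp (t : ℝ) :
    Tendsto (fun n : ℕ => ((n + 1 : ℕ) : ℝ) * Real.exp (-t)) atTop atTop :=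
  (tendsto_natCast_atTop_atTop.comp (tendsto_add_atTop_nat 1)).atTop_mul_const (Real.exp_pos _)

lemma tendsto_ageVertex (t : ℝ) : Tendsto (fun n => ageVertex n t) atTop atTop :=
  (tendsto_nat_floor_atTop (α := ℝ)).comp (tendsto_succ_mul_exp t)

lemma tendsto_div_ageVertex (t : ℝ) :
    Tendsto (fun n => ((n + 1 : ℕ) : ℝ) / ageVertex n t) atTop (𝓝 (Real.exp t)) := by
  have h1 := ((tendsto_nat_floor_div_atTop (R := ℝ)).comp (tendsto_succ_mul_exp t)).inv₀ one_ne_zero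
  have h2 := h1.mul_const (Real.exp t)
  rw [inv_one, one_mul] at h2
  refine h2.congr fun n => ?_
  simp only [Function.comp, ageVertex, inv_div, Real.exp_neg]
  field_simp

/-- e^{-T} is uniform on (0, 1), so each vertex v ≥ 1 corresponds to an interval of ages of mass
1/(n+1). This trades a uniform vertex for an exponential age. -/
lemma expMeasure_ageVertex_le {n v : ℕ} (hv : 1 ≤ v) (hvn : v < n + 1) :
    expMeasure 1 {t | ageVertex n t = v} ≤ ((n : ℝ≥0∞) + 1)⁻¹ := by
  set N : ℝ := ((n + 1 : ℕ) : ℝ) with hN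
  have hN0 : 0 < N := by positivity
  have hv0 : (0 : ℝ) < v := by exact_mod_cast hv
  have hvN : (v : ℝ) + 1 ≤ N := by rw [hN]; exact_mod_cast hvn
  have hsub : {t | ageVertex n t = v} ⊆ Set.Ioc (Real.log (N / (v + 1))) (Real.log (N / v)) := by
    intro t ht
    obtain ⟨h1, h2⟩ := (Nat.floor_eq_iff' (by omega)).1 (show ageVertex n t = v from ht)
    rw [← hN, Real.exp_neg, ← div_eq_mul_inv] at h1 h2
    have he := Real.exp_pos t
    constructor
    · rw [Real.log_lt_iff_lt_exp (by positivity), div_lt_iff₀ (by positivity)]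
      rw [div_lt_iff₀ he] at h2
      linarith
    · rw [Real.le_log_iff_exp_le (by positivity), le_div_iff₀ hv0]
      rw [le_div_iff₀ he] at h1
      linarith
  refine (measure_mono hsub).trans ?_
  rw [← ofReal_measureReal, expMeasure_real_Ioc, Real.exp_neg, Real.exp_neg,
    Real.exp_log (by positivity), Real.exp_log (by positivity)]
  · have : (N / (v + 1))⁻¹ - (N / v)⁻¹ = N⁻¹ := by
      rw [inv_div, inv_div]
      field_simp
      ring
    rw [this, ENNReal.ofReal_inv_of_pos hN0, hN, ENNReal.ofReal_natCast]
    push_cast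
    exact le_rfl
  · exact Real.log_nonneg (by rw [le_div_iff₀ (by positivity)]; linarith)
  · exact Real.log_le_log (by positivity) (by gcongr; linarith)

/-- The root of the network, which has no parent edge, is left out by the condition 1 ≤ v; dropping
one vertex is harmless for a lower bound. -/
lemma clockEvent_zero (μ : Measure I) (α : ℝ≥0) (S : Finset (List ℕ)) (k : List ℕ → ℕ) (N : ℕ) :
    clockEvent μ α S k N 0 = ∅ := by
  refine Set.eq_empty_of_forall_notMem fun e he => ?_
  obtain ⟨f, hf, -⟩ := Set.mem_iUnion.1 he
  exact absurd hf.pos (by omega)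

lemma tendsto_clockError (α : ℝ≥0) (S : Finset (List ℕ)) (t : ℝ) :
    Tendsto (fun n => clockError α S (n + 1) (ageVertex n t)) atTop (𝓝 0) := by
  have h1 : Tendsto (fun n => ((ageVertex n t : ℕ) : ℝ)⁻¹) atTop (𝓝 0) :=
    tendsto_inv_atTop_zero.comp (tendsto_natCast_atTop_atTop.comp (tendsto_ageVertex t))
  have h2 := ((tendsto_div_ageVertex t).mul h1).mul_const ((S.card * (1 + α + S.card) : ℝ) ^ 2)
  rw [mul_zero, zero_mul] at h2
  refine h2.congr fun n => ?_
  rw [clockError, div_pow, div_eq_mul_inv, div_eq_mul_inv, ← inv_pow]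
  ring

/-- The lower bound for the fringe at the vertex of exponential age. -/
noncomputable def clockDensity (μ : Measure I) (α : ℝ≥0) (S : Finset (List ℕ)) (k : List ℕ → ℕ)
    (n : ℕ) (p : (List ℕ → ℕ → ℝ) × ℝ) : ℝ≥0∞ :=
  ∑ v ∈ Finset.range (n + 1), ENNReal.ofReal (1 - clockError α S (n + 1) v) *
    (clockEvent μ α S k (n + 1) v ×ˢ {t | ageVertex n t = v}).indicator 1 p

lemma measurableSet_clockEvent_prod (μ : Measure I) (α : ℝ≥0) (S : Finset (List ℕ))
    (k : List ℕ → ℕ) (n v : ℕ) :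
    MeasurableSet (clockEvent μ α S k (n + 1) v ×ˢ {t | ageVertex n t = v}) :=
  (measurableSet_clockEvent μ α S k (n + 1) v).prod
    (measurable_ageVertex n (measurableSet_singleton v))

lemma measurable_clockDensity (μ : Measure I) (α : ℝ≥0) (S : Finset (List ℕ)) (k : List ℕ → ℕ)
    (n : ℕ) : Measurable (clockDensity μ α S k n) :=
  Finset.measurable_sum _ fun v _ =>
    (measurable_one.indicator (measurableSet_clockEvent_prod μ α S k n v)).const_mul _

lemma lintegral_clockDensity_le (μ : Measure I) [IsProbabilityMeasure μ] (α : ℝ≥0)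
    {S : Finset (List ℕ)} {k : List ℕ → ℕ} (hS : IsPlaneTree S k) (n : ℕ) :
    ∫⁻ p, clockDensity μ α S k n p ∂drivingLaw ≤
      ((n : ℝ≥0∞) + 1)⁻¹ * ∑ v ∈ Finset.range (n + 1), networkLaw μ α (treeEvent S (n + 1) v) := by
  unfold clockDensity
  rw [lintegral_finsetSum _ fun v _ =>
    (measurable_one.indicator (measurableSet_clockEvent_prod μ α S k n v)).const_mul _,
    Finset.mul_sum]
  refine Finset.sum_le_sum fun v hv => ?_
  rw [lintegral_const_mul _ (measurable_one.indicator (measurableSet_clockEvent_prod μ α S k n v)),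
    lintegral_indicator_one (measurableSet_clockEvent_prod μ α S k n v), drivingLaw_eq,
    Measure.prod_prod, ← mul_assoc, mul_comm]
  rcases Nat.eq_zero_or_pos v with rfl | hv0
  · simp [clockEvent_zero]
  · exact mul_le_mul' (expMeasure_ageVertex_le hv0 (Finset.mem_range.1 hv))
      (mul_clockEvent_le μ α hS (n + 1) v)

/-- The term v = `ageVertex n t` alone suffices: its clock event eventually holds and its relative
error tends to 0, because N/v tends to e^t and 1/v to 0. -/
lemma one_le_liminf_clockDensity {μ : Measure I} [IsProbabilityMeasure μ] {α : ℝ≥0}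
    {S : Finset (List ℕ)} {k : List ℕ → ℕ} (hS : IsPlaneTree S k) {e : List ℕ → ℕ → ℝ} {t : ℝ}
    (he : ∀ u i, 0 < e u i) (ht : 0 < t) (hne : ∀ u, birth μ α e u ≠ ENNReal.ofReal t)
    (hd : ∀ u u', u ≠ u' → birth μ α e u ≠ ⊤ → birth μ α e u ≠ birth μ α e u')
    (hpop : population μ α e t = S) :
    1 ≤ liminf (fun n => clockDensity μ α S k n (e, t)) atTop := by
  have h1 : Tendsto (fun n => ENNReal.ofReal (1 - clockError α S (n + 1) (ageVertex n t))) atTop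
      (𝓝 1) := by
    have := ENNReal.tendsto_ofReal ((tendsto_clockError α S t).const_sub 1)
    simpa using this
  rw [← h1.liminf_eq]
  refine liminf_le_liminf ?_
  filter_upwards [eventually_mem_clockEvent hS he ht hne hd hpop (N := fun n => n + 1)
    (tendsto_ageVertex t) (tendsto_div_ageVertex t)] with n hn
  refine le_trans (le_of_eq ?_) (Finset.single_le_sum (f := fun v =>
    ENNReal.ofReal (1 - clockError α S (n + 1) v) *
      (clockEvent μ α S k (n + 1) v ×ˢ {t | ageVertex n t = v}).indicator 1 (e, t))
    (fun _ _ => zero_le) (Finset.mem_range.2 (ageVertex_lt n ht)))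
  have hmem : (e, t) ∈ clockEvent μ α S k (n + 1) (ageVertex n t) ×ˢ
      {s | ageVertex n s = ageVertex n t} := ⟨hn, rfl⟩
  rw [Set.indicator_of_mem hmem, Pi.one_apply, mul_one]

/-- The histories with different plane trees at a vertex are disjoint. -/
lemma disjoint_treeEvent {S S' : Finset (List ℕ)} {k k' : List ℕ → ℕ} (hS : IsPlaneTree S k)
    (hS' : IsPlaneTree S' k') (h : S ≠ S') (N v : ℕ) :
    Disjoint (treeEvent S N v) (treeEvent S' N v) := by
  refine Set.disjoint_left.2 fun ω hω hω' => h ?_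
  obtain ⟨f, hf, hfc⟩ := Set.mem_iUnion.1 hω
  obtain ⟨g, hg, hgc⟩ := Set.mem_iUnion.1 hω'
  ext u
  exact ⟨fun hu => (consistent_unique hS hf hS' hg hfc hgc hu).1,
    fun hu => (consistent_unique hS' hg hS hf hgc hfc hu).1⟩

/-- The fringe of the network at a uniform vertex is asymptotically at least as likely to be in a
set of plane trees as the genealogical tree of the branching process. -/
theorem drivingLaw_le_liminf (μ : Measure I) [IsProbabilityMeasure μ] (α : ℝ≥0)
    (𝒮 : Set (Finset (List ℕ))) (Q : ℕ → ℕ → Set ParentSeq)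
    (hQ : ∀ S ∈ 𝒮, ∀ k, IsPlaneTree S k → ∀ n v, treeEvent S (n + 1) v ⊆ Q n v) :
    drivingLaw {p | ∃ S ∈ 𝒮, population μ α p.1 p.2 = S} ≤
      liminf (fun n : ℕ => ((n : ℝ≥0∞) + 1)⁻¹ *
        ∑ v ∈ Finset.range (n + 1), networkLaw μ α (Q n v)) atTop := by
  -- A countable index type. On each outcome the term of the realized plane tree bounds the whole
  -- sum from below.
  let Plane := {S : Finset (List ℕ) // S ∈ 𝒮 ∧ ∃ k, IsPlaneTree S k}
  choose k hk using fun S : Plane => S.2.2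
  have hae : ∀ᵐ p ∂drivingLaw, {p : (List ℕ → ℕ → ℝ) × ℝ | ∃ S ∈ 𝒮,
      population μ α p.1 p.2 = S}.indicator (1 : (List ℕ → ℕ → ℝ) × ℝ → ℝ≥0∞) p ≤
        liminf (fun n => ∑' S : Plane, clockDensity μ α S.1 (k S) n p) atTop := by
    have h1 : ∀ᵐ p ∂drivingLaw, ∀ u i, 0 < (p : (List ℕ → ℕ → ℝ) × ℝ).1 u i := by
      rw [drivingLaw_eq]
      exact Measure.quasiMeasurePreserving_fst.ae ae_pos_expFamilyLaw
    have h2 : ∀ᵐ p ∂drivingLaw, ∀ u v, u ≠ v →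
        birth μ α (p : (List ℕ → ℕ → ℝ) × ℝ).1 u ≠ ⊤ → birth μ α p.1 u ≠ birth μ α p.1 v := by
      rw [drivingLaw_eq]
      exact Measure.quasiMeasurePreserving_fst.ae ae_birth_ne
    filter_upwards [h1, h2, ae_birth_ne_time (μ := μ) (α := α)] with p h1 h2 h3
    refine Set.indicator_apply_le' (fun hp => ?_) fun _ => zero_le
    obtain ⟨S, hS, hpS⟩ := hp
    let S' : Plane := ⟨S, hS, exists_isPlaneTree_of_population_eq hpS⟩
    refine (one_le_liminf_clockDensity (hk S') h1 h3.1 h3.2 h2 hpS).trans ?_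
    exact liminf_le_liminf (Eventually.of_forall fun n =>
      ENNReal.le_tsum (f := fun S : Plane => clockDensity μ α S.1 (k S) n p) S')
  rw [← lintegral_indicator_one (measurableSet_population_mem 𝒮)]
  -- Fatou's lemma for the whole sum over plane trees, so no uniformity in S is required.
  refine (lintegral_mono_ae hae).trans ((lintegral_liminf_le fun n =>
    Measurable.tsum fun S : Plane => measurable_clockDensity μ α S.1 (k S) n).trans ?_)
  refine liminf_le_liminf (Eventually.of_forall fun n => ?_)
  rw [lintegral_tsum fun S : Plane => (measurable_clockDensity μ α S.1 (k S) n).aemeasurable]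
  refine (ENNReal.tsum_le_tsum fun S => lintegral_clockDensity_le μ α (hk S) n).trans ?_
  rw [ENNReal.tsum_mul_left, Summable.tsum_finsetSum fun _ _ => ENNReal.summable]
  refine mul_le_mul_right (Finset.sum_le_sum fun v _ => ?_) _
  -- Different plane trees give disjoint events, so their probabilities add up to at most that of `Q
  -- n v`.
  rw [← measure_iUnion (fun S S' h => disjoint_treeEvent (hk S) (hk S')
    (fun h' => h (Subtype.ext h')) (n + 1) v) fun S => measurableSet_treeEvent _ _ _]
  exact measure_mono (Set.iUnion_subset fun S => hQ S S.2.1 (k S) (hk S) n v)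

end ParentSeq

/-! ### Trees of words -/

open Classical in
/-- The tree of a finite set of words that is closed under taking parents (and the one point tree
for other sets). -/
noncomputable def wordTree (W : Set (List ℕ)) : FinRootedTree :=
  if h : W.Finite ∧ [] ∈ W ∧ ∀ u ∈ W, u.tail ∈ W then
    { V := W
      finite_V := h.1
      root := ⟨[], h.2.1⟩
      parent := fun u => ⟨u.1.tail, h.2.2 u.1 u.2⟩
      parent_root := rfl
      reaches_root := by
        rintro ⟨u, hu⟩
        induction u with
        | nil => exact ⟨0, rfl⟩
        | cons i u ih =>
          obtain ⟨k, hk⟩ := ih (h.2.2 _ hu)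
          exact ⟨k + 1, hk⟩ }
  else FinRootedTree.single

lemma BPMac.tree_eq_wordTree (μ : Measure I) (α : ℝ≥0) (e : List ℕ → ℕ → ℝ) (t : ℝ) :
    tree μ α e t = wordTree (population μ α e t) := by
  by_cases h : (population μ α e t).Finite
  · rw [tree, wordTree, dif_pos h, dif_pos ⟨h, zero_le (a := ENNReal.ofReal t),
      fun u hu => tail_mem_population hu⟩]
  · rw [tree, wordTree, dif_neg h, dif_neg fun h' => h h'.1]

namespace ParentSeq

/-- The vertex `v` of the tree with `n + 1` vertices. -/
def vertex (n : ℕ) (ω : ParentSeq) (v : ℕ) (hv : v < n + 1) : (ω.tree n).V :=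
  (⟨v, hv⟩ : Fin (n + 1))

/-- The label of a vertex of the tree with `n + 1` vertices. -/
def vertexLabel {n : ℕ} {ω : ParentSeq} (x : (ω.tree n).V) : ℕ := Fin.val (n := n + 1) x

lemma vertexLabel_injective {n : ℕ} {ω : ParentSeq} :
    Function.Injective (vertexLabel (n := n) (ω := ω)) := Fin.val_injective (n := n + 1)

lemma vertexLabel_lt {n : ℕ} {ω : ParentSeq} (x : (ω.tree n).V) : vertexLabel x < n + 1 :=
  Fin.isLt (n := n + 1) x

lemma vertexLabel_parent {n : ℕ} {ω : ParentSeq} {x : (ω.tree n).V} {j : ℕ}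
    (hx : vertexLabel x = j + 1) : vertexLabel ((ω.tree n).parent x) = ω j := by
  have hj : j + 1 < n + 1 := hx ▸ vertexLabel_lt x
  obtain rfl : x = vertex n ω (j + 1) hj := vertexLabel_injective hx
  rfl

lemma vertexLabel_parent_zero {n : ℕ} {ω : ParentSeq} {x : (ω.tree n).V}
    (hx : vertexLabel x = 0) : vertexLabel ((ω.tree n).parent x) = 0 := by
  obtain rfl : x = vertex n ω 0 n.succ_pos := vertexLabel_injective hx
  rfl

section Labelling

variable {S : Finset (List ℕ)} {k : List ℕ → ℕ} {w : List ℕ → ℕ} {v n : ℕ} {ω : ParentSeq}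

lemma tree_parent_label (hS : IsPlaneTree S k) (hw : IsLabelling S w v (n + 1))
    (hc : Consistent S w v (n + 1) ω) {i : ℕ} {u : List ℕ} (hi : i :: u ∈ S) {x : (ω.tree n).V}
    (hx : vertexLabel x = w (i :: u)) : vertexLabel ((ω.tree n).parent x) = w u := by
  obtain ⟨hu, hik⟩ := (hS.cons_mem_iff i u).1 hi
  have hpos := lt_label_cons hS hw hi
  obtain ⟨j, hj⟩ : ∃ j, vertexLabel x = j + 1 := ⟨vertexLabel x - 1, by omega⟩
  rw [vertexLabel_parent hj]
  exact (parent_eq_iff hS hw hc hu (hj ▸ vertexLabel_lt x)).2 ⟨i, hik, hj ▸ hx⟩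

/-- The fringe at a vertex is the tree of words of a labelling that the history respects. -/
lemma mk_wordTree_eq_mk_fringe (hS : IsPlaneTree S k) (hw : IsLabelling S w v (n + 1))
    (hc : Consistent S w v (n + 1) ω) (hv : v < n + 1) :
    TreeSpace.mk (wordTree S) = TreeSpace.mk ((ω.tree n).fringe (vertex n ω v hv)) := by
  have hW : (S : Set (List ℕ)).Finite ∧ [] ∈ (S : Set (List ℕ)) ∧
      ∀ u ∈ (S : Set (List ℕ)), u.tail ∈ (S : Set (List ℕ)) := by
    refine ⟨S.finite_toSet, hS.nil_mem, fun u hu => ?_⟩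
    cases u with
    | nil => exact hu
    | cons i u => exact ((hS.cons_mem_iff i u).1 hu).1
  let x : {u // u ∈ (S : Set (List ℕ))} → (ω.tree n).V := fun u => vertex n ω (w u) (hw.lt u u.2)
  have hx : ∀ u, vertexLabel (x u) = w u := fun u => rfl
  have hV : vertexLabel (vertex n ω v hv) = v := rfl
  have hdesc : ∀ u (hu : u ∈ S), ∃ m, (ω.tree n).parent^[m] (x ⟨u, hu⟩) = vertex n ω v hv := by
    intro u
    induction u with
    | nil => exact fun hu => ⟨0, vertexLabel_injective hw.nil⟩
    | cons i u ih =>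
      intro hu
      obtain ⟨m, hm⟩ := ih ((hS.cons_mem_iff i u).1 hu).1
      refine ⟨m + 1, ?_⟩
      rw [Function.iterate_succ_apply, ← hm]
      congr 1
      exact vertexLabel_injective (tree_parent_label hS hw hc hu (hx _))
  have hsurj : ∀ m (y : (ω.tree n).V), (ω.tree n).parent^[m] y = vertex n ω v hv →
      ∃ u ∈ S, w u = vertexLabel y := by
    intro m
    induction m with
    | zero =>
      intro y hy
      obtain rfl : y = vertex n ω v hv := hy
      exact ⟨[], hS.nil_mem, hw.nil⟩
    | succ m ih =>
      intro y hy
      rw [Function.iterate_succ_apply] at hy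
      obtain ⟨u, hu, hwu⟩ := ih _ hy
      cases hyl : vertexLabel y with
      | zero =>
        -- Vertex 0 is its own parent, while all labels are at least v ≥ 1, so it cannot descend
        -- from v.
        have h1 := hw.pos.trans (le_label hS hw hu)
        rw [hwu, vertexLabel_parent_zero hyl] at h1
        omega
      | succ j =>
        rw [vertexLabel_parent hyl] at hwu
        obtain ⟨i, hi, he⟩ := (parent_eq_iff hS hw hc hu (hyl ▸ vertexLabel_lt y)).1 hwu.symm
        exact ⟨i :: u, (hS.cons_mem_iff i u).2 ⟨hu, hi⟩, he.symm⟩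
  let f : {u // u ∈ (S : Set (List ℕ))} → ((ω.tree n).fringe (vertex n ω v hv)).V :=
    fun u => ⟨x u, hdesc u.1 u.2⟩
  have hf : Function.Bijective f := by
    constructor
    · rintro ⟨u, hu⟩ ⟨u', hu'⟩ h
      have h1 : w u = w u' := congrArg (fun z : ((ω.tree n).fringe (vertex n ω v hv)).V => vertexLabel z.1) h
      exact Subtype.ext (hw.inj hu hu' h1)
    · rintro ⟨y, m, hy⟩
      obtain ⟨u, hu, he⟩ := hsurj m y hy
      exact ⟨⟨u, hu⟩, Subtype.ext (vertexLabel_injective he)⟩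
  rw [wordTree, dif_pos hW]
  refine Quotient.sound ⟨Equiv.ofBijective f hf, Subtype.ext (vertexLabel_injective hw.nil), ?_⟩
  rintro ⟨u, hu⟩
  refine Subtype.ext (vertexLabel_injective ?_)
  cases u with
  | nil =>
    have h : (f ⟨[], hu⟩).1 = vertex n ω v hv := vertexLabel_injective hw.nil
    have h2 : ((ω.tree n).fringe (vertex n ω v hv)).parent (f ⟨[], hu⟩) = f ⟨[], hu⟩ := dif_pos h
    exact congrArg (fun z : ((ω.tree n).fringe (vertex n ω v hv)).V => vertexLabel z.1) h2.symm
  | cons i u =>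
    have h : (f ⟨i :: u, hu⟩).1 ≠ vertex n ω v hv := fun h =>
      (lt_label_cons hS hw hu).ne' (congrArg vertexLabel h)
    refine Eq.trans ?_ (congrArg (fun z : ((ω.tree n).fringe (vertex n ω v hv)).V => vertexLabel z.1) (dif_neg h).symm)
    exact (tree_parent_label hS hw hc hu (hx _)).symm

lemma degree_of_consistent (hS : IsPlaneTree S k) (hw : IsLabelling S w v (n + 1))
    (hc : Consistent S w v (n + 1) ω) : ω.degree v (n + 1) = k [] + 1 := by
  have hv : v < n + 1 := hw.nil ▸ hw.lt [] hS.nil_mem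
  have hv1 := hw.pos
  rw [degree_eq ω (by omega) hv, if_neg (by omega)]
  congr 1
  rw [← Finset.card_range (k [])]
  symm
  refine Finset.card_bij (fun i _ => w [i] - 1) ?_ ?_ ?_
  · intro i hi
    have hi' := (hS.cons_mem_iff i []).2 ⟨hS.nil_mem, Finset.mem_range.1 hi⟩
    have h1 := lt_label_cons hS hw hi'
    have h2 := hw.lt _ hi'
    rw [Finset.mem_filter, Finset.mem_range, ← hw.nil]
    exact ⟨by omega, (parent_eq_iff hS hw hc hS.nil_mem (by omega)).2
      ⟨i, Finset.mem_range.1 hi, by omega⟩⟩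
  · intro i hi j hj h
    have hi' := (hS.cons_mem_iff i []).2 ⟨hS.nil_mem, Finset.mem_range.1 hi⟩
    have hj' := (hS.cons_mem_iff j []).2 ⟨hS.nil_mem, Finset.mem_range.1 hj⟩
    have h1 := lt_label_cons hS hw hi'
    have h2 := lt_label_cons hS hw hj'
    simpa using hw.inj hi' hj' (by omega)
  · intro j hj
    rw [Finset.mem_filter, Finset.mem_range, ← hw.nil] at hj
    obtain ⟨i, hi, he⟩ := (parent_eq_iff hS hw hc hS.nil_mem (by omega)).1 hj.2
    exact ⟨i, Finset.mem_range.2 hi, by omega⟩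

end Labelling

lemma tree_congr {n : ℕ} {ω ω' : ParentSeq} (h : ∀ j < n, ω j = ω' j) : ω.tree n = ω'.tree n := by
  unfold tree
  congr 1
  funext x
  refine Fin.cases rfl (fun i => ?_) x
  exact Fin.ext (congrArg Fin.val (h i i.2) :)

/-- The tree depends on finitely many coordinates with finitely many values, so any function of it
is measurable. -/
lemma measurable_comp_tree {β : Type*} [MeasurableSpace β] (n : ℕ) (f : FinRootedTree → β) :
    Measurable fun ω : ParentSeq => f (ω.tree n) := by
  have : (fun ω : ParentSeq => f (ω.tree n)) = (fun x => f ((extend n x).tree n)) ∘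
      Preorder.frestrictLe (π := fun i => Fin (i + 1)) n := by
    funext ω
    exact congrArg f (tree_congr fun j hj => (extend_frestrictLe n ω hj.le).symm)
  rw [this]
  exact Measurable.of_discrete.comp (Preorder.measurable_frestrictLe n)

lemma measurable_degree (v n : ℕ) : Measurable fun ω : ParentSeq => ω.degree v n := by
  have : (fun ω : ParentSeq => ω.degree v n) = (fun x => (extend n x).degree v n) ∘
      Preorder.frestrictLe (π := fun i => Fin (i + 1)) n := by
    funext ω
    have h : ((Finset.range (n - 1)).filter fun i => (ω i : ℕ) = v) =
        (Finset.range (n - 1)).filter fun i => (extend n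
          (Preorder.frestrictLe (π := fun i => Fin (i + 1)) n ω) i : ℕ) = v := by
      refine Finset.filter_congr fun i hi => ?_
      rw [Finset.mem_range] at hi
      rw [extend_frestrictLe n ω (by omega)]
    simp only [Function.comp, degree, h]
  rw [this]
  exact Measurable.of_discrete.comp (Preorder.measurable_frestrictLe n)

/-- The fringe at the vertex `v` of the tree with `n + 1` vertices belongs to `G`. -/
def fringeEvent (G : Set TreeSpace) (n v : ℕ) : Set ParentSeq :=
  {ω | ∃ hv : v < n + 1, TreeSpace.mk ((ω.tree n).fringe (vertex n ω v hv)) ∈ G}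

lemma measurableSet_fringeEvent (G : Set TreeSpace) (n v : ℕ) :
    MeasurableSet (fringeEvent G n v) := by
  -- The cast expresses the event through the tree alone, although the type of its vertices depends
  -- on ω.
  have : fringeEvent G n v = {ω | ∃ (h : Fin (n + 1) = (ω.tree n).V) (hv : v < n + 1),
      TreeSpace.mk ((ω.tree n).fringe (cast h ⟨v, hv⟩)) ∈ G} := by
    ext ω
    exact ⟨fun h => ⟨rfl, h⟩, fun ⟨_, h⟩ => h⟩
  rw [this]
  exact (measurable_comp_tree n fun t => ∃ (h : Fin (n + 1) = t.V) (hv : v < n + 1),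
    TreeSpace.mk (t.fringe (cast h ⟨v, hv⟩)) ∈ G).setOf

lemma lintegral_empiricalFringe (μ : Measure I) [IsProbabilityMeasure μ] (α : ℝ≥0)
    {G : Set TreeSpace} (hG : MeasurableSet G) (n : ℕ) :
    ∫⁻ ω, (tree n ω).empiricalFringe G ∂networkLaw μ α = ((n : ℝ≥0∞) + 1)⁻¹ *
      ∑ v ∈ Finset.range (n + 1), networkLaw μ α (fringeEvent G n v) := by
  have h1 : ∀ ω : ParentSeq, (ω.tree n).empiricalFringe G = ((n : ℝ≥0∞) + 1)⁻¹ *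
      ∑ v ∈ Finset.range (n + 1), (fringeEvent G n v).indicator 1 ω := by
    intro ω
    have hcard : Nat.card (ω.tree n).V = n + 1 := Nat.card_fin _
    rw [FinRootedTree.empiricalFringe, hcard, Measure.smul_apply, Measure.sum_apply _ hG,
      smul_eq_mul, Nat.cast_add, Nat.cast_one]
    congr 1
    refine (tsum_fintype (L := .unconditional _) (fun v : Fin (n + 1) =>
      Measure.dirac (TreeSpace.mk ((ω.tree n).fringe v)) G)).trans ?_
    rw [Finset.sum_range]
    refine Finset.sum_congr rfl fun v _ => ?_
    rw [Measure.dirac_apply' _ hG]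
    by_cases h : TreeSpace.mk ((ω.tree n).fringe (vertex n ω v v.2)) ∈ G
    · have h' : ω ∈ fringeEvent G n v := ⟨v.2, h⟩
      exact (Set.indicator_of_mem h _).trans (Set.indicator_of_mem h' (1 : ParentSeq → ℝ≥0∞)).symm
    · have h' : ω ∉ fringeEvent G n v := fun h' => h h'.2
      exact (Set.indicator_of_notMem h _).trans (Set.indicator_of_notMem h' (1 : ParentSeq → ℝ≥0∞)).symm
  simp only [h1]
  have hm := fun v => measurable_one.indicator (β := ℝ≥0∞) (measurableSet_fringeEvent G n v)
  rw [lintegral_const_mul _ (Finset.measurable_sum _ fun v _ => hm v),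
    lintegral_finsetSum _ fun v _ => hm v]
  congr 1
  exact Finset.sum_congr rfl fun v _ => lintegral_indicator_one (measurableSet_fringeEvent G n v)

end ParentSeq

/-! ### The limit law and the limiting degree in terms of plane trees. -/

namespace BPMac

/-- Finite sets of words are countably many, so the preimage of any set is a countable union of
population events, up to the default value on infinite populations. -/
lemma measurable_mk_tree (μ : Measure I) [IsProbabilityMeasure μ] (α : ℝ≥0) :
    Measurable fun p : (List ℕ → ℕ → ℝ) × ℝ => TreeSpace.mk (tree μ α p.1 p.2) := by
  intro G _
  have : (fun p : (List ℕ → ℕ → ℝ) × ℝ => TreeSpace.mk (tree μ α p.1 p.2)) ⁻¹' G =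
      {p | ∃ S ∈ {S : Finset (List ℕ) | TreeSpace.mk (wordTree S) ∈ G},
        population μ α p.1 p.2 = S} ∪
      ({p | ∃ S ∈ (Set.univ : Set (Finset (List ℕ))), population μ α p.1 p.2 = S}ᶜ ∩
        {_p | TreeSpace.mk .single ∈ G}) := by
    ext p
    rw [Set.mem_preimage, tree_eq_wordTree]
    by_cases h : (population μ α p.1 p.2).Finite
    · obtain ⟨S, hS⟩ := h.exists_finset_coe
      simp [← hS]
    · have h1 : ∀ S : Finset (List ℕ), population μ α p.1 p.2 ≠ S := fun S hS =>
        h (hS ▸ S.finite_toSet)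
      have h2 : wordTree (population μ α p.1 p.2) = .single := dif_neg fun h' => h h'.1
      simp [h1, h2]
  rw [this]
  exact (measurableSet_population_mem _).union
    ((measurableSet_population_mem _).compl.inter (MeasurableSet.const _))

instance isProbabilityMeasure_limitLaw (μ : Measure I) [IsProbabilityMeasure μ] (α : ℝ≥0) :
    IsProbabilityMeasure (limitLaw μ α) :=
  Measure.isProbabilityMeasure_map (measurable_mk_tree μ α).aemeasurable

lemma limitLaw_apply (μ : Measure I) [IsProbabilityMeasure μ] (α : ℝ≥0) {G : Set TreeSpace}
    (hG : MeasurableSet G) : limitLaw μ α G =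
      drivingLaw {p | ∃ S ∈ {S : Finset (List ℕ) | TreeSpace.mk (wordTree S) ∈ G},
        population μ α p.1 p.2 = S} := by
  rw [limitLaw, Measure.map_apply (measurable_mk_tree μ α) hG]
  refine measure_congr ?_
  filter_upwards [ae_finite_population μ α] with p hp
  obtain ⟨S, hS⟩ := hp.exists_finset_coe
  refine propext ?_
  change TreeSpace.mk (tree μ α p.1 p.2) ∈ G ↔ ∃ S ∈
    {S : Finset (List ℕ) | TreeSpace.mk (wordTree S) ∈ G}, population μ α p.1 p.2 = S
  rw [tree_eq_wordTree, ← hS]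
  simp

/-- The plane trees in which the root has `k - 1` children. -/
def rootDegreeSet (k : ℕ) : Set (Finset (List ℕ)) :=
  {S | ∃ c, ParentSeq.IsPlaneTree S c ∧ c [] + 1 = k}

lemma mem_rootDegreeSet_iff {S : Finset (List ℕ)} {c : List ℕ → ℕ} (hS : ParentSeq.IsPlaneTree S c)
    (k : ℕ) : S ∈ rootDegreeSet k ↔ c [] + 1 = k := by
  refine ⟨fun ⟨c', hc', h⟩ => ?_, fun h => ⟨c, hS, h⟩⟩
  have h1 : ∀ i, i < c [] ↔ i < c' [] := fun i => by
    have h2 := hS.cons_mem_iff i []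
    have h3 := hc'.cons_mem_iff i []
    simp only [hS.nil_mem, true_and] at h2 h3
    rw [← h2, h3]
  have h2 := h1 (c [])
  have h3 := h1 (c' [])
  omega

/-- The children of the root use only the clocks at `[]`, whose marginal law is the one in
`limitDegree`. Having k - 1 children means σ_{k-1} ≤ T_1 < σ_k. -/
lemma limitDegree_eq (μ : Measure I) [IsProbabilityMeasure μ] (α : ℝ≥0) {k : ℕ} (hk : 1 ≤ k) :
    limitDegree μ α k =
      drivingLaw.real {p | ∃ S ∈ rootDegreeSet k, population μ α p.1 p.2 = S} := by
  have hm : MeasurableSet {p : (ℕ → ℝ) × ℝ | sigma μ α p.1 (k - 1) ≤ ENNReal.ofReal p.2 ∧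
      ENNReal.ofReal p.2 < sigma μ α p.1 k} := by
    have h1 : Measurable fun p : (ℕ → ℝ) × ℝ => ENNReal.ofReal p.2 :=
      ENNReal.measurable_ofReal.comp measurable_snd
    exact (measurableSet_le ((measurable_sigma _).comp measurable_fst) h1).inter
      (measurableSet_lt h1 ((measurable_sigma _).comp measurable_fst))
  have hmp : MeasurePreserving (Prod.map (Function.eval ([] : List ℕ)) id) drivingLaw
      ((Measure.infinitePi fun _ : ℕ => expMeasure 1).prod (expMeasure 1)) :=
    (measurePreserving_eval_infinitePi
      (fun _ : List ℕ => Measure.infinitePi fun _ : ℕ => expMeasure 1) []).prod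
        (MeasurePreserving.id _)
  rw [limitDegree, ← hmp.measureReal_preimage hm.nullMeasurableSet]
  refine measureReal_congr ?_
  filter_upwards [ae_finite_population μ α] with p hp
  obtain ⟨S, hS⟩ := hp.exists_finset_coe
  obtain ⟨c, hc⟩ := exists_isPlaneTree_of_population_eq hS.symm
  have hmem : ∀ i, sigma μ α (p.1 []) i ≤ ENNReal.ofReal p.2 ↔ i ≤ c [] := by
    intro i
    cases i with
    | zero => simp [sigma_zero]
    | succ i =>
      have h1 := hc.cons_mem_iff i []
      rw [← Finset.mem_coe, hS] at h1
      simp only [hc.nil_mem, true_and] at h1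
      rw [Nat.succ_le_iff, ← h1]
      simp [population, birth]
  refine propext ?_
  change (sigma μ α (p.1 []) (k - 1) ≤ ENNReal.ofReal p.2 ∧
    ENNReal.ofReal p.2 < sigma μ α (p.1 []) k) ↔
      ∃ S ∈ rootDegreeSet k, population μ α p.1 p.2 = S
  rw [← not_le, hmem, hmem, ← hS]
  have h2 := mem_rootDegreeSet_iff hc k
  simp only [Finset.coe_inj, exists_eq_right']
  rw [h2]
  omega

end BPMac

/-! ### Convergence of the fringe and of the degree distribution. -/

namespace ParentSeq

open BPMac

lemma fringeEvent_univ {n v : ℕ} (hv : v < n + 1) : fringeEvent Set.univ n v = Set.univ :=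
  Set.eq_univ_of_forall fun _ => ⟨hv, Set.mem_univ _⟩

lemma inv_mul_sum_one (n : ℕ) :
    ((n : ℝ≥0∞) + 1)⁻¹ * ∑ _v ∈ Finset.range (n + 1), (1 : ℝ≥0∞) = 1 := by
  rw [Finset.sum_const, Finset.card_range, nsmul_eq_mul, mul_one, Nat.cast_add, Nat.cast_one]
  exact ENNReal.inv_mul_cancel (by positivity) (by finiteness)

section Random

variable {μ : Measure I} [IsProbabilityMeasure μ] {α : ℝ≥0} {Ω : Type*} [MeasurableSpace Ω]
  {P : Measure Ω} {X : Ω → ParentSeq}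

lemma expectedFringe_apply (hX : HasLaw X (networkLaw μ α) P) (n : ℕ) {G : Set TreeSpace}
    (hG : MeasurableSet G) : expectedFringe P (fun ω => (X ω).tree n) G = ((n : ℝ≥0∞) + 1)⁻¹ *
      ∑ v ∈ Finset.range (n + 1), networkLaw μ α (fringeEvent G n v) := by
  have hm : AEMeasurable (fun ω => ((X ω).tree n).empiricalFringe) P :=
    (measurable_comp_tree n FinRootedTree.empiricalFringe).comp_aemeasurable hX.aemeasurable
  rw [expectedFringe, Measure.bind_apply hG hm, ← lintegral_empiricalFringe μ α hG n]
  exact hX.lintegral_comp (f := fun ω => (tree n ω).empiricalFringe G)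
    (measurable_comp_tree n fun t => t.empiricalFringe G).aemeasurable

lemma isProbabilityMeasure_expectedFringe (hX : HasLaw X (networkLaw μ α) P) (n : ℕ) :
    IsProbabilityMeasure (expectedFringe P fun ω => (X ω).tree n) := by
  refine ⟨?_⟩
  rw [expectedFringe_apply hX n MeasurableSet.univ, Finset.sum_congr rfl fun v hv => by
    rw [fringeEvent_univ (Finset.mem_range.1 hv), measure_univ]]
  exact inv_mul_sum_one n

/-- Convergence in the expected fringe sense to the genealogical tree of the branching process. -/
theorem tendstoExpectedFringe (hX : HasLaw X (networkLaw μ α) P) :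
    TendstoExpectedFringe P (fun n ω => (X ω).tree n) (limitLaw μ α) := by
  refine ⟨isProbabilityMeasure_expectedFringe hX, isProbabilityMeasure_limitLaw μ α,
    -- Portmanteau: between probability measures, lower bounds on open sets suffice.
    tendsto_of_forall_isOpen_le_liminf_nat' fun G hG => ?_⟩
  have h : ∀ n, expectedFringe P (fun ω => (X ω).tree n) G = _ := fun n =>
    expectedFringe_apply hX n hG.measurableSet
  simp only [ProbabilityMeasure.coe_mk, h, limitLaw_apply μ α hG.measurableSet]
  refine drivingLaw_le_liminf μ α _ (fringeEvent G) fun S hS k hk n v ω hω => ?_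
  obtain ⟨f, hf, hc⟩ := Set.mem_iUnion.1 hω
  have hv : v < n + 1 := hf.nil ▸ hf.lt [] hk.nil_mem
  exact ⟨hv, mk_wordTree_eq_mk_fringe hk hf hc hv ▸ hS⟩

/-- The probability that a uniform vertex of the tree with `n + 1` vertices has degree `k` converges. -/
lemma tendsto_networkLaw_degree (μ : Measure I) [IsProbabilityMeasure μ] (α : ℝ≥0) (k : ℕ) :
    Tendsto (fun n : ℕ => ((n : ℝ≥0∞) + 1)⁻¹ * ∑ v ∈ Finset.range (n + 1),
      networkLaw μ α {ω | ω.degree v (n + 1) = k}) atTop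
        (𝓝 (drivingLaw {p | ∃ S ∈ rootDegreeSet k, population μ α p.1 p.2 = S})) := by
  have hdeg : ∀ S c, IsPlaneTree S c → ∀ n v, ∀ ω ∈ treeEvent S (n + 1) v,
      (ω.degree v (n + 1) = k ↔ S ∈ rootDegreeSet k) := by
    intro S c hc n v ω hω
    obtain ⟨f, hf, hcons⟩ := Set.mem_iUnion.1 hω
    rw [degree_of_consistent hc hf hcons, mem_rootDegreeSet_iff hc]
  have hA := drivingLaw_le_liminf μ α (rootDegreeSet k)
    (fun n v => {ω | ω.degree v (n + 1) = k})
    fun S hS c hc n v ω hω => (hdeg S c hc n v ω hω).2 hS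
  -- The same lower bound for the complement becomes the upper bound, since the two limiting events
  -- cover almost all outcomes by non-explosion.
  have hB := drivingLaw_le_liminf μ α (rootDegreeSet k)ᶜ
    (fun n v => {ω | ω.degree v (n + 1) = k}ᶜ)
    fun S hS c hc n v ω hω h => hS ((hdeg S c hc n v ω hω).1 h)
  refine tendsto_of_le_liminf_of_limsup_le hA ?_
  have hmeas : ∀ n v, MeasurableSet {ω : ParentSeq | ω.degree v (n + 1) = k} := fun n v =>
    measurable_degree v (n + 1) (measurableSet_singleton k)
  have hsub : ∀ n : ℕ, ((n : ℝ≥0∞) + 1)⁻¹ * ∑ v ∈ Finset.range (n + 1),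
      networkLaw μ α {ω | ω.degree v (n + 1) = k} = 1 - ((n : ℝ≥0∞) + 1)⁻¹ *
        ∑ v ∈ Finset.range (n + 1), networkLaw μ α {ω | ω.degree v (n + 1) = k}ᶜ := by
    intro n
    refine ENNReal.eq_sub_of_add_eq ?_ ?_
    · refine ENNReal.mul_ne_top (by simp) (ENNReal.sum_ne_top.2 fun v _ => measure_ne_top _ _)
    · rw [← mul_add, ← Finset.sum_add_distrib, Finset.sum_congr rfl fun v _ => by
        rw [measure_add_measure_compl (hmeas n v), measure_univ]]
      exact inv_mul_sum_one n
  simp only [hsub]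
  rw [ENNReal.limsup_const_sub _ _ ENNReal.one_ne_top, tsub_le_iff_right]
  refine le_trans ?_ (add_le_add_right hB _)
  rw [← measure_univ (μ := drivingLaw)]
  refine le_trans (measure_mono_ae ?_) (measure_union_le _ _)
  filter_upwards [ae_finite_population μ α] with p hp _
  obtain ⟨S, hS⟩ := hp.exists_finset_coe
  by_cases h : S ∈ rootDegreeSet k
  · exact Or.inl ⟨S, h, hS.symm⟩
  · exact Or.inr ⟨S, h, hS.symm⟩

lemma integral_degreeCount [IsProbabilityMeasure P] (hX : HasLaw X (networkLaw μ α) P) (k n : ℕ) :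
    ∫ ω, ((X ω).degreeCount k (n + 1) : ℝ) / ((n + 1 : ℕ) : ℝ) ∂P =
      (((n : ℝ≥0∞) + 1)⁻¹ * ∑ v ∈ Finset.range (n + 1),
        networkLaw μ α {ω | ω.degree v (n + 1) = k}).toReal := by
  have hmeas : ∀ v, MeasurableSet {ω : ParentSeq | ω.degree v (n + 1) = k} := fun v =>
    measurable_degree v (n + 1) (measurableSet_singleton k)
  have h1 : ∀ ω : ParentSeq, (ω.degreeCount k (n + 1) : ℝ) =
      ∑ v ∈ Finset.range (n + 1), {ω : ParentSeq | ω.degree v (n + 1) = k}.indicator 1 ω := by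
    intro ω
    rw [degreeCount, Finset.card_filter, Nat.cast_sum]
    refine Finset.sum_congr rfl fun v _ => ?_
    by_cases h : ω.degree v (n + 1) = k <;> simp [h]
  have hm : ∀ v, Measurable ({ω : ParentSeq | ω.degree v (n + 1) = k}.indicator (1 : ParentSeq → ℝ)) :=
    fun v => measurable_one.indicator (hmeas v)
  have h2 := hX.integral_comp (f := fun ω => (ω.degreeCount k (n + 1) : ℝ) / ((n + 1 : ℕ) : ℝ)) (by
    simp only [h1]
    exact ((Finset.measurable_sum _ fun v _ => hm v).div_const _).aestronglyMeasurable)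
  have hint : ∀ v, Integrable ({ω : ParentSeq | ω.degree v (n + 1) = k}.indicator
      (1 : ParentSeq → ℝ)) (networkLaw μ α) := fun v =>
    (integrable_const (1 : ℝ)).indicator (hmeas v)
  refine h2.trans ?_
  simp only [h1]
  rw [integral_div, integral_finsetSum _ fun v _ => hint v, ENNReal.toReal_mul,
    ENNReal.toReal_sum fun v _ => measure_ne_top _ _, div_eq_inv_mul, ENNReal.toReal_inv]
  congr 1
  · congr 1
    exact_mod_cast (ENNReal.toReal_natCast (n + 1)).symm
  · exact Finset.sum_congr rfl fun v _ => integral_indicator_one (hmeas v)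

/-- Convergence of the expected degree distribution. -/
theorem tendsto_integral_degreeCount [IsProbabilityMeasure P] (hX : HasLaw X (networkLaw μ α) P)
    {k : ℕ} (hk : 1 ≤ k) :
    Tendsto (fun n : ℕ => ∫ ω, ((X ω).degreeCount k n : ℝ) / n ∂P) atTop
      (𝓝 (limitDegree μ α k)) := by
  -- The index is shifted because `tree n` has n + 1 vertices.
  rw [← tendsto_add_atTop_iff_nat 1, limitDegree_eq μ α hk]
  simp only [integral_degreeCount hX]
  exact (ENNReal.tendsto_toReal (measure_ne_top _ _)).comp (tendsto_networkLaw_degree μ α k)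

end Random

end ParentSeq

theorem mainTheorem1 (μ : Measure I) [IsProbabilityMeasure μ] (α : ℝ≥0)
    {Ω : Type*} [MeasurableSpace Ω] (P : Measure Ω) [IsProbabilityMeasure P] (X : Ω → ParentSeq)
    (hX : HasLaw X (ParentSeq.networkLaw μ α) P) :
    (∀ᵐ p ∂BPMac.drivingLaw, (BPMac.population μ α p.1 p.2).Finite) ∧
    TendstoExpectedFringe P (fun n ω => (X ω).tree n) (BPMac.limitLaw μ α) ∧
    ∀ k : ℕ, 1 ≤ k →
      Tendsto (fun n : ℕ => ∫ ω, ((X ω).degreeCount k n : ℝ) / n ∂P) atTop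
        (𝓝 (BPMac.limitDegree μ α k)) :=
  ⟨BPMac.ae_finite_population μ α, ParentSeq.tendstoExpectedFringe hX,
    fun _ hk => ParentSeq.tendsto_integral_degreeCount hX hk⟩
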